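/- **Setting.** Let $\Sigma$ be a text alphabet and $(S_x)_{x\in\Pi}$ a family of character classes $S_x\subseteq\Sigma$, known in advance. It defines the matching relation $\Delta(x,a)=1$ if $a\in S_x$, and $\Delta(x,a)=0$ otherwise. $\Delta$ *contains the wildcard matrix* if the $0/1$-matrix $(\Delta(x,a))_{x\in\Pi,\,a\in\Sigma}$ has, up to permuting rows and columns, the submatrix $\begin{pmatrix}1&1\\1&0\end{pmatrix}$. In *online pattern matching with character classes* a pattern $P\in\Pi^m$ is preprocessed and is then no longer available; the letters of a text $T\in\Sigma^{\mathbb N}$ arrive one at a time, and whenever the last letter of a window $T[i],\dots,T[i+m-1]$ arrives, the algorithm outputs a bit, which should be $\bigwedge_{j=0}^{m-1}\Delta(P[j],T[i+j])$. A randomised algorithm (with private coins; random bits that are reused have to be stored) *solves the problem with probability $p$* if, for every pattern of length $m$, every text and every window, this output is correct with probability at least $p$. The space of an algorithm with set $M$ of memory states is $\log_2|M|$ bits. **Lower bound.** For every $p>1/2$ there is a constant $c>0$ such that, for all $m$, every online algorithm, even non-uniform and of unbounded computational power, that solves the problem with probability $p$ for patterns of length $m$ uses at least $cm$ bits of space,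 in each of the following two situations: (a) the alphabet $\Sigma$ has at least two letters and the classes are unrestricted, that is, all subsets of $\Sigma$ are allowed; (b) the family of classes is arbitrary with a matching relation that contains the wildcard matrix. **Upper bound.** For every $d\in\mathbb N$ and every $p<1$ there are a randomised word-RAM algorithm (one program for preprocessing and one for processing a text letter, both independent of $m$, of the alphabets and of $\Delta$, with query access to $\Delta$) and constants $s$, $C$ such that the following holds for every $m\ge 2$, with $L=s(\lfloor\log_2 m\rfloor+1)$. Run with $L$ words of memory of $L$ bits each, the algorithm uses at most $C\log^2 m$ bits of space in total, working space included; and for all finite alphabets $\Pi$, $\Sigma$ with $|\Pi|,|\Sigma|\le m^d$ and all families $(S_x)_{x\in\Pi}$ of subsets of $\Sigma$ whose matching relation does not contain the wildcard matrix, it solves the problem with probability $p$ for patterns of length $m$. -/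

import Mathlib

/-! ## The problem -/

/-- The matching relation `Δ` defined by a family of character classes: the class named `x`
matches the letter `a` iff `a` belongs to it. -/
noncomputable def classRel {κ σ : Type*} (cls : κ → Set σ) : κ → σ → Bool :=
  open Classical in fun x a => decide (a ∈ cls x)

theorem classRel_eq_true {κ σ : Type*} (cls : κ → Set σ) (x : κ) (a : σ) :
    classRel cls x a = true ↔ a ∈ cls x := by
  classical
  unfold classRel
  rw [decide_eq_true_iff]

/-- The `0/1`-matrix of a matching relation; rows are pattern symbols, columns text symbols. -/
def relMatrix {κ σ : Type*} (Δ : κ → σ → Bool) : Matrix κ σ ℕ :=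
  Matrix.of fun x a => if Δ x a then 1 else 0

/-- `M_Δ` contains the wildcard matrix as a submatrix, up to permuting rows and columns. -/
def ContainsWildcard {κ σ : Type*} (Δ : κ → σ → Bool) : Prop :=
  ∃ (f : Fin 2 ↪ κ) (g : Fin 2 ↪ σ), (relMatrix Δ).submatrix f g = !![1, 1; 1, 0]

/-- `⋀_{j < m} Δ(P[j], T[i+j])`: the value of the local pattern matching problem with operator
AND for the window of the text `T` that starts at position `i`. -/
def localAnd {κ σ : Type*} (Δ : κ → σ → Bool) {m : ℕ} (P : Fin m → κ) (T : ℕ → σ) (i : ℕ) :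
    Bool :=
  decide (∀ j : Fin m, Δ (P j) (T (i + j)) = true)

/-! ## Randomised online algorithms -/

/-- A randomised online algorithm with set `M` of memory states, patterns from `α` and text
alphabet `σ`. The pattern is seen only by `init`. When a letter arrives, `step` returns an output
bit and the new memory state; all coin tosses are private and fresh (random bits that are to be
used again have to be kept in memory). The space used is `log₂ |M|` bits. -/
structure OnlineAlgorithm (α σ M : Type*) where
  init : α → PMF M
  step : M → σ → PMF (Bool × M)

namespace OnlineAlgorithm

variable {α σ M : Type*}

/-- Distribution of the memory state after the letters `T 0, …, T (t - 1)`. -/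
noncomputable def state (A : OnlineAlgorithm α σ M) (P : α) (T : ℕ → σ) : ℕ → PMF M
  | 0 => A.init P
  | t + 1 => (A.state P T t).bind fun q => (A.step q (T t)).map Prod.snd

/-- Distribution of the output given when the letter `T t` arrives. -/
noncomputable def output (A : OnlineAlgorithm α σ M) (P : α) (T : ℕ → σ) (t : ℕ) : PMF Bool :=
  (A.state P T t).bind fun q => (A.step q (T t)).map Prod.fst

/-- For every pattern of length `m` and every text, and for each window `T[i], …, T[i+m-1]`, the
output given when the last letter `T[t]` of the window arrives is correct with probability at
least `p`. -/
def Solves {κ : Type*} {m : ℕ} (A : OnlineAlgorithm (Fin m → κ) σ M) (Δ : κ → σ → Bool)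
    (p : ℝ) : Prop :=
  ∀ (P : Fin m → κ) (T : ℕ → σ) (i t : ℕ), t + 1 = i + m →
    p ≤ (A.output P T t (localAnd Δ P T i)).toReal

end OnlineAlgorithm

/-! ## Word-RAM programs -/

/-- Memory of `N` words of `w` bits each. -/
abbrev RamMem (N w : ℕ) : Type := Fin N → Fin (2 ^ w)

namespace RamMem

variable {N w : ℕ}

/-- The memory in which every word is zero. -/
def zero (N w : ℕ) : RamMem N w := fun _ => ⟨0, Nat.two_pow_pos w⟩

/-- The word at address `i` (`0` if there is no such address). -/
def get (μ : RamMem N w) (i : ℕ) : ℕ := if h : i < N then (μ ⟨i, h⟩ : ℕ) else 0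

/-- Write `v`, truncated to `w` bits, at address `i` (no effect if there is no such address). -/
def set (μ : RamMem N w) (i v : ℕ) : RamMem N w :=
  fun j => if (j : ℕ) = i then ⟨v % 2 ^ w, Nat.mod_lt _ (Nat.two_pow_pos w)⟩ else μ j

end RamMem

/-- What a program can read besides its memory. -/
structure RamInput where
  /-- pattern length -/
  patLen : ℕ
  /-- size of the pattern alphabet -/
  numP : ℕ
  /-- size of the text alphabet -/
  numT : ℕ
  /-- the matching relation -/
  rel : ℕ → ℕ → Bool
  /-- the pattern -/
  pat : ℕ → ℕ
  /-- the text letter that has just arrived -/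
  sym : ℕ

/-- Arithmetic operations on words. Subtraction is truncated at zero, and `lt`, `eq` return
`1` or `0`. -/
inductive RamOp
  | plus | minus | times | quot | rem | lt | eq

def RamOp.eval : RamOp → ℕ → ℕ → ℕ
  | plus, a, b => a + b
  | minus, a, b => a - b
  | times, a, b => a * b
  | quot, a, b => a / b
  | rem, a, b => a % b
  | lt, a, b => if a < b then 1 else 0
  | eq, a, b => if a = b then 1 else 0

/-- Expressions. `load e` is the word at address `e` (indirect addressing is allowed); `rel x a`
queries the matching relation; `pat e` is the pattern symbol at position `e`; `sym` is the current
text letter. -/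
inductive RamExpr
  | const (k : ℕ)
  | patLen
  | numP
  | numT
  | sym
  | pat (e : RamExpr)
  | rel (x a : RamExpr)
  | load (e : RamExpr)
  | op (o : RamOp) (a b : RamExpr)

namespace RamExpr

/-- The value of an expression; every intermediate result is truncated to `w` bits. -/
def eval {N w : ℕ} (I : RamInput) (μ : RamMem N w) : RamExpr → ℕ
  | const k => k % 2 ^ w
  | patLen => I.patLen % 2 ^ w
  | numP => I.numP % 2 ^ w
  | numT => I.numT % 2 ^ w
  | sym => I.sym % 2 ^ w
  | pat e => I.pat (e.eval I μ) % 2 ^ w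
  | rel x a => (if I.rel (x.eval I μ) (a.eval I μ) then 1 else 0) % 2 ^ w
  | load e => μ.get (e.eval I μ)
  | op o a b => o.eval (a.eval I μ) (b.eval I μ) % 2 ^ w

/-- Number of nodes. -/
def size : RamExpr → ℕ
  | const _ | patLen | numP | numT | sym => 1
  | pat e => e.size + 1
  | rel x a => x.size + a.size + 1
  | load e => e.size + 1
  | op _ a b => a.size + b.size + 1

end RamExpr

/-- Structured programs. `store a e` writes the value of `e` at address `a`; `rand a` writes a
uniformly random word at address `a`; `ite e c d` runs `c` if `e` is nonzero and `d` otherwise;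
`loop e c` evaluates `e` once and runs `c` that many times. All programs halt. -/
inductive RamCmd
  | skip
  | store (a e : RamExpr)
  | rand (a : RamExpr)
  | seq (c d : RamCmd)
  | ite (e : RamExpr) (c d : RamCmd)
  | loop (e : RamExpr) (c : RamCmd)

namespace RamCmd

/-- The distribution of the memory contents after running a program. -/
noncomputable def run {N w : ℕ} (I : RamInput) : RamCmd → RamMem N w → PMF (RamMem N w)
  | skip, μ => PMF.pure μ
  | store a e, μ => PMF.pure (μ.set (a.eval I μ) (e.eval I μ))
  | rand a, μ =>
      haveI : Nonempty (Fin (2 ^ w)) := ⟨⟨0, Nat.two_pow_pos w⟩⟩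
      (PMF.uniformOfFintype (Fin (2 ^ w))).map fun v => μ.set (a.eval I μ) v
  | seq c d, μ => (run I c μ).bind (run I d)
  | ite e c d, μ => if e.eval I μ ≠ 0 then run I c μ else run I d μ
  | loop e c, μ => (fun ν => ν.bind (run I c))^[e.eval I μ] (PMF.pure μ)

/-- Number of nodes. -/
def size : RamCmd → ℕ
  | skip => 1
  | store a e => a.size + e.size + 1
  | rand a => a.size + 1
  | seq c d => c.size + d.size + 1
  | ite e c d => e.size + c.size + d.size + 1
  | loop e c => e.size + c.size + 1

end RamCmd

/-- A pattern matching algorithm on the word RAM: `pre` is run once, with access to the pattern,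
and `step` is run, without access to the pattern, for each text letter. -/
structure RamAlgorithm where
  pre : RamCmd
  step : RamCmd

namespace RamAlgorithm

/-- Bits of space used when the memory has `N` words of `w` bits. Besides the memory, one word is
charged for each node of the programs; this pays for the loop counters and for the intermediate
values of expressions. -/
def space (R : RamAlgorithm) (N w : ℕ) : ℕ := (N + R.pre.size + R.step.size) * w

/-- The online algorithm for patterns of length `m` over the pattern alphabet `{0, …, k-1}` and
texts over `{0, …, n-1}`, with matching relation `Δ`, executed with `N` words of `w` bits. The
output is `true` iff the word at address `0` is nonzero after `step`. -/
noncomputable def toOnline (R : RamAlgorithm) (N w : ℕ) (m : ℕ) {k n : ℕ}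
    (Δ : Fin k → Fin n → Bool) : OnlineAlgorithm (Fin m → Fin k) (Fin n) (RamMem N w) :=
  let rel : ℕ → ℕ → Bool := fun x a => if h : x < k ∧ a < n then Δ ⟨x, h.1⟩ ⟨a, h.2⟩ else false
  { init := fun P =>
      R.pre.run
        { patLen := m, numP := k, numT := n, rel := rel,
          pat := fun i => if h : i < m then (P ⟨i, h⟩ : ℕ) else 0,
          sym := 0 }
        (RamMem.zero N w)
    step := fun μ a =>
      (R.step.run
        { patLen := m, numP := k, numT := n, rel := rel,
          pat := fun _ => 0,
          sym := a } μ).map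
        fun μ' => (decide (μ'.get 0 ≠ 0), μ') }

end RamAlgorithm

/-! Lower bound. Let `x`, `y`, `a`, `b` witness the wildcard matrix: `a` is matched by `x` and `y`,
while `b` is matched by `x` only. Write a bit string `z` as a pattern, with `x` for 1 and `y` for 0.
On the text that has `b` at position `j` and `a` everywhere else, the first window matches iff `z j`
is 1. So the memory state left by the preprocessing is a random access code: any single bit of `z`
can be recovered from it with probability `p = 1/2 + δ`. By averaging, every `z` has a state from
which its bits are recovered with mean success at least `1/2 + δ`, and an exponential moment
(Hoeffding) bound shows that one state can serve only few strings, so there are at least `exp (2 δ²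
m)` states (`card_ge_of_randomAccessCode`).

Upper bound. Without the wildcard matrix, classes that meet coincide. Giving each class a number
turns the problem into exact matching of codes (`textCode_eq_patCode_iff`), which is solved by
Karp–Rabin fingerprints together with periodicity. Take prefix lengths that grow by a factor of
about 3/2 up to `m`, hence `O(log m)` levels. Level `s` holds the positions at which the prefix of
length `ℓ_s` has been found and the prefix of length `ℓ_{s+1}` is not yet complete. These positions
lie within distance `ℓ_s / 2` of each other, so they form an arithmetic progression whose difference
is the least period of the prefix (`Occurs.add_period`, `IsProgression.push`). Hence the first and
last position and the fingerprint of the text before the first one describe the whole level. When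
the longer prefix of the first position is complete, one fingerprint comparison decides whether the
position moves up (`wp_moveUp`).

A false positive makes the seed a root of a nonzero polynomial of degree at most `m`, so a union
bound over positions and lengths leaves few bad seeds (`card_not_goodSeed_le`). To keep this bound
independent of the length of the text, two copies run with a shift of `m`, each restarted after `2m`
letters. Every window then lies inside one run of one copy, which alone reports it
(`IsRun.out_iff`).

The programs are written in a small language with named arrays and exact arithmetic. A
weakest-precondition calculus (`ACmd.Wp`) proves correctness and absence of overflow together, and
`ACmd.run_compile` transfers the result to the word RAM. Only the seed is random, so the output is
the image of a uniform word under a deterministic map. -/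

/-! ### Lower bound: the memory state as a message -/

namespace OnlineAlgorithm

variable {α σ M : Type*}

/-- Distribution of the memory state when the algorithm is started in the state `q`. -/
noncomputable def stateFrom (A : OnlineAlgorithm α σ M) (T : ℕ → σ) (q : M) : ℕ → PMF M
  | 0 => PMF.pure q
  | t + 1 => (A.stateFrom T q t).bind fun q => (A.step q (T t)).map Prod.snd

theorem state_eq_bind_stateFrom (A : OnlineAlgorithm α σ M) (P : α) (T : ℕ → σ) (t : ℕ) :
    A.state P T t = (A.init P).bind fun q => A.stateFrom T q t := by
  induction t with
  | zero => simp [state, stateFrom, PMF.bind_pure]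
  | succ t ih => simp [state, stateFrom, ih, PMF.bind_bind]

/-- Distribution of the output at time `t` when the algorithm is started in the state `q`. -/
noncomputable def outputFrom (A : OnlineAlgorithm α σ M) (T : ℕ → σ) (t : ℕ) (q : M) : PMF Bool :=
  (A.stateFrom T q t).bind fun q => (A.step q (T t)).map Prod.fst

/-- The pattern enters only through the initial state: `A.init` is the encoder, and `A.outputFrom`
is a decoder that knows the text but not the pattern. -/
theorem output_eq_bind_outputFrom (A : OnlineAlgorithm α σ M) (P : α) (T : ℕ → σ) (t : ℕ) :
    A.output P T t = (A.init P).bind (A.outputFrom T t) := by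
  simp only [output, state_eq_bind_stateFrom, PMF.bind_bind]
  rfl

end OnlineAlgorithm

/-! ### Lower bound: random access codes -/

theorem PMF.sum_toReal_eq_one {M : Type*} [Fintype M] (μ : PMF M) : ∑ q, (μ q).toReal = 1 := by
  rw [← ENNReal.toReal_sum (fun q _ => μ.apply_ne_top q), ← tsum_fintype (L := .unconditional _), μ.tsum_coe,
    ENNReal.toReal_one]

theorem PMF.bind_toReal {M β : Type*} [Fintype M] (μ : PMF M) (h : M → PMF β) (b : β) :
    (μ.bind h b).toReal = ∑ q, (μ q).toReal * (h q b).toReal := by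
  rw [PMF.bind_apply, tsum_fintype, ENNReal.toReal_sum]
  · simp only [ENNReal.toReal_mul]
  · exact fun q _ => ENNReal.mul_ne_top (μ.apply_ne_top q) ((h q).apply_ne_top b)

/-- Hoeffding's lemma for a fair coin: factoring out `exp (l / 2)` leaves `2 cosh (l (h - 1/2))`.
Then use `cosh x ≤ exp (x² / 2)` and `|h - 1/2| ≤ 1/2`. -/
theorem exp_add_exp_one_sub_le {l h : ℝ} (h0 : 0 ≤ h) (h1 : h ≤ 1) :
    Real.exp (l * h) + Real.exp (l * (1 - h)) ≤ 2 * Real.exp (l / 2 + l ^ 2 / 8) := by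
  have e : Real.exp (l * h) + Real.exp (l * (1 - h))
      = 2 * (Real.exp (l / 2) * Real.cosh (l * (h - 1 / 2))) := by
    rw [Real.cosh_eq]
    have a : Real.exp (l * h) = Real.exp (l / 2) * Real.exp (l * (h - 1 / 2)) := by
      rw [← Real.exp_add]; congr 1; ring
    have b : Real.exp (l * (1 - h)) = Real.exp (l / 2) * Real.exp (-(l * (h - 1 / 2))) := by
      rw [← Real.exp_add]; congr 1; ring
    rw [a, b]; ring
  rw [e, Real.exp_add]
  gcongr
  refine (Real.cosh_le_exp_half_sq _).trans (Real.exp_le_exp.2 ?_)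
  have : (h - 1 / 2) ^ 2 ≤ 1 / 4 := by nlinarith
  nlinarith [sq_nonneg l]

/-- A random access code that recovers each of `m` bits with probability at least `1 / 2 + δ`
has at least `exp (2 δ² m)` code words. -/
theorem card_ge_of_randomAccessCode {m : ℕ} {M : Type*} [Fintype M]
    (E : (Fin m → Bool) → PMF M) (h : Fin m → M → PMF Bool) {δ : ℝ} (hδ : 0 < δ)
    (hE : ∀ z j, 1 / 2 + δ ≤ ((E z).bind (h j) (z j)).toReal) :
    Real.exp (2 * δ ^ 2 * m) ≤ Fintype.card M := by
  classical
  -- The expected number of correctly recovered bits is at least `(1/2 + δ) m`, so some code word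
  -- reaches this mean.
  have key : ∀ z : Fin m → Bool, ∃ q, (1 / 2 + δ) * m ≤ ∑ j, (h j q (z j)).toReal := by
    intro z
    by_contra! hc
    have h1 : ∑ q, (E z q).toReal * ∑ j, (h j q (z j)).toReal
        < ∑ q, (E z q).toReal * ((1 / 2 + δ) * m) := by
      obtain ⟨q, hq⟩ := (E z).support_nonempty
      refine Finset.sum_lt_sum (fun q _ => by gcongr; exact (hc q).le) ⟨q, Finset.mem_univ _, ?_⟩
      have : 0 < (E z q).toReal := ENNReal.toReal_pos hq ((E z).apply_ne_top q)
      gcongr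
      exact hc q
    rw [← Finset.sum_mul, PMF.sum_toReal_eq_one, one_mul] at h1
    have h2 : ∑ q, (E z q).toReal * ∑ j, (h j q (z j)).toReal
        = ∑ j, ((E z).bind (h j) (z j)).toReal := by
      simp only [PMF.bind_toReal, Finset.mul_sum]
      rw [Finset.sum_comm]
    have h3 : ∑ _j : Fin m, (1 / 2 + δ) ≤ ∑ j, ((E z).bind (h j) (z j)).toReal :=
      Finset.sum_le_sum fun j _ => hE z j
    simp only [Finset.sum_const, Finset.card_univ, Fintype.card_fin, nsmul_eq_mul] at h3
    linarith
  choose c hc using key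
  -- For a fixed code word the sum over all strings factors over the coordinates, and each factor is
  -- bounded by Hoeffding's lemma.
  have hq : ∀ q, ∑ z : Fin m → Bool, Real.exp (4 * δ * ∑ j, (h j q (z j)).toReal)
      ≤ (2 * Real.exp (4 * δ / 2 + (4 * δ) ^ 2 / 8)) ^ m := by
    intro q
    have e : ∑ z : Fin m → Bool, Real.exp (4 * δ * ∑ j, (h j q (z j)).toReal)
        = ∏ j, ∑ b, Real.exp (4 * δ * (h j q b).toReal) := by
      rw [Finset.prod_univ_sum, Fintype.piFinset_univ]
      simp only [Finset.mul_sum, Real.exp_sum]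
    rw [e]
    calc _ ≤ ∏ _j : Fin m, 2 * Real.exp (4 * δ / 2 + (4 * δ) ^ 2 / 8) := by
          refine Finset.prod_le_prod (fun j _ => by positivity) fun j _ => ?_
          have hs := (h j q).sum_toReal_eq_one
          simp only [Fintype.sum_bool] at hs ⊢
          have : ((h j q) false).toReal = 1 - ((h j q) true).toReal := by linarith
          rw [this]
          refine exp_add_exp_one_sub_le ENNReal.toReal_nonneg ?_
          linarith [ENNReal.toReal_nonneg (a := (h j q) false)]
      _ = _ := by simp
  -- With parameter `λ`, the gain per coordinate is `λ δ - λ² / 8`. It is maximal at `λ = 4 δ`,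
  -- where it equals `2 δ²`.
  have hsum : (2 : ℝ) ^ m * Real.exp (4 * δ * ((1 / 2 + δ) * m))
      ≤ Fintype.card M * (2 * Real.exp (4 * δ / 2 + (4 * δ) ^ 2 / 8)) ^ m := by
    calc (2 : ℝ) ^ m * Real.exp (4 * δ * ((1 / 2 + δ) * m))
        = ∑ _z : Fin m → Bool, Real.exp (4 * δ * ((1 / 2 + δ) * m)) := by simp
      _ ≤ ∑ z : Fin m → Bool, ∑ q, Real.exp (4 * δ * ∑ j, (h j q (z j)).toReal) := by
          refine Finset.sum_le_sum fun z _ => ?_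
          refine le_trans ?_ (Finset.single_le_sum
            (f := fun q => Real.exp (4 * δ * ∑ j, (h j q (z j)).toReal))
            (fun q _ => (Real.exp_pos _).le) (Finset.mem_univ (c z)))
          exact Real.exp_le_exp.2 (by gcongr; exact hc z)
      _ ≤ ∑ _q : M, (2 * Real.exp (4 * δ / 2 + (4 * δ) ^ 2 / 8)) ^ m := by
          rw [Finset.sum_comm]
          exact Finset.sum_le_sum fun q _ => hq q
      _ = _ := by simp
  rw [mul_pow, ← Real.exp_nat_mul, mul_left_comm (Fintype.card M : ℝ)] at hsum
  have h2 := le_of_mul_le_mul_left hsum (by positivity)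
  have e : 4 * δ * ((1 / 2 + δ) * m) = 2 * δ ^ 2 * m + m * (4 * δ / 2 + (4 * δ) ^ 2 / 8) := by ring
  rw [e, Real.exp_add] at h2
  exact le_of_mul_le_mul_right h2 (Real.exp_pos _)

/-! ### Lower bound: reduction from random access codes -/

theorem ContainsWildcard.exists_letters {κ σ : Type*} {Δ : κ → σ → Bool}
    (h : ContainsWildcard Δ) :
    ∃ x y a b, Δ x a = true ∧ Δ x b = true ∧ Δ y a = true ∧ Δ y b = false := by
  obtain ⟨f, g, h⟩ := h
  have e := fun i j => congrFun (congrFun h i) j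
  refine ⟨f 0, f 1, g 0, g 1, ?_, ?_, ?_, ?_⟩
  · simpa [relMatrix] using e 0 0
  · simpa [relMatrix] using e 0 1
  · simpa [relMatrix] using e 1 0
  · simpa [relMatrix] using e 1 1

/-- The memory state encodes the string that chooses between `x` and `y` at each pattern position.
Running the algorithm on a text with a single `b` reads off one bit. -/
theorem OnlineAlgorithm.Solves.le_logb_card {m : ℕ} {κ σ M : Type*} [Fintype M]
    {Δ : κ → σ → Bool} (hΔ : ContainsWildcard Δ) {A : OnlineAlgorithm (Fin m → κ) σ M} {δ : ℝ}
    (hδ : 0 < δ) (hA : A.Solves Δ (1 / 2 + δ)) :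
    2 * δ ^ 2 / Real.log 2 * m ≤ Real.logb 2 (Fintype.card M) := by
  obtain ⟨x, y, a, b, hxa, hxb, hya, hyb⟩ := hΔ.exists_letters
  -- No window can be used as below for `m = 0`, where nonnegativity suffices; for an empty state
  -- set it holds because `Real.logb 2 0 = 0`.
  rcases m with - | m
  · simp only [Nat.cast_zero, mul_zero]
    rcases Nat.eq_zero_or_pos (Fintype.card M) with h | h
    · simp [h]
    · exact Real.logb_nonneg (by norm_num) (by exact_mod_cast h)
  -- The decoder of bit `j` feeds the text with `b` at position `j` and `a` elsewhere; the other
  -- positions match whatever the pattern is.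
  have key := card_ge_of_randomAccessCode (m := m + 1) (M := M)
    (fun z => A.init fun j => if z j then x else y)
    (fun j => A.outputFrom (fun s => if s = (j : ℕ) then b else a) m) hδ (by
      intro z j
      have h := hA (fun j => if z j then x else y) (fun s => if s = (j : ℕ) then b else a) 0 m
        (by simp)
      rw [OnlineAlgorithm.output_eq_bind_outputFrom] at h
      convert h using 3
      simp only [localAnd, zero_add]
      rcases hz : z j with _ | _
      · refine (decide_eq_false fun hall => ?_).symm
        simpa [hz, hyb] using hall j
      · refine (decide_eq_true fun i => ?_).symm
        by_cases hij : (i : ℕ) = j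
        · rw [Fin.ext hij, hz]; simp [hxb]
        · rw [if_neg hij]; split <;> assumption)
  have h2 := Real.log_le_log (Real.exp_pos _) key
  rw [Real.log_exp] at h2
  rw [Real.logb, div_mul_eq_mul_div]
  exact div_le_div_of_nonneg_right h2 (Real.log_nonneg (by norm_num))

theorem containsWildcard_classRel_id {σ : Type*} [Nontrivial σ] :
    ContainsWildcard (classRel (id : Set σ → Set σ)) := by
  obtain ⟨a, b, hab⟩ := exists_pair_ne σ
  have hu : (Set.univ : Set σ) ≠ {a} := fun h =>
    hab.symm (by have := Set.mem_univ b; rwa [h] at this)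
  refine ⟨⟨![Set.univ, {a}], ?_⟩, ⟨![a, b], ?_⟩, ?_⟩
  · intro i j; fin_cases i <;> fin_cases j <;> simp [hu, hu.symm]
  · intro i j; fin_cases i <;> fin_cases j <;> simp [hab, hab.symm]
  · ext i j
    fin_cases i <;> fin_cases j
    · exact if_pos ((classRel_eq_true id Set.univ a).2 (Set.mem_univ a))
    · exact if_pos ((classRel_eq_true id Set.univ b).2 (Set.mem_univ b))
    · exact if_pos ((classRel_eq_true id {a} a).2 rfl)
    · exact if_neg fun h => hab.symm ((classRel_eq_true id {a} b).1 h)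

/-! ## Occurrences and periods -/

/-- The word `v 0 … v (ℓ - 1)` occurs in `u` at position `q`. -/
def Occurs (u v : ℕ → ℕ) (ℓ q : ℕ) : Prop := ∀ x < ℓ, u (q + x) = v x

/-- `p` is a period of the word `v 0 … v (ℓ - 1)`. -/
def IsWordPeriod (v : ℕ → ℕ) (ℓ p : ℕ) : Prop := ∀ x, x + p < ℓ → v x = v (x + p)

/-- `p` is the least positive period of the word `v 0 … v (ℓ - 1)`. -/
structure IsLeastWordPeriod (v : ℕ → ℕ) (ℓ p : ℕ) : Prop where
  pos : 0 < p
  isPeriod : IsWordPeriod v ℓ p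
  le_of_isPeriod : ∀ d, 0 < d → IsWordPeriod v ℓ d → p ≤ d

theorem IsWordPeriod.self (v : ℕ → ℕ) (ℓ : ℕ) : IsWordPeriod v ℓ ℓ := fun x hx => by omega

theorem Occurs.mono {u v : ℕ → ℕ} {ℓ ℓ' q : ℕ} (h : Occurs u v ℓ' q) (hl : ℓ ≤ ℓ') :
    Occurs u v ℓ q := fun x hx => h x (by omega)

/-- If `x` is at least `p`, go back by `p` and forward by `d`. Otherwise `x + d < ℓ` because `p + d
≤ ℓ`, and both letters equal `v (x + d)`. -/
theorem IsWordPeriod.sub {v : ℕ → ℕ} {ℓ p d : ℕ} (hp : IsWordPeriod v ℓ p)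
    (hd : IsWordPeriod v ℓ d) (hpd : p ≤ d) (hl : p + d ≤ ℓ) : IsWordPeriod v ℓ (d - p) := by
  intro x hx
  by_cases h : p ≤ x
  · have h1 := hp (x - p) (by omega)
    have h2 := hd (x - p) (by omega)
    rw [Nat.sub_add_cancel h] at h1
    rw [← h1, h2]; congr 1; omega
  · rw [hd x (by omega), hp (x + (d - p)) (by omega)]; congr 1; omega

theorem IsWordPeriod.eq_add_mul {v : ℕ → ℕ} {ℓ p : ℕ} (hp : IsWordPeriod v ℓ p) (k x : ℕ)
    (hx : x + k * p < ℓ) : v x = v (x + k * p) := by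
  induction k with
  | zero => simp
  | succ k ih =>
    rw [add_mul, one_mul, ← add_assoc] at hx ⊢
    rw [ih (by omega), hp _ hx]

theorem IsLeastWordPeriod.le {v : ℕ → ℕ} {ℓ p : ℕ} (hp : IsLeastWordPeriod v ℓ p) (hl : 0 < ℓ) :
    p ≤ ℓ := hp.le_of_isPeriod ℓ hl (.self v ℓ)

/-- Weak form of the periodicity lemma of Fine and Wilf, by subtractive Euclid: `d - p` is again a
period, and no positive period is below `p`. -/
theorem IsLeastWordPeriod.dvd {v : ℕ → ℕ} {ℓ p d : ℕ} (hp : IsLeastWordPeriod v ℓ p)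
    (hd : IsWordPeriod v ℓ d) (hl : p + d ≤ ℓ) : p ∣ d := by
  induction d using Nat.strong_induction_on with
  | _ d ih =>
    rcases Nat.eq_zero_or_pos d with rfl | h0
    · exact dvd_zero p
    have h1 := hp.le_of_isPeriod d h0 hd
    have h2 := ih (d - p) (by have := hp.pos; omega) (hp.isPeriod.sub hd h1 hl) (by omega)
    rw [← Nat.sub_add_cancel h1]
    exact dvd_add h2 dvd_rfl

theorem Occurs.isWordPeriod {u v : ℕ → ℕ} {ℓ a d : ℕ} (ha : Occurs u v ℓ a)
    (hb : Occurs u v ℓ (a + d)) : IsWordPeriod v ℓ d := by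
  intro x hx
  rw [← hb x (by omega), ← ha (x + d) hx]; congr 1; omega

/-- Two occurrences at a distance of at most half the length differ by a multiple of the least
period, and the first one can be shifted by the period. -/
theorem Occurs.add_period {u v : ℕ → ℕ} {ℓ a d p : ℕ} (ha : Occurs u v ℓ a)
    (hb : Occurs u v ℓ (a + d)) (hp : IsLeastWordPeriod v ℓ p) (hd : 0 < d) (hl : 2 * d ≤ ℓ) :
    p ∣ d ∧ p ≤ d ∧ Occurs u v ℓ (a + p) := by
  have hper := ha.isWordPeriod hb
  have hpd := hp.le_of_isPeriod d hd hper
  have hdvd := hp.dvd hper (by omega)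
  refine ⟨hdvd, hpd, fun x hx => ?_⟩
  obtain ⟨k, rfl⟩ := hdvd
  obtain ⟨k, rfl⟩ : ∃ j, k = j + 1 := ⟨k - 1, by rcases k with - | k <;> simp_all⟩
  by_cases h : p + x < ℓ
  · rw [add_assoc, ha _ h, hp.isPeriod x (by omega)]; congr 1; omega
  · have e : p * (k + 1) = k * p + p := by ring
    rw [e] at hb hl hpd
    -- The letter lies beyond the first occurrence, hence in the second one, at the offset `x - k *
    -- p`, which carries the same letter as `x` by periodicity.
    have h1 := hb (x - k * p) (by omega)
    have h2 := hp.isPeriod.eq_add_mul k (x - k * p) (by omega)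
    rw [Nat.sub_add_cancel (by omega)] at h2
    rw [← h2, ← h1]; congr 1; omega

/-! ## Arithmetic progressions of candidates -/

/-- The positions `q` at which the prefix of length `ℓ` occurs, with its last letter before time
`lo`, and for which the prefix of length `ℓ'` would end after time `hi`. -/
def Candidate (u v : ℕ → ℕ) (ℓ ℓ' lo hi q : ℕ) : Prop :=
  Occurs u v ℓ q ∧ q + ℓ ≤ lo ∧ hi < q + ℓ'

/-- The set `S` is empty and `e = 0`, or `e = 1` and `S` is the arithmetic progression from `a` to
`b` with difference `p`; in the second case `g` is the value of `F` at `a`. -/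
def IsProgression (S : ℕ → Prop) (p : ℕ) (F : ℕ → ℕ) (e a b g : ℕ) : Prop :=
  (e = 0 ∧ ∀ q, ¬ S q) ∨
    (e = 1 ∧ g = F a ∧ ∃ c, b = a + c * p ∧ ∀ q, S q ↔ ∃ i ≤ c, q = a + i * p)

theorem IsProgression.congr {S S' : ℕ → Prop} {p : ℕ} {F : ℕ → ℕ} {e a b g : ℕ}
    (h : IsProgression S p F e a b g) (hS : ∀ q, S q ↔ S' q) : IsProgression S' p F e a b g := by
  have : S = S' := funext fun q => propext (hS q)
  rwa [← this]

theorem IsProgression.first_mem {S : ℕ → Prop} {p : ℕ} {F : ℕ → ℕ} {e a b g : ℕ}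
    (h : IsProgression S p F e a b g) (he : e ≠ 0) : S a := by
  rcases h with ⟨h, -⟩ | ⟨-, -, c, -, h⟩
  · exact absurd h he
  · exact (h a).2 ⟨0, Nat.zero_le _, by simp⟩

theorem IsProgression.first_le {S : ℕ → Prop} {p : ℕ} {F : ℕ → ℕ} {e a b g q : ℕ}
    (h : IsProgression S p F e a b g) (hq : S q) : e = 1 ∧ a ≤ q := by
  rcases h with ⟨-, h⟩ | ⟨h1, -, c, -, h⟩
  · exact absurd hq (h q)
  · obtain ⟨i, -, rfl⟩ := (h q).1 hq
    exact ⟨h1, Nat.le_add_right _ _⟩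

section Candidate

variable {u v F : ℕ → ℕ} {ℓ ℓ' t p e a b g : ℕ}

/-- The candidate whose time has come is the first one. -/
theorem IsProgression.first_eq (h : IsProgression (Candidate u v ℓ ℓ' t t) p F e a b g)
    (hl : ℓ < ℓ') {q : ℕ} (hq : Occurs u v ℓ q) (hqt : q + ℓ' = t + 1) : e = 1 ∧ a = q := by
  obtain ⟨he, hle⟩ := h.first_le (q := q) ⟨hq, by omega, by omega⟩
  have := (h.first_mem (by omega)).2.2
  exact ⟨he, by omega⟩

/-- Advancing `hi` can drop only the position with `q + ℓ' = t + 1`, and by `first_eq` that would be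
the first candidate. -/
theorem IsProgression.keep (h : IsProgression (Candidate u v ℓ ℓ' t t) p F e a b g)
    (hl : ℓ < ℓ') (hc : ¬ (e ≠ 0 ∧ a + ℓ' = t + 1)) :
    IsProgression (Candidate u v ℓ ℓ' t (t + 1)) p F e a b g := by
  refine h.congr fun q => ⟨fun ⟨h1, h2, h3⟩ => ⟨h1, h2, ?_⟩, fun ⟨h1, h2, h3⟩ =>
    ⟨h1, h2, by omega⟩⟩
  by_contra h4
  obtain ⟨he, ha⟩ := h.first_eq hl h1 (by omega)
  exact hc ⟨by omega, by omega⟩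

/-- `a = b` forces the progression to have one element. The other fields are arbitrary, as they mean
nothing for an empty set. -/
theorem IsProgression.pop_last (h : IsProgression (Candidate u v ℓ ℓ' t t) p F e a b g)
    (hp : 0 < p) (he : e ≠ 0) (hc : a + ℓ' = t + 1) (hab : a = b) (a' b' g' : ℕ) :
    IsProgression (Candidate u v ℓ ℓ' t (t + 1)) p F 0 a' b' g' := by
  refine Or.inl ⟨rfl, fun q ⟨h1, h2, h3⟩ => ?_⟩
  rcases h with ⟨h, -⟩ | ⟨-, -, c, hb, h⟩
  · exact he h
  obtain ⟨i, hi, rfl⟩ := (h q).1 ⟨h1, h2, by omega⟩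
  have : c * p = 0 := by omega
  have hc0 : c = 0 := by simpa [hp.ne'] using this
  obtain rfl : i = 0 := by omega
  simp at h3
  omega

/-- The new value `g'` has to be computed from `g`. The hypothesis `hg` may use that `a` and `a + p`
are both candidates, which is what determines the text between them. -/
theorem IsProgression.pop (h : IsProgression (Candidate u v ℓ ℓ' t t) p F e a b g)
    (hp : 0 < p) (he : e ≠ 0) (hc : a + ℓ' = t + 1) (hab : a ≠ b) {g' : ℕ}
    (hg : Candidate u v ℓ ℓ' t t a → Candidate u v ℓ ℓ' t t (a + p) → g = F a → g' = F (a + p)) :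
    IsProgression (Candidate u v ℓ ℓ' t (t + 1)) p F e (a + p) b g' := by
  rcases h with ⟨h, -⟩ | ⟨h1, hg1, c, hb, h⟩
  · exact absurd h he
  obtain ⟨c, rfl⟩ : ∃ c', c = c' + 1 := ⟨c - 1, by rcases c with - | c <;> simp_all⟩
  refine Or.inr ⟨h1, hg ((h _).2 ⟨0, by omega, by simp⟩) ((h _).2 ⟨1, by omega, by simp⟩) hg1,
    c, by rw [hb]; ring, fun q => ⟨fun ⟨h1, h2, h3⟩ => ?_, ?_⟩⟩
  · obtain ⟨i, hi, rfl⟩ := (h q).1 ⟨h1, h2, by omega⟩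
    obtain ⟨i, rfl⟩ : ∃ i', i = i' + 1 := ⟨i - 1, by
      rcases i with - | i
      · simp at h3; omega
      · simp⟩
    exact ⟨i, by omega, by ring⟩
  · rintro ⟨i, hi, rfl⟩
    have := (h (a + p + i * p)).2 ⟨i + 1, by omega, by ring⟩
    exact ⟨this.1, this.2.1, by omega⟩

theorem IsProgression.no_push (h : IsProgression (Candidate u v ℓ ℓ' t (t + 1)) p F e a b g)
    (hc : ∀ q, q + ℓ = t + 1 → ¬ Occurs u v ℓ q) :
    IsProgression (Candidate u v ℓ ℓ' (t + 1) (t + 1)) p F e a b g := by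
  refine h.congr fun q => ⟨fun ⟨h1, h2, h3⟩ => ⟨h1, by omega, h3⟩, fun ⟨h1, h2, h3⟩ =>
    ⟨h1, ?_, h3⟩⟩
  by_contra h4
  exact hc q (by omega) h1

theorem IsProgression.push_empty
    (h : IsProgression (Candidate u v ℓ ℓ' t (t + 1)) p F e a b g) (he : e = 0) (hl : ℓ < ℓ')
    {x : ℕ} (hx : Occurs u v ℓ x) (hxt : x + ℓ = t + 1) :
    IsProgression (Candidate u v ℓ ℓ' (t + 1) (t + 1)) p F 1 x x (F x) := by
  rcases h with ⟨-, h⟩ | ⟨h1, -⟩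
  · refine Or.inr ⟨rfl, rfl, 0, by simp, fun q => ⟨fun ⟨h1, h2, h3⟩ => ?_, ?_⟩⟩
    · refine ⟨0, le_rfl, ?_⟩
      by_contra h4
      exact h q ⟨h1, by omega, h3⟩
    · rintro ⟨i, hi, rfl⟩
      obtain rfl : i = 0 := by omega
      exact ⟨by simpa using hx, by omega, by omega⟩
  · omega

/-- By `hl'` the last candidate and the new one are at distance at most `ℓ / 2`. Periodicity then
leaves only the distance `p`, so the new position continues the progression; the first position and
its value stay. -/
theorem IsProgression.push
    (h : IsProgression (Candidate u v ℓ ℓ' t (t + 1)) p F e a b g) (he : e ≠ 0) (hl : ℓ < ℓ')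
    (hl' : ℓ' ≤ ℓ + ℓ / 2 + 1) (hp : IsLeastWordPeriod v ℓ p)
    {x : ℕ} (hx : Occurs u v ℓ x) (hxt : x + ℓ = t + 1) :
    IsProgression (Candidate u v ℓ ℓ' (t + 1) (t + 1)) p F 1 a x g := by
  rcases h with ⟨h, -⟩ | ⟨-, hg1, c, hb, h⟩
  · exact absurd h he
  have hlast := (h b).2 ⟨c, le_rfl, hb⟩
  obtain ⟨d, rfl⟩ : ∃ d, x = b + d := ⟨x - b, by have := hlast.2; omega⟩
  have hd := hlast.2
  obtain ⟨-, hpd, hocc⟩ := hlast.1.add_period hx hp (by omega) (by omega)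
  -- Otherwise `b + p` would be a candidate strictly between the last one and the new one.
  have hdp : d = p := by
    by_contra hne
    obtain ⟨i, hi, hbi⟩ := (h (b + p)).1 ⟨hocc, by omega, by omega⟩
    have := Nat.mul_le_mul_right p hi
    have := hp.pos
    omega
  subst hdp
  refine Or.inr ⟨rfl, hg1, c + 1, by rw [hb]; ring, fun q => ⟨fun ⟨h1, h2, h3⟩ => ?_, ?_⟩⟩
  · by_cases hq : q + ℓ ≤ t
    · obtain ⟨i, hi, rfl⟩ := (h q).1 ⟨h1, hq, h3⟩
      exact ⟨i, by omega, rfl⟩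
    · exact ⟨c + 1, le_rfl, by rw [add_mul]; omega⟩
  · rintro ⟨i, hi, rfl⟩
    rcases Nat.lt_or_ge c i with hci | hci
    · obtain rfl : i = c + 1 := by omega
      have : a + (c + 1) * d = b + d := by rw [hb]; ring
      rw [this]
      exact ⟨hx, by omega, by omega⟩
    · have := (h _).2 ⟨i, hci, rfl⟩
      exact ⟨this.1, by have := this.2; omega, this.2.2⟩

end Candidate

/-! ## Fingerprints -/

/-- The Karp–Rabin fingerprint of `u 0 … u (q - 1)`. -/
def fingerprint (r Q : ℕ) (u : ℕ → ℕ) : ℕ → ℕ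
  | 0 => 0
  | q + 1 => (fingerprint r Q u q * r + u q) % Q

/-- `r ^ n` modulo `Q`. -/
def modPow (r Q : ℕ) : ℕ → ℕ
  | 0 => 1
  | n + 1 => modPow r Q n * r % Q

theorem fingerprint_lt {r Q : ℕ} (hQ : 0 < Q) (u : ℕ → ℕ) (q : ℕ) : fingerprint r Q u q < Q := by
  cases q with
  | zero => exact hQ
  | succ q => exact Nat.mod_lt _ hQ

theorem modPow_lt {r Q : ℕ} (hQ : 1 < Q) (n : ℕ) : modPow r Q n < Q := by
  cases n with
  | zero => exact hQ
  | succ q => exact Nat.mod_lt _ (by omega)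

theorem modPow_cast (r Q n : ℕ) : (modPow r Q n : ZMod Q) = (r : ZMod Q) ^ n := by
  induction n with
  | zero => simp [modPow]
  | succ n ih => simp [modPow, ih, pow_succ]

/-- The fingerprint as a polynomial in `r`. -/
noncomputable def fingerprintPoly (Q : ℕ) (u : ℕ → ℕ) : ℕ → Polynomial (ZMod Q)
  | 0 => 0
  | q + 1 => fingerprintPoly Q u q * Polynomial.X + Polynomial.C (u q : ZMod Q)

theorem fingerprintPoly_eval (r Q : ℕ) (u : ℕ → ℕ) (q : ℕ) :
    (fingerprintPoly Q u q).eval (r : ZMod Q) = fingerprint r Q u q := by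
  induction q with
  | zero => simp [fingerprintPoly, fingerprint]
  | succ q ih => simp [fingerprintPoly, fingerprint, ih]

theorem fingerprintPoly_degree (Q : ℕ) (u : ℕ → ℕ) (q : ℕ) :
    (fingerprintPoly Q u q).natDegree ≤ q := by
  induction q with
  | zero => simp [fingerprintPoly]
  | succ q ih =>
    refine (Polynomial.natDegree_add_le _ _).trans (max_le ?_ (by simp))
    refine (Polynomial.natDegree_mul_le).trans ?_
    have := Polynomial.natDegree_X_le (R := ZMod Q)
    omega

/-- The letters are the coefficients; the bound by `Q` makes them recoverable from their residues.
-/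
theorem fingerprintPoly_inj {Q : ℕ} {u v : ℕ → ℕ} (hu : ∀ x, u x < Q) (hv : ∀ x, v x < Q)
    {ℓ : ℕ} (h : fingerprintPoly Q u ℓ = fingerprintPoly Q v ℓ) : ∀ x < ℓ, u x = v x := by
  induction ℓ with
  | zero => intro x hx; omega
  | succ ℓ ih =>
    simp only [fingerprintPoly] at h
    have h0 : (u ℓ : ZMod Q) = v ℓ := by
      simpa using congrArg (Polynomial.coeff · 0) h
    have h1 : fingerprintPoly Q u ℓ = fingerprintPoly Q v ℓ := by
      ext n
      simpa [Polynomial.coeff_C] using congrArg (Polynomial.coeff · (n + 1)) h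
    intro x hx
    rcases Nat.lt_succ_iff_lt_or_eq.1 hx with hx | rfl
    · exact ih h1 x hx
    · rw [ZMod.natCast_eq_natCast_iff'] at h0
      rwa [Nat.mod_eq_of_lt (hu x), Nat.mod_eq_of_lt (hv x)] at h0

theorem fingerprint_add_cast (r Q : ℕ) (u : ℕ → ℕ) (q ℓ : ℕ) :
    (fingerprint r Q u (q + ℓ) : ZMod Q)
      = fingerprint r Q u q * (r : ZMod Q) ^ ℓ + fingerprint r Q (fun x => u (q + x)) ℓ := by
  induction ℓ with
  | zero => simp [fingerprint]
  | succ ℓ ih =>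
    rw [← add_assoc]
    simp only [fingerprint, ZMod.natCast_mod, Nat.cast_add, Nat.cast_mul, ih]
    ring

theorem fingerprint_congr (r Q : ℕ) {u v : ℕ → ℕ} {ℓ : ℕ} (h : ∀ x < ℓ, u x = v x) :
    fingerprint r Q u ℓ = fingerprint r Q v ℓ := by
  induction ℓ with
  | zero => rfl
  | succ ℓ ih => simp only [fingerprint, ih fun x hx => h x (by omega), h ℓ (by omega)]

/-- The comparison made by the algorithm, which sees only prefix fingerprints of the text, says that
the factor of length `ℓ` starting at `q` has fingerprint `y`. -/
theorem fingerprint_add_eq_iff {r Q : ℕ} (hQ : 0 < Q) (u : ℕ → ℕ) (q ℓ y : ℕ) :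
    fingerprint r Q u (q + ℓ) = (fingerprint r Q u q * modPow r Q ℓ + y) % Q ↔
      (fingerprint r Q (fun x => u (q + x)) ℓ : ZMod Q) = y := by
  rw [← Nat.mod_eq_of_lt (fingerprint_lt hQ u (q + ℓ)), ← ZMod.natCast_eq_natCast_iff',
    fingerprint_add_cast, Nat.cast_add, Nat.cast_mul, modPow_cast]
  exact add_right_inj _

theorem Occurs.fingerprint_eq {r Q : ℕ} (hQ : 0 < Q) {u v : ℕ → ℕ} {ℓ q : ℕ}
    (h : Occurs u v ℓ q) :
    fingerprint r Q u (q + ℓ)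
      = (fingerprint r Q u q * modPow r Q ℓ + fingerprint r Q v ℓ) % Q := by
  rw [fingerprint_add_eq_iff hQ, fingerprint_congr r Q h]

/-- No factor of `u 0 … u (2 * m - 1)` of length at most `m` has the fingerprint of a prefix of
`v` without being equal to it. -/
def GoodSeed (Q m : ℕ) (u v : ℕ → ℕ) (r : ℕ) : Prop :=
  ∀ q ℓ, q + ℓ ≤ 2 * m → ℓ ≤ m →
    fingerprint r Q u (q + ℓ)
      = (fingerprint r Q u q * modPow r Q ℓ + fingerprint r Q v ℓ) % Q → Occurs u v ℓ q

-- A bad seed is a root of the difference of the fingerprint polynomials of a factor and of a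
-- different prefix. There are `2m · m` pairs of position and length, and each nonzero difference
-- has at most `m` roots.
open Classical in
theorem card_not_goodSeed_le {Q : ℕ} (hQ : Q.Prime) (m : ℕ) {u v : ℕ → ℕ} (hu : ∀ x, u x < Q)
    (hv : ∀ x, v x < Q) :
    ((Finset.range Q).filter fun r => ¬ GoodSeed Q m u v r).card ≤ 2 * m * m * m := by
  have : Fact Q.Prime := ⟨hQ⟩
  let D : ℕ × ℕ → Polynomial (ZMod Q) := fun z =>
    fingerprintPoly Q (fun x => u (z.1 + x)) (z.2 + 1) - fingerprintPoly Q v (z.2 + 1)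
  -- Lengths are shifted by one, since the empty factor is never bad.
  let Z : Finset (ℕ × ℕ) := Finset.range (2 * m) ×ˢ Finset.range m
  have hsub : ((Finset.range Q).filter fun r => ¬ GoodSeed Q m u v r).image
      (fun r : ℕ => (r : ZMod Q)) ⊆ Z.biUnion fun z => (D z).roots.toFinset := by
    intro y hy
    simp only [Finset.mem_image, Finset.mem_filter, Finset.mem_range] at hy
    obtain ⟨r, ⟨-, hr⟩, rfl⟩ := hy
    simp only [GoodSeed] at hr
    push Not at hr
    obtain ⟨q, ℓ, h1, h2, h3, h4⟩ := hr
    obtain ⟨ℓ, rfl⟩ : ∃ l, ℓ = l + 1 := ⟨ℓ - 1, by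
      rcases ℓ with - | ℓ
      · exact absurd (fun x hx => absurd hx (by omega)) h4
      · simp⟩
    rw [fingerprint_add_eq_iff hQ.pos] at h3
    simp only [Finset.mem_biUnion, Multiset.mem_toFinset]
    refine ⟨(q, ℓ), by simp [Z]; omega, (Polynomial.mem_roots fun h0 => h4 ?_).2 ?_⟩
    · exact fingerprintPoly_inj (fun x => hu _) hv (sub_eq_zero.1 h0)
    · simp [D, Polynomial.IsRoot, fingerprintPoly_eval, h3]
  have hinj : Set.InjOn (fun r : ℕ => (r : ZMod Q))
      ((Finset.range Q).filter fun r => ¬ GoodSeed Q m u v r) := by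
    intro a ha b hb hab
    simp only [Finset.coe_filter, Finset.mem_range, Set.mem_ofPred_eq] at ha hb
    simp only [ZMod.natCast_eq_natCast_iff'] at hab
    rwa [Nat.mod_eq_of_lt ha.1, Nat.mod_eq_of_lt hb.1] at hab
  rw [← Finset.card_image_of_injOn hinj]
  refine (Finset.card_le_card hsub).trans ((Finset.card_biUnion_le_card_mul _ _ m ?_).trans ?_)
  · rintro ⟨q, ℓ⟩ hz
    simp only [Z, Finset.mem_product, Finset.mem_range] at hz
    refine (Multiset.toFinset_card_le _).trans ((Polynomial.card_roots' _).trans ?_)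
    refine (Polynomial.natDegree_sub_le _ _).trans (max_le ?_ ?_) <;>
      exact (fingerprintPoly_degree _ _ _).trans (by omega)
  · simp [Z]

/-! ## Structured programs with named arrays -/

/-- The arrays used by the streaming algorithm. Those with a Boolean argument exist twice, once
for each of the two copies of the algorithm. -/
inductive Arr
  | out | seed | modulus | top | len | powLen | fpLen | per | powPer | fpPer
  | code | i | j | x | y | z | flag
  | first (b : Bool) | last (b : Bool) | full (b : Bool) | fpAt (b : Bool)
  | time (b : Bool) | fp (b : Bool)
  deriving DecidableEq

namespace Arr

/-- Offset of the array in the memory of the word RAM. -/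
def idx : Arr → ℕ
  | out => 0 | seed => 1 | modulus => 2 | top => 3 | len => 4 | powLen => 5 | fpLen => 6
  | per => 7 | powPer => 8 | fpPer => 9 | code => 10 | i => 11 | j => 12 | x => 13 | y => 14
  | z => 15 | flag => 16
  | first b => 17 + b.toNat | last b => 19 + b.toNat | full b => 21 + b.toNat
  | fpAt b => 23 + b.toNat | time b => 25 + b.toNat | fp b => 27 + b.toNat

theorem idx_lt (v : Arr) : v.idx < 64 := by
  cases v <;> simp only [idx] <;> first | omega | (rename_i b; cases b <;> simp)

theorem idx_injective : Function.Injective idx := by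
  intro v v' h
  cases v <;> cases v' <;> simp only [idx] at h <;> first
    | rfl
    | omega
    | (rename_i b; cases b <;> simp at h; done)
    | (rename_i b b'; cases b <;> cases b' <;> simp at h ⊢)

end Arr

/-- The contents of the arrays. -/
abbrev Store := Arr → ℕ → ℕ

/-- Write `x` at index `k` of the array `v`. -/
def Store.upd (g : Store) (v : Arr) (k x : ℕ) : Store :=
  fun v' k' => if v' = v ∧ k' = k then x else g v' k'

theorem Store.upd_apply (g : Store) (v v' : Arr) (k k' x : ℕ) :
    g.upd v k x v' k' = if v' = v ∧ k' = k then x else g v' k' := rfl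

theorem Store.upd_of_ne (g : Store) {v v' : Arr} (h : v' ≠ v) (k x : ℕ) :
    g.upd v k x v' = g v' := by
  funext k'
  simp [upd, h]

/-- Expressions over named arrays. `sc v` is the entry of `v` at index `0`. -/
inductive AExpr
  | lit (k : ℕ)
  | patLen
  | numP
  | numT
  | sym
  | pat (e : AExpr)
  | rel (x a : AExpr)
  | sc (v : Arr)
  | rd (v : Arr) (e : AExpr)
  | op (o : RamOp) (a b : AExpr)

namespace AExpr

instance : Add AExpr := ⟨op .plus⟩
instance : Sub AExpr := ⟨op .minus⟩
instance : Mul AExpr := ⟨op .times⟩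
instance : Mod AExpr := ⟨op .rem⟩
instance : Div AExpr := ⟨op .quot⟩

/-- The value of an expression in exact arithmetic. -/
def eval (I : RamInput) (g : Store) : AExpr → ℕ
  | lit k => k
  | patLen => I.patLen
  | numP => I.numP
  | numT => I.numT
  | sym => I.sym
  | pat e => I.pat (e.eval I g)
  | rel x a => if I.rel (x.eval I g) (a.eval I g) then 1 else 0
  | sc v => g v 0
  | rd v e => g v (e.eval I g)
  | op o a b => o.eval (a.eval I g) (b.eval I g)

/-- No intermediate result reaches `W` and no array is read beyond index `n`. -/
def Safe (I : RamInput) (W n : ℕ) (g : Store) : AExpr → Prop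
  | lit k => k < W
  | patLen | numP | numT | sym | sc _ => True
  | pat e => e.Safe I W n g
  | rel x a => x.Safe I W n g ∧ a.Safe I W n g
  | rd _ e => e.Safe I W n g ∧ e.eval I g < n
  | op .plus a b => a.Safe I W n g ∧ b.Safe I W n g ∧ a.eval I g + b.eval I g < W
  | op .times a b => a.Safe I W n g ∧ b.Safe I W n g ∧ a.eval I g * b.eval I g < W
  | op _ a b => a.Safe I W n g ∧ b.Safe I W n g

/-- Address of the entry of the array `v` at index `e`. -/
def addr (v : Arr) (e : RamExpr) : RamExpr :=
  .op .plus (.op .times (.const 64) e) (.const v.idx)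

/-- Translation to expressions of the word RAM. -/
def compile : AExpr → RamExpr
  | lit k => .const k
  | patLen => .patLen
  | numP => .numP
  | numT => .numT
  | sym => .sym
  | pat e => .pat e.compile
  | rel x a => .rel x.compile a.compile
  | sc v => .load (.const v.idx)
  | rd v e => .load (addr v e.compile)
  | op o a b => .op o a.compile b.compile

section eval

variable (I : RamInput) (g : Store) (a b : AExpr)

@[simp] theorem eval_lit (k : ℕ) : (lit k).eval I g = k := rfl
@[simp] theorem eval_patLen : patLen.eval I g = I.patLen := rfl
@[simp] theorem eval_numP : numP.eval I g = I.numP := rfl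
@[simp] theorem eval_numT : numT.eval I g = I.numT := rfl
@[simp] theorem eval_sym : sym.eval I g = I.sym := rfl
@[simp] theorem eval_pat : (pat a).eval I g = I.pat (a.eval I g) := rfl
@[simp] theorem eval_rel :
    (rel a b).eval I g = if I.rel (a.eval I g) (b.eval I g) then 1 else 0 := rfl
@[simp] theorem eval_sc (v : Arr) : (sc v).eval I g = g v 0 := rfl
@[simp] theorem eval_rd (v : Arr) : (rd v a).eval I g = g v (a.eval I g) := rfl
@[simp] theorem eval_add : (a + b).eval I g = a.eval I g + b.eval I g := rfl
@[simp] theorem eval_sub : (a - b).eval I g = a.eval I g - b.eval I g := rfl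
@[simp] theorem eval_mul : (a * b).eval I g = a.eval I g * b.eval I g := rfl
@[simp] theorem eval_mod : (a % b).eval I g = a.eval I g % b.eval I g := rfl
@[simp] theorem eval_div : (a / b).eval I g = a.eval I g / b.eval I g := rfl
@[simp] theorem eval_lt :
    (op .lt a b).eval I g = if a.eval I g < b.eval I g then 1 else 0 := rfl
@[simp] theorem eval_eq :
    (op .eq a b).eval I g = if a.eval I g = b.eval I g then 1 else 0 := rfl

variable (W n : ℕ)

@[simp] theorem safe_lit (k : ℕ) : (lit k).Safe I W n g ↔ k < W := Iff.rfl
@[simp] theorem safe_patLen : patLen.Safe I W n g := trivial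
@[simp] theorem safe_numP : numP.Safe I W n g := trivial
@[simp] theorem safe_numT : numT.Safe I W n g := trivial
@[simp] theorem safe_sym : sym.Safe I W n g := trivial
@[simp] theorem safe_sc (v : Arr) : (sc v).Safe I W n g := trivial
@[simp] theorem safe_pat : (pat a).Safe I W n g ↔ a.Safe I W n g := Iff.rfl
@[simp] theorem safe_rel : (rel a b).Safe I W n g ↔ a.Safe I W n g ∧ b.Safe I W n g := Iff.rfl
@[simp] theorem safe_rd (v : Arr) :
    (rd v a).Safe I W n g ↔ a.Safe I W n g ∧ a.eval I g < n := Iff.rfl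
@[simp] theorem safe_add : (a + b).Safe I W n g ↔
    a.Safe I W n g ∧ b.Safe I W n g ∧ a.eval I g + b.eval I g < W := Iff.rfl
@[simp] theorem safe_mul : (a * b).Safe I W n g ↔
    a.Safe I W n g ∧ b.Safe I W n g ∧ a.eval I g * b.eval I g < W := Iff.rfl
@[simp] theorem safe_sub : (a - b).Safe I W n g ↔ a.Safe I W n g ∧ b.Safe I W n g := Iff.rfl
@[simp] theorem safe_mod : (a % b).Safe I W n g ↔ a.Safe I W n g ∧ b.Safe I W n g := Iff.rfl
@[simp] theorem safe_div : (a / b).Safe I W n g ↔ a.Safe I W n g ∧ b.Safe I W n g := Iff.rfl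
@[simp] theorem safe_lt : (op .lt a b).Safe I W n g ↔ a.Safe I W n g ∧ b.Safe I W n g := Iff.rfl
@[simp] theorem safe_eq : (op .eq a b).Safe I W n g ↔ a.Safe I W n g ∧ b.Safe I W n g := Iff.rfl

end eval

end AExpr

/-- Deterministic structured programs over named arrays. `set v e` writes at index `0` of `v`, and
`asg v k e` at index `k`. -/
inductive ACmd
  | skip
  | set (v : Arr) (e : AExpr)
  | asg (v : Arr) (k e : AExpr)
  | seq (c d : ACmd)
  | ite (e : AExpr) (c d : ACmd)
  | loop (e : AExpr) (c : ACmd)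

instance : Append ACmd := ⟨ACmd.seq⟩

namespace ACmd

/-- The effect of a program in exact arithmetic. -/
def exec (I : RamInput) : ACmd → Store → Store
  | skip, g => g
  | set v e, g => g.upd v 0 (e.eval I g)
  | asg v k e, g => g.upd v (k.eval I g) (e.eval I g)
  | seq c d, g => exec I d (exec I c g)
  | ite e c d, g => if e.eval I g ≠ 0 then exec I c g else exec I d g
  | loop e c, g => (exec I c)^[e.eval I g] g

/-- No intermediate result reaches `W` and all indices are below `n`. -/
def Safe (I : RamInput) (W n : ℕ) : ACmd → Store → Prop
  | skip, _ => True
  | set _ e, g => e.Safe I W n g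
  | asg _ k e, g => k.Safe I W n g ∧ e.Safe I W n g ∧ k.eval I g < n
  | seq c d, g => Safe I W n c g ∧ Safe I W n d (exec I c g)
  | ite e c d, g => e.Safe I W n g ∧ (e.eval I g ≠ 0 → Safe I W n c g) ∧
      (e.eval I g = 0 → Safe I W n d g)
  | loop e c, g => e.Safe I W n g ∧ ∀ k < e.eval I g, Safe I W n c ((exec I c)^[k] g)

/-- Translation to programs of the word RAM. -/
def compile : ACmd → RamCmd
  | skip => .skip
  | set v e => .store (.const v.idx) e.compile
  | asg v k e => .store (AExpr.addr v k.compile) e.compile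
  | seq c d => .seq c.compile d.compile
  | ite e c d => .ite e.compile c.compile d.compile
  | loop e c => .loop e.compile c.compile

/-- The arrays that a program may change. -/
def writes : ACmd → List Arr
  | skip => []
  | set v _ => [v]
  | asg v _ _ => [v]
  | seq c d => c.writes ++ d.writes
  | ite _ c d => c.writes ++ d.writes
  | loop _ c => c.writes

@[simp] theorem writes_append (c d : ACmd) : (c ++ d).writes = c.writes ++ d.writes := rfl

/-- The frame rule. The lists of written arrays are concrete, so its hypothesis can be settled by
`decide` or `simp`. -/
theorem exec_of_notMem_writes (I : RamInput) (c : ACmd) (g : Store) (v : Arr)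
    (hv : v ∉ c.writes) : exec I c g v = g v := by
  induction c generalizing g with
  | skip => rfl
  | set v' e => exact Store.upd_of_ne _ (by simpa [writes] using hv) _ _
  | asg v' k e => exact Store.upd_of_ne _ (by simpa [writes] using hv) _ _
  | seq c d hc hd =>
    simp only [writes, List.mem_append, not_or] at hv
    simp only [exec, hd _ hv.2, hc _ hv.1]
  | ite e c d hc hd =>
    simp only [writes, List.mem_append, not_or] at hv
    simp only [exec]
    split
    · exact hc _ hv.1
    · exact hd _ hv.2
  | loop e c hc =>
    simp only [exec]
    induction e.eval I g with
    | zero => rfl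
    | succ n ih => rw [Function.iterate_succ_apply', hc _ hv, ih]

/-- The program runs safely from `g` and leads to a state in which `P` holds. -/
def Wp (I : RamInput) (W n : ℕ) (c : ACmd) (g : Store) (P : Store → Prop) : Prop :=
  c.Safe I W n g ∧ P (c.exec I g)

section Wp

variable {I : RamInput} {W n : ℕ} {c d : ACmd} {g : Store} {P P' : Store → Prop}

theorem Wp.mono (h : Wp I W n c g P)
    (hP : ∀ g', (∀ v, v ∉ c.writes → g' v = g v) → P g' → P' g') : Wp I W n c g P' :=
  ⟨h.1, hP _ (exec_of_notMem_writes I c g) h.2⟩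

@[simp] theorem wp_skip : Wp I W n skip g P ↔ P g := by simp [Wp, Safe, exec]

@[simp] theorem wp_set {v : Arr} {e : AExpr} :
    Wp I W n (set v e) g P ↔ e.Safe I W n g ∧ P (g.upd v 0 (e.eval I g)) := Iff.rfl

@[simp] theorem wp_asg {v : Arr} {k e : AExpr} :
    Wp I W n (asg v k e) g P ↔ (k.Safe I W n g ∧ e.Safe I W n g ∧ k.eval I g < n) ∧
      P (g.upd v (k.eval I g) (e.eval I g)) := Iff.rfl

@[simp] theorem wp_seq : Wp I W n (c ++ d) g P ↔ Wp I W n c g fun g' => Wp I W n d g' P :=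
  and_assoc

theorem wp_ite {e : AExpr} : Wp I W n (ite e c d) g P ↔ e.Safe I W n g ∧
    (e.eval I g ≠ 0 → Wp I W n c g P) ∧ (e.eval I g = 0 → Wp I W n d g P) := by
  by_cases h : e.eval I g = 0 <;> simp [Wp, Safe, exec, h, and_assoc]

/-- The frame rule is built in, so an invariant need only speak of the arrays that the body changes.
-/
theorem wp_loop (Inv : ℕ → Store → Prop) {e : AExpr} (he : e.Safe I W n g) (h0 : Inv 0 g)
    (hs : ∀ k g', k < e.eval I g → (∀ v, v ∉ c.writes → g' v = g v) → Inv k g' →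
      Wp I W n c g' (Inv (k + 1)))
    (hP : ∀ g', (∀ v, v ∉ c.writes → g' v = g v) → Inv (e.eval I g) g' → P g') :
    Wp I W n (loop e c) g P := by
  have key : ∀ k ≤ e.eval I g, Inv k ((exec I c)^[k] g) ∧
      (∀ v, v ∉ c.writes → (exec I c)^[k] g v = g v) := by
    intro k hk
    induction k with
    | zero => exact ⟨h0, fun _ _ => rfl⟩
    | succ k ih =>
      obtain ⟨h1, h2⟩ := ih (by omega)
      rw [Function.iterate_succ_apply']
      exact ⟨(hs k _ (by omega) h2 h1).2, fun v hv => by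
        rw [exec_of_notMem_writes I c _ v hv, h2 v hv]⟩
  refine ⟨⟨he, fun k hk => (hs k _ hk (key k hk.le).2 (key k hk.le).1).1⟩, ?_⟩
  exact hP _ (key _ le_rfl).2 (key _ le_rfl).1

end Wp

end ACmd

/-! ## Simulation on the word RAM -/

/-- The memory `μ` holds the first `n` entries of all arrays. -/
def Represents {N w : ℕ} (n : ℕ) (μ : RamMem N w) (g : Store) : Prop :=
  ∀ v k, k < n → μ.get (64 * k + v.idx) = g v k

theorem RamMem.get_lt {N w : ℕ} (μ : RamMem N w) (k : ℕ) : μ.get k < 2 ^ w := by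
  unfold RamMem.get
  split
  · exact (μ _).2
  · exact Nat.two_pow_pos w

theorem RamMem.get_set {N w : ℕ} (μ : RamMem N w) (a v k : ℕ) (ha : a < N) :
    (μ.set a v).get k = if k = a then v % 2 ^ w else μ.get k := by
  unfold RamMem.get RamMem.set
  by_cases hk : k = a
  · subst hk; simp [ha]
  · simp [hk]

theorem Represents.set {N w n : ℕ} {μ : RamMem N w} {g : Store} (h : Represents n μ g)
    (hN : 64 * n ≤ N) (v : Arr) {k : ℕ} (hk : k < n) {x : ℕ} (hx : x < 2 ^ w) :
    Represents n (μ.set (64 * k + v.idx) x) (g.upd v k x) := by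
  intro v' k' hk'
  have h1 := v.idx_lt
  have h2 := v'.idx_lt
  rw [RamMem.get_set _ _ _ _ (by omega), Store.upd_apply, Nat.mod_eq_of_lt hx, h v' k' hk']
  congr 1
  rw [eq_iff_iff]
  constructor
  · intro h
    exact ⟨Arr.idx_injective (by omega), by omega⟩
  · rintro ⟨rfl, rfl⟩
    rfl

/-- The input fits into words below `W`. -/
structure RamInput.Fits (I : RamInput) (W : ℕ) : Prop where
  patLen : I.patLen < W
  numP : I.numP < W
  numT : I.numT < W
  sym : I.sym < W
  pat : ∀ k, I.pat k < W

/-- `Safe` bounds constants, sums and products, and the other operations cannot increase a value, so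
no truncation takes effect. The bound on the value is part of the induction. -/
theorem AExpr.eval_compile {N w n : ℕ} {I : RamInput} (hI : I.Fits (2 ^ w)) {μ : RamMem N w}
    {g : Store} (h : Represents n μ g) (hn : 0 < n) (hw : 64 * n < 2 ^ w) (e : AExpr)
    (he : e.Safe I (2 ^ w) n g) : e.compile.eval I μ = e.eval I g ∧ e.eval I g < 2 ^ w := by
  induction e with
  | lit k => exact ⟨Nat.mod_eq_of_lt he, he⟩
  | patLen => exact ⟨Nat.mod_eq_of_lt hI.patLen, hI.patLen⟩
  | numP => exact ⟨Nat.mod_eq_of_lt hI.numP, hI.numP⟩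
  | numT => exact ⟨Nat.mod_eq_of_lt hI.numT, hI.numT⟩
  | sym => exact ⟨Nat.mod_eq_of_lt hI.sym, hI.sym⟩
  | pat e ih =>
    simp only [compile, RamExpr.eval, eval, (ih he).1]
    exact ⟨Nat.mod_eq_of_lt (hI.pat _), hI.pat _⟩
  | rel x a hx ha =>
    simp only [compile, RamExpr.eval, eval, (hx he.1).1, (ha he.2).1]
    have : (if I.rel (x.eval I g) (a.eval I g) then 1 else 0) < 2 ^ w := by split <;> omega
    exact ⟨Nat.mod_eq_of_lt this, this⟩
  | sc v =>
    have hv := v.idx_lt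
    have e := h v 0 hn
    simp only [mul_zero, zero_add] at e
    simp only [compile, RamExpr.eval, eval]
    rw [Nat.mod_eq_of_lt (by omega), e, ← e]
    exact ⟨rfl, μ.get_lt _⟩
  | rd v e ih =>
    have hv := v.idx_lt
    obtain ⟨h1, h2⟩ := he
    have e1 := h v _ h2
    simp only [compile, addr, RamExpr.eval, eval, RamOp.eval, (ih h1).1]
    rw [Nat.mod_eq_of_lt (a := 64) (by omega), Nat.mod_eq_of_lt (a := v.idx) (by omega),
      Nat.mod_eq_of_lt (a := 64 * _) (by omega), Nat.mod_eq_of_lt (by omega), e1, ← e1]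
    exact ⟨rfl, μ.get_lt _⟩
  | op o a b ha hb =>
    have hab : a.Safe I (2 ^ w) n g ∧ b.Safe I (2 ^ w) n g := by
      cases o <;> first | exact ⟨he.1, he.2.1⟩ | exact he
    obtain ⟨ha1, ha2⟩ := ha hab.1
    obtain ⟨hb1, hb2⟩ := hb hab.2
    simp only [compile, RamExpr.eval, eval, ha1, hb1]
    suffices o.eval (a.eval I g) (b.eval I g) < 2 ^ w from ⟨Nat.mod_eq_of_lt this, this⟩
    cases o with
    | plus => exact he.2.2
    | minus => exact (Nat.sub_le _ _).trans_lt ha2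
    | times => exact he.2.2
    | quot => exact (Nat.div_le_self _ _).trans_lt ha2
    | rem => exact (Nat.mod_le _ _).trans_lt ha2
    | lt => simp only [RamOp.eval]; split <;> omega
    | eq => simp only [RamOp.eval]; split <;> omega

/-- Compiled programs draw no random words, so a safe run ends in a point mass that still represents
the store. -/
theorem ACmd.run_compile {N w n : ℕ} {I : RamInput} (hI : I.Fits (2 ^ w)) (hn : 0 < n)
    (hw : 64 * n < 2 ^ w) (hN : 64 * n ≤ N) (c : ACmd) {μ : RamMem N w} {g : Store}
    (h : Represents n μ g) (hc : c.Safe I (2 ^ w) n g) :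
    ∃ ν, c.compile.run I μ = PMF.pure ν ∧ Represents n ν (c.exec I g) := by
  induction c generalizing μ g with
  | skip => exact ⟨μ, rfl, h⟩
  | set v e =>
    have hv := v.idx_lt
    obtain ⟨e1, e2⟩ := AExpr.eval_compile hI h hn hw e hc
    refine ⟨_, rfl, ?_⟩
    simp only [e1, RamExpr.eval]
    rw [Nat.mod_eq_of_lt (by omega)]
    have := h.set hN v hn e2
    rwa [mul_zero, zero_add] at this
  | asg v k e =>
    have hv := v.idx_lt
    obtain ⟨h1, h2, h3⟩ := hc
    obtain ⟨k1, k2⟩ := AExpr.eval_compile hI h hn hw k h1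
    obtain ⟨e1, e2⟩ := AExpr.eval_compile hI h hn hw e h2
    refine ⟨_, rfl, ?_⟩
    simp only [e1, AExpr.addr, RamExpr.eval, RamOp.eval, k1]
    rw [Nat.mod_eq_of_lt (a := 64) (by omega), Nat.mod_eq_of_lt (a := v.idx) (by omega),
      Nat.mod_eq_of_lt (a := 64 * _) (by omega), Nat.mod_eq_of_lt (by omega)]
    exact h.set hN v h3 e2
  | seq c d ihc ihd =>
    obtain ⟨ν, h1, h2⟩ := ihc h hc.1
    obtain ⟨ρ, h3, h4⟩ := ihd h2 hc.2
    exact ⟨ρ, by simp [compile, RamCmd.run, h1, h3], h4⟩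
  | ite e c d ihc ihd =>
    obtain ⟨h1, h2, h3⟩ := hc
    obtain ⟨e1, -⟩ := AExpr.eval_compile hI h hn hw e h1
    simp only [compile, RamCmd.run, e1, exec]
    split
    · exact ihc h (h2 ‹_›)
    · exact ihd h (h3 (by tauto))
  | loop e c ih =>
    obtain ⟨h1, h2⟩ := hc
    obtain ⟨e1, -⟩ := AExpr.eval_compile hI h hn hw e h1
    simp only [compile, RamCmd.run, e1, exec]
    have key : ∀ k ≤ e.eval I g, ∃ ν,
        (fun ν => ν.bind (c.compile.run I))^[k] (PMF.pure μ) = PMF.pure ν ∧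
          Represents n ν ((exec I c)^[k] g) := by
      intro k hk
      induction k with
      | zero => exact ⟨μ, rfl, h⟩
      | succ k ihk =>
        obtain ⟨ν, h3, h4⟩ := ihk (by omega)
        obtain ⟨ρ, h5, h6⟩ := ih h4 (h2 k (by omega))
        exact ⟨ρ, by rw [Function.iterate_succ_apply', h3, PMF.pure_bind, h5], by
          rwa [Function.iterate_succ_apply']⟩
    exact key _ le_rfl

open AExpr ACmd

/-! ## Codes of letters -/

/-- One more than the largest `z < n` with `p z`, and `0` if there is none. -/
def lastHit (p : ℕ → Bool) : ℕ → ℕ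
  | 0 => 0
  | n + 1 => if p n then n + 1 else lastHit p n

theorem lastHit_le (p : ℕ → Bool) (n : ℕ) : lastHit p n ≤ n := by
  induction n with
  | zero => exact le_rfl
  | succ n ih => simp only [lastHit]; split <;> omega

theorem lastHit_spec (p : ℕ → Bool) (n : ℕ) :
    (lastHit p n = 0 ∧ ∀ z < n, p z = false) ∨
      ∃ z < n, lastHit p n = z + 1 ∧ p z = true := by
  induction n with
  | zero => exact Or.inl ⟨rfl, fun z hz => by omega⟩
  | succ n ih =>
    simp only [lastHit]
    by_cases h : p n = true
    · exact Or.inr ⟨n, by omega, by simp [h], h⟩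
    · rw [if_neg h]
      rcases ih with ⟨h1, h2⟩ | ⟨z, h1, h2, h3⟩
      · refine Or.inl ⟨h1, fun z hz => ?_⟩
        rcases Nat.lt_succ_iff_lt_or_eq.1 hz with hz | rfl
        · exact h2 z hz
        · simpa using h
      · exact Or.inr ⟨z, by omega, h2, h3⟩

theorem lastHit_congr {p p' : ℕ → Bool} {n : ℕ} (h : ∀ z < n, p z = p' z) :
    lastHit p n = lastHit p' n := by
  induction n with
  | zero => rfl
  | succ n ih => simp only [lastHit, h n (by omega), ih fun z hz => h z (by omega)]

/-- The code of a pattern symbol: it depends on its class only, and is `0` if the class is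
empty. -/
def patCode (I : RamInput) (x : ℕ) : ℕ := lastHit (fun z => I.rel x z) I.numT

/-- The code of a text letter: the code of the classes that contain it. -/
def textCode (I : RamInput) (a : ℕ) : ℕ :=
  if lastHit (fun x => I.rel x a) I.numP ≠ 0 then
    patCode I (lastHit (fun x => I.rel x a) I.numP - 1)
  else I.numT + 1

/-- The codes of the pattern. -/
def patWord (I : RamInput) (k : ℕ) : ℕ := patCode I (I.pat k)

theorem patCode_le (I : RamInput) (x : ℕ) : patCode I x ≤ I.numT := lastHit_le _ _

theorem textCode_le (I : RamInput) (a : ℕ) : textCode I a ≤ I.numT + 1 := by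
  unfold textCode
  split
  · exact (patCode_le I _).trans (Nat.le_succ _)
  · exact le_rfl

/-- If classes that meet are equal, then codes agree exactly on matching pairs. -/
theorem textCode_eq_patCode_iff {I : RamInput}
    (hI : ∀ x x' a a', I.rel x a = true → I.rel x' a = true → I.rel x a' = true →
      I.rel x' a' = true)
    {x a : ℕ} (hx : x < I.numP) (ha : a < I.numT) :
    textCode I a = patCode I x ↔ I.rel x a = true := by
  unfold textCode
  rcases lastHit_spec (fun x => I.rel x a) I.numP with ⟨h1, h2⟩ | ⟨y, -, h2, h3⟩
  · rw [if_neg (by simpa using h1)]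
    have := patCode_le I x
    constructor
    · intro h; omega
    · intro h; exact absurd h (by simp [h2 x hx])
  · rw [if_pos (by omega), h2, Nat.add_sub_cancel]
    constructor
    · intro h
      -- A positive code names the last letter of the class, so equal codes give two classes that
      -- share a letter and hence coincide; the class of `y` contains `a`, so its code is not 0.
      unfold patCode at h
      rcases lastHit_spec (fun z => I.rel y z) I.numT with ⟨h4, h5⟩ | ⟨z, h4, h5, h6⟩
      · exact absurd h3 (by simp [h5 a ha])
      rcases lastHit_spec (fun z => I.rel x z) I.numT with ⟨h7, h8⟩ | ⟨z', h7, h8, h9⟩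
      · omega
      obtain rfl : z = z' := by omega
      exact hI y x z a h6 h9 h3
    · intro h
      refine lastHit_congr fun z _ => Bool.eq_iff_iff.2 ⟨fun h4 => ?_, fun h4 => ?_⟩
      · exact hI y x a z h3 h h4
      · exact hI x y a z h h3 h4

/-! ## The preprocessing program -/

/-- Search for the last index below `bound` that satisfies `cond`. -/
def scan (o k : Arr) (cond bound : AExpr) : ACmd :=
  set o (lit 0) ++ set k (lit 0) ++
    loop bound (ite cond (set o (sc k + lit 1)) skip ++ set k (sc k + lit 1))

/-- Compute the code of the pattern symbol at position `e`. -/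
def codePat (e : AExpr) : ACmd :=
  set .x (pat e) ++ scan .code .z (rel (sc .x) (sc .z)) numT

/-- Compute the code of the current text letter. -/
def codeSym : ACmd :=
  scan .y .z (rel (sc .z) sym) numP ++
    ite (sc .y) (set .x (sc .y - lit 1) ++ scan .code .z (rel (sc .x) (sc .z)) numT)
      (set .code (numT + lit 1))

/-- Compute the power of the seed and the fingerprint that belong to the prefix of the pattern of
length `bound`. -/
def hashPrefix (p f : Arr) (bound : AExpr) : ACmd :=
  asg p (sc .top) (lit 1) ++ asg f (sc .top) (lit 0) ++ set .i (lit 0) ++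
    loop bound (codePat (sc .i) ++
      asg p (sc .top) (rd p (sc .top) * sc .seed % sc .modulus) ++
      asg f (sc .top) ((rd f (sc .top) * sc .seed + sc .code) % sc .modulus) ++
      set .i (sc .i + lit 1))

/-- Test whether `y` is a period of the current prefix. -/
def testPeriod : ACmd :=
  set .flag (lit 1) ++ set .i (lit 0) ++
    loop (rd .len (sc .top) - sc .y) (codePat (sc .i) ++ set .j (sc .code) ++
      codePat (sc .i + sc .y) ++ ite (op .eq (sc .j) (sc .code)) skip (set .flag (lit 0)) ++
      set .i (sc .i + lit 1))

/-- Compute the least period of the current prefix. -/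
def findPeriod : ACmd :=
  set .y (rd .len (sc .top)) ++ asg .per (sc .top) (rd .len (sc .top)) ++
    loop (rd .len (sc .top)) (testPeriod ++ ite (sc .flag) (asg .per (sc .top) (sc .y)) skip ++
      set .y (sc .y - lit 1))

/-- Add a level. -/
def addLevel : ACmd :=
  set .top (sc .top + lit 1) ++
    set .y (rd .len (sc .top - lit 1) + rd .len (sc .top - lit 1) / lit 2 + lit 1) ++
    ite (op .lt (sc .y) patLen) (asg .len (sc .top) (sc .y)) (asg .len (sc .top) patLen) ++
    hashPrefix .powLen .fpLen (rd .len (sc .top)) ++ findPeriod ++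
    hashPrefix .powPer .fpPer (rd .per (sc .top))

/-- Add levels until the whole pattern is reached. -/
def addLevels : ACmd :=
  set .per (lit 1) ++ loop patLen (ite (op .lt (rd .len (sc .top)) patLen) addLevel skip)

/-- Find the first prime that is at least `e`. -/
def findPrime (e : AExpr) : ACmd :=
  set .modulus e ++ loop (sc .modulus) (set .flag (lit 1) ++ set .i (lit 2) ++
    loop (sc .modulus - lit 2) (ite (sc .modulus % sc .i) skip (set .flag (lit 0)) ++
      set .i (sc .i + lit 1)) ++
    ite (sc .flag) skip (set .modulus (sc .modulus + lit 1)))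

/-- The power `patLen ^ a`. -/
def powPatLen : ℕ → AExpr
  | 0 => lit 1
  | a + 1 => powPatLen a * patLen

/-- Preprocessing, after the seed has been drawn. -/
def preprocess (c a : ℕ) : ACmd :=
  findPrime (lit c * powPatLen a) ++ set .seed (sc .seed % sc .modulus) ++ addLevels ++
    set (.time true) patLen

/-! ### Correctness of the preprocessing: codes and fingerprints -/

section

variable {I : RamInput} {W n : ℕ} {g : Store} {P : Store → Prop}

theorem wp_scan {o k : Arr} {cond bound : AExpr} (p : ℕ → Bool) {b : ℕ} (hok : o ≠ k)
    (hb : ∀ g', bound.Safe I W n g' ∧ bound.eval I g' = b) (hbW : b < W) (hW : 2 ≤ W)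
    (hc : ∀ g', (∀ v, v ∉ [o, k] → g' v = g v) → cond.Safe I W n g' ∧
      (cond.eval I g' ≠ 0 ↔ p (g' k 0) = true))
    (hP : ∀ g', (∀ v, v ∉ [o, k] → g' v = g v) → g' o 0 = lastHit p b → P g') :
    Wp I W n (scan o k cond bound) g P := by
  unfold scan
  simp only [wp_seq, wp_set, safe_lit, eval_lit]
  refine ⟨by omega, by omega, ?_⟩
  refine wp_loop (fun i g' => g' k 0 = i ∧ g' o 0 = lastHit p i) (hb _).1 ?_ ?_ ?_
  · simp [Store.upd_apply, lastHit, hok]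
  · rintro i g' hi hfr ⟨h1, h2⟩
    rw [(hb _).2] at hi
    have hfr' : ∀ v, v ∉ [o, k] → g' v = g v := by
      intro v hv
      rw [hfr v (by simpa [writes] using hv)]
      simp only [List.mem_cons, List.not_mem_nil, or_false, not_or] at hv
      rw [Store.upd_of_ne _ hv.2, Store.upd_of_ne _ hv.1]
    obtain ⟨hs, he⟩ := hc g' hfr'
    have hb1 := lastHit_le p i
    rw [wp_seq, wp_ite]
    refine ⟨hs, fun hne => ?_, fun hne => ?_⟩
    · have := he.1 hne
      simp [Store.upd_apply, hok, hok.symm, h1, lastHit, h1 ▸ this]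
      omega
    · have : p i = false := by
        rw [← h1]
        by_contra h
        exact he.2 (by simpa using h) hne
      simp [Store.upd_apply, hok, h1, h2, lastHit, this]
      omega
  · rintro g' hfr ⟨-, h2⟩
    refine hP g' (fun v hv => ?_) (by rw [h2, (hb _).2])
    rw [hfr v (by simpa [writes] using hv)]
    simp only [List.mem_cons, List.not_mem_nil, or_false, not_or] at hv
    rw [Store.upd_of_ne _ hv.2, Store.upd_of_ne _ hv.1]

theorem wp_codePat (hI : I.Fits W) (hW : 2 ≤ W) {e : AExpr} (he : e.Safe I W n g)
    (hP : ∀ g', (∀ v, v ∉ [.x, .code, .z] → g' v = g v) →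
      g' .code 0 = patWord I (e.eval I g) → P g') :
    Wp I W n (codePat e) g P := by
  unfold codePat
  rw [wp_seq, wp_set]
  refine ⟨he, wp_scan (fun z => I.rel (I.pat (e.eval I g)) z) (by decide)
    (fun g' => ⟨trivial, rfl⟩) hI.numT hW (fun g' hfr => ⟨⟨trivial, trivial⟩, ?_⟩)
    fun g' hfr h => hP g' (fun v hv => ?_) h⟩
  · have := congrFun (hfr .x (by simp)) 0
    simp [this, Store.upd_apply]
  · simp only [List.mem_cons, List.not_mem_nil, or_false, not_or] at hv
    rw [hfr v (by simp [hv]), Store.upd_of_ne _ hv.1]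

theorem wp_codeSym (hI : I.Fits W) (hW : 2 ≤ W) (hT : I.numT + 1 < W)
    (hP : ∀ g', (∀ v, v ∉ [.x, .y, .code, .z] → g' v = g v) →
      g' .code 0 = textCode I I.sym → P g') :
    Wp I W n codeSym g P := by
  unfold codeSym
  rw [wp_seq]
  refine wp_scan (fun x => I.rel x I.sym) (by decide) (fun g' => ⟨trivial, rfl⟩) hI.numP hW
    (fun g' hfr => ⟨⟨trivial, trivial⟩, by
      by_cases h : I.rel (g' .z 0) I.sym = true <;> simp [h]⟩) fun g1 hfr1 h1 => ?_
  rw [wp_ite]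
  refine ⟨trivial, fun hy => ?_, fun hy => ?_⟩
  · simp only [eval_sc, h1] at hy
    rw [wp_seq, wp_set]
    refine ⟨⟨trivial, hW⟩, ?_⟩
    refine wp_scan (fun z => I.rel (lastHit (fun x => I.rel x I.sym) I.numP - 1) z) (by decide)
      (fun g' => ⟨trivial, rfl⟩) hI.numT hW (fun g' hfr => ⟨⟨trivial, trivial⟩, ?_⟩)
      fun g' hfr h => hP g' (fun v hv => ?_) ?_
    · have := congrFun (hfr .x (by simp)) 0
      simp [this, Store.upd_apply, h1]
    · simp only [List.mem_cons, List.not_mem_nil, or_false, not_or] at hv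
      rw [hfr v (by simp [hv]), Store.upd_of_ne _ hv.1, hfr1 v (by simp [hv])]
    · rw [h, textCode, if_pos hy]; rfl
  · simp only [eval_sc, h1] at hy
    simp only [wp_set, safe_add, safe_numT, safe_lit, eval_numT, eval_lit, eval_add, true_and]
    refine ⟨⟨by omega, hT⟩, hP _ (fun v hv => ?_) ?_⟩
    · simp only [List.mem_cons, List.not_mem_nil, or_false, not_or] at hv
      rw [Store.upd_of_ne _ (by simp [hv]), hfr1 v (by simp [hv])]
    · simp [Store.upd_apply, textCode, hy]

/-- Horner's scheme, with all products below `Q² < W`. The target arrays are parameters because both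
the prefix and its least period are hashed; the bound is evaluated after `p`, `f` and `i` have been
reset, so its value must not depend on them. -/
theorem wp_hashPrefix (hI : I.Fits W) (hn : g .top 0 < n) {p f : Arr} {bound : AExpr} {b : ℕ}
    (hpf : p ≠ f) (hp : p ∉ [.top, .seed, .modulus, .i, .x, .code, .z])
    (hf : f ∉ [.top, .seed, .modulus, .i, .x, .code, .z])
    (hb : ∀ g', (∀ v, v ∉ [p, f, .i] → g' v = g v) →
      bound.Safe I W n g' ∧ bound.eval I g' = b) (hbW : b < W)
    (hr : g .seed 0 < g .modulus 0) (hT : I.numT < g .modulus 0) (hQ1 : 1 < g .modulus 0)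
    (hQ : g .modulus 0 * g .modulus 0 < W)
    (hP : ∀ g', (∀ v, v ∉ [p, f, .i, .x, .code, .z] → g' v = g v) →
      (∀ k, k ≠ g .top 0 → g' p k = g p k ∧ g' f k = g f k) →
      g' p (g .top 0) = modPow (g .seed 0) (g .modulus 0) b →
      g' f (g .top 0) = fingerprint (g .seed 0) (g .modulus 0) (patWord I) b → P g') :
    Wp I W n (hashPrefix p f bound) g P := by
  have hW : 2 ≤ W := by nlinarith
  simp only [List.mem_cons, List.not_mem_nil, or_false, not_or] at hp hf
  obtain ⟨hp1, hp2, hp3, hp4, hp5, hp6, hp7⟩ := hp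
  obtain ⟨hf1, hf2, hf3, hf4, hf5, hf6, hf7⟩ := hf
  unfold hashPrefix
  simp only [wp_seq, wp_set, wp_asg, safe_lit, eval_lit, safe_sc, eval_sc]
  refine ⟨⟨trivial, by omega, hn⟩, ⟨trivial, by omega, ?_⟩, by omega, ?_⟩
  · simpa [Store.upd_apply, (Ne.symm hp1)] using hn
  have hb0 := hb (((g.upd p (g .top 0) 1).upd f ((g.upd p (g .top 0) 1) .top 0) 0).upd .i 0 0)
    (fun v hv => by
      simp only [List.mem_cons, List.not_mem_nil, or_false, not_or] at hv
      rw [Store.upd_of_ne _ hv.2.2, Store.upd_of_ne _ hv.2.1, Store.upd_of_ne _ hv.1])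
  have fr : ∀ g' : Store, (∀ v, v ∉ [Arr.x, .code, .z, p, f, .i] → g' v =
      (((g.upd p (g .top 0) 1).upd f ((g.upd p (g .top 0) 1) .top 0) 0).upd .i 0 0) v) →
      ∀ v, v ∉ [p, f, .i, .x, .code, .z] → g' v = g v := by
    intro g' hfr v hv
    simp only [List.mem_cons, List.not_mem_nil, or_false, not_or] at hv
    rw [hfr v (by simp [hv]), Store.upd_of_ne _ hv.2.2.1, Store.upd_of_ne _ hv.2.1,
      Store.upd_of_ne _ hv.1]
  have hwr : (codePat (sc .i) ++
      asg p (sc .top) (rd p (sc .top) * sc .seed % sc .modulus) ++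
      asg f (sc .top) ((rd f (sc .top) * sc .seed + sc .code) % sc .modulus) ++
      set .i (sc .i + lit 1)).writes = [Arr.x, .code, .z, .code, .z, p, f, .i] := rfl
  refine wp_loop (fun i g' => g' .i 0 = i ∧ (∀ k, k ≠ g .top 0 → g' p k = g p k ∧ g' f k = g f k) ∧
      g' p (g .top 0) = modPow (g .seed 0) (g .modulus 0) i ∧
      g' f (g .top 0) = fingerprint (g .seed 0) (g .modulus 0) (patWord I) i) hb0.1 ?_ ?_ ?_
  · simp [Store.upd_apply, hpf, (Ne.symm hp1), hp4, hf4, modPow, fingerprint]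
    intro k hk; simp [hk]
  · rintro i g1 hi hfr ⟨h1, h2, h3, h4⟩
    rw [hb0.2] at hi
    rw [hwr] at hfr
    replace hfr := fr g1 fun v hv => hfr v (by simpa [or_comm, or_left_comm] using hv)
    simp only [wp_seq]
    refine wp_codePat hI hW trivial fun g2 hfr2 hc => ?_
    have e1 : g2 .top = g .top := by rw [hfr2 _ (by simp), hfr _ (by simp [(Ne.symm hp1), (Ne.symm hf1)])]
    have e2 : g2 .seed = g .seed := by
      rw [hfr2 _ (by simp), hfr _ (by simp [(Ne.symm hp2), (Ne.symm hf2)])]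
    have e3 : g2 .modulus = g .modulus := by
      rw [hfr2 _ (by simp), hfr _ (by simp [(Ne.symm hp3), (Ne.symm hf3)])]
    have e4 : g2 p = g1 p := hfr2 _ (by simp [hp5, hp6, hp7])
    have e5 : g2 f = g1 f := hfr2 _ (by simp [hf5, hf6, hf7])
    have e6 : g2 .i = g1 .i := hfr2 _ (by simp)
    have b1 := modPow_lt (r := g .seed 0) hQ1 i
    have b2 := fingerprint_lt (r := g .seed 0) (by omega : 0 < g .modulus 0) (patWord I) i
    have b3 : patWord I i ≤ I.numT := patCode_le _ _
    have b4 : modPow (g .seed 0) (g .modulus 0) i * g .seed 0 < W := by nlinarith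
    have b5 : fingerprint (g .seed 0) (g .modulus 0) (patWord I) i * g .seed 0 + patWord I i < W := by
      nlinarith
    simp only [eval_sc, h1] at hc
    simp only [wp_asg, wp_set, safe_sc, safe_mod, safe_mul, safe_rd, safe_add, safe_lit, eval_sc,
      eval_mod, eval_mul, eval_rd, eval_add, eval_lit, Store.upd_apply, hpf, hpf.symm,
      Ne.symm hp1, Ne.symm hp2, Ne.symm hp3, hp4, Ne.symm hp4, Ne.symm hp6, Ne.symm hf4, hf4,
      e1, e2, e3, e4, e5, e6, h1, h3, h4, hc, hn, true_and, false_and, if_false, if_true, and_true,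
      modPow, fingerprint]
    refine ⟨by omega, ⟨by omega, by omega⟩, ⟨by omega, by omega⟩, fun k hk => ?_⟩
    simpa [hk] using h2 k hk
  · rintro g' hfr ⟨h1, h2, h3, h4⟩
    rw [hb0.2] at h3 h4
    rw [hwr] at hfr
    exact hP g' (fr g' fun v hv => hfr v (by simpa [or_comm, or_left_comm] using hv)) h2 h3 h4

end

/-! ### Correctness of the preprocessing: periods and the prime modulus -/

section

variable {I : RamInput} {W n : ℕ} {g : Store} {P : Store → Prop}

theorem wp_testPeriod (hI : I.Fits W) (hW : 2 ≤ W) (hn : g .top 0 < n)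
    (hl : g .len (g .top 0) < W) :
    Wp I W n testPeriod g fun g' =>
      (g' .flag 0 ≠ 0 ↔ IsWordPeriod (patWord I) (g .len (g .top 0)) (g .y 0)) := by
  unfold testPeriod
  simp only [wp_seq, wp_set, safe_lit, eval_lit]
  refine ⟨by omega, by omega, ?_⟩
  refine wp_loop (fun k g' => g' .i 0 = k ∧
    (g' .flag 0 ≠ 0 ↔ ∀ x < k, patWord I x = patWord I (x + g .y 0))) ?_ ?_ ?_ ?_
  · simpa [Store.upd_apply] using hn
  · simp [Store.upd_apply]
  · rintro k g1 hk f1 ⟨h1, h2⟩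
    have ey : g1 .y = g .y := f1 .y (by decide)
    simp only [eval_sub, eval_rd, eval_sc, Store.upd_apply, reduceCtorEq, false_and, if_false] at hk
    simp only [wp_seq]
    refine wp_codePat hI hW trivial fun g2 f2 h3 => ?_
    rw [wp_set]
    refine ⟨trivial, wp_codePat hI hW ?_ fun g3 f3 h4 => ?_⟩
    · simp [Store.upd_apply, f2, h1, ey]; omega
    have e1 : g3 .flag 0 = g1 .flag 0 := by
      rw [f3 _ (by decide), Store.upd_of_ne _ (by decide), f2 _ (by decide)]
    have e2 : g3 .i 0 = k := by
      rw [f3 _ (by decide), Store.upd_of_ne _ (by decide), f2 _ (by decide), h1]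
    have e3 : g3 .j 0 = patWord I k := by
      rw [f3 _ (by decide)]; simp [Store.upd_apply, h3, h1]
    have e4 : g3 .code 0 = patWord I (k + g .y 0) := by
      rw [h4]; simp [Store.upd_apply, f2, h1, ey]
    rw [wp_ite]
    refine ⟨⟨trivial, trivial⟩, fun hc => ?_, fun hc => ?_⟩
    · simp only [eval_eq, eval_sc, e3, e4] at hc
      have hc' : patWord I k = patWord I (k + g .y 0) := by
        by_contra h; simp [h] at hc
      simp only [wp_skip, wp_set, safe_add, safe_sc, safe_lit, eval_sc, eval_lit, eval_add, e2,
        Store.upd_apply, reduceCtorEq, false_and, if_false, if_true, and_self, e1, true_and]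
      refine ⟨⟨by omega, by omega⟩, h2.trans ⟨fun h x hx => ?_, fun h x hx => h x (by omega)⟩⟩
      rcases Nat.lt_succ_iff_lt_or_eq.1 hx with hx | rfl
      exacts [h x hx, hc']
    · simp only [eval_eq, eval_sc, e3, e4] at hc
      have hc' : patWord I k ≠ patWord I (k + g .y 0) := by
        intro h; simp [h] at hc
      simp only [wp_set, safe_add, safe_sc, safe_lit, eval_sc, eval_lit, eval_add, e2,
        Store.upd_apply, reduceCtorEq, false_and, if_false, if_true, and_self, true_and]
      refine ⟨by omega, ⟨by omega, by omega⟩, ⟨fun h => absurd rfl h, fun h => ?_⟩⟩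
      exact absurd (h k (by omega)) hc'
  · rintro g1 - ⟨-, h2⟩
    simp only [eval_sub, eval_rd, eval_sc, Store.upd_apply, reduceCtorEq, false_and, if_false] at h2
    exact h2.trans ⟨fun h x hx => h x (by omega), fun h x hx => h x (by omega)⟩

/-- The lengths are tested in decreasing order from `len` down to 1, so the last period recorded is
the least one. -/
theorem wp_findPeriod (hI : I.Fits W) (hW : 2 ≤ W) (hn : g .top 0 < n)
    (hl : g .len (g .top 0) < W) (hl0 : 0 < g .len (g .top 0)) :
    Wp I W n findPeriod g fun g' => (∀ k, k ≠ g .top 0 → g' .per k = g .per k) ∧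
      IsLeastWordPeriod (patWord I) (g .len (g .top 0)) (g' .per (g .top 0)) := by
  unfold findPeriod
  simp only [wp_seq, wp_set, wp_asg, safe_rd, safe_sc, eval_rd, eval_sc, Store.upd_apply,
    reduceCtorEq, false_and, if_false, hn, and_true, true_and]
  refine wp_loop (fun k g' => g' .y 0 = g .len (g .top 0) - k ∧
    (∀ k, k ≠ g .top 0 → g' .per k = g .per k) ∧ 0 < g' .per (g .top 0) ∧
    g' .per (g .top 0) ≤ g .len (g .top 0) ∧
    IsWordPeriod (patWord I) (g .len (g .top 0)) (g' .per (g .top 0)) ∧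
    ∀ d, g .len (g .top 0) - k < d → IsWordPeriod (patWord I) (g .len (g .top 0)) d →
      g' .per (g .top 0) ≤ d) ?_ ?_ ?_ ?_
  · simpa [Store.upd_apply] using hn
  · simp only [Store.upd_apply, reduceCtorEq, false_and, if_false, and_self, if_true, true_and,
      tsub_zero, hl0, le_refl]
    exact ⟨fun k hk => by simp [hk], .self _ _, fun d hd _ => hd.le⟩
  · rintro k g1 hk f1 ⟨h1, h2, h3, h4, h5, h6⟩
    have et : g1 .top = g .top := f1 .top (by decide)
    have el : g1 .len = g .len := f1 .len (by decide)
    simp only [eval_rd, eval_sc, Store.upd_apply, reduceCtorEq, false_and, if_false] at hk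
    rw [wp_seq, wp_seq]
    refine (wp_testPeriod hI hW (by rwa [et]) (by rwa [et, el])).mono fun g2 f2 h7 => ?_
    have et2 : g2 .top = g .top := by rw [f2 _ (by decide), et]
    have ep : g2 .per = g1 .per := f2 _ (by decide)
    have ey : g2 .y 0 = g .len (g .top 0) - k := by rw [f2 _ (by decide), h1]
    rw [et, el, h1] at h7
    rw [wp_ite]
    refine ⟨trivial, fun hc => ?_, fun hc => ?_⟩
    · have hper := h7.1 hc
      simp only [wp_asg, wp_set, safe_sc, eval_sc, safe_sub, safe_lit, eval_sub, eval_lit, et2, hn,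
        ey, Store.upd_apply, reduceCtorEq, false_and, if_false, and_self, if_true, true_and]
      refine ⟨by omega, by omega, fun k hk => ?_, by omega, by omega, hper, fun d hd hd' => by omega⟩
      rw [if_neg hk, ep, h2 k hk]
    · have hper := mt h7.2 (by simpa using hc)
      simp only [wp_skip, wp_set, safe_sc, eval_sc, safe_sub, safe_lit, eval_sub, eval_lit, ey, ep,
        Store.upd_apply, reduceCtorEq, false_and, if_false, and_self, if_true, true_and]
      refine ⟨by omega, by omega, h2, h3, h4, h5, fun d hd hd' => ?_⟩
      by_cases hd1 : d = g .len (g .top 0) - k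
      · exact absurd (hd1 ▸ hd') hper
      · exact h6 d (by omega) hd'
  · rintro g1 - ⟨-, h2, h3, h4, h5, h6⟩
    simp only [eval_rd, eval_sc, Store.upd_apply, reduceCtorEq, false_and, if_false] at h6
    exact ⟨h2, h3, h5, fun d hd hd' => h6 d (by omega) hd'⟩

/-- The least prime that is at least `X`. -/
noncomputable def nextPrime (X : ℕ) : ℕ := Nat.find (Nat.exists_infinite_primes X)

theorem nextPrime_prime (X : ℕ) : (nextPrime X).Prime :=
  (Nat.find_spec (Nat.exists_infinite_primes X)).2

theorem le_nextPrime (X : ℕ) : X ≤ nextPrime X :=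
  (Nat.find_spec (Nat.exists_infinite_primes X)).1

theorem nextPrime_le {X q : ℕ} (h : X ≤ q) (hq : q.Prime) : nextPrime X ≤ q :=
  Nat.find_min' (Nat.exists_infinite_primes X) ⟨h, hq⟩

theorem nextPrime_le_two_mul {X : ℕ} (hX : X ≠ 0) : nextPrime X ≤ 2 * X := by
  obtain ⟨q, hq, hq1, hq2⟩ := Nat.exists_prime_lt_and_le_two_mul X hX
  exact (nextPrime_le hq1.le hq).trans hq2

/-- The search moves on at most `X` times. By Bertrand's postulate there is a prime at most `2 * X`,
so this many rounds suffice, and no prime is skipped. -/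
theorem wp_findPrime {e : AExpr} (he : e.Safe I W n g) (h2 : 2 ≤ e.eval I g)
    (hW : 2 * e.eval I g + 1 < W) :
    Wp I W n (findPrime e) g fun g' => g' .modulus 0 = nextPrime (e.eval I g) := by
  unfold findPrime
  rw [wp_seq, wp_set]
  refine ⟨he, ?_⟩
  generalize e.eval I g = X at *
  have eX : (sc .modulus).eval I (g.upd .modulus 0 X) = X := by simp [Store.upd_apply]
  refine wp_loop (fun k g' => X ≤ g' .modulus 0 ∧ g' .modulus 0 ≤ X + k ∧
    (∀ y, X ≤ y → y < g' .modulus 0 → ¬ y.Prime) ∧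
    ((g' .modulus 0).Prime ∨ g' .modulus 0 = X + k)) trivial ?_ ?_ ?_
  · simp only [Store.upd_apply, and_self, if_true, le_refl, add_zero, or_true, and_true, true_and]
    intro y h1 h2; omega
  · rintro k g1 hk - ⟨h3, h4, h5, h6⟩
    rw [eX] at hk
    simp only [wp_seq, wp_set, safe_lit, eval_lit]
    refine ⟨by omega, by omega, ?_⟩
    refine wp_loop (fun k g' => g' .i 0 = k + 2 ∧
      (g' .flag 0 ≠ 0 ↔ ∀ x < k + 2, 2 ≤ x → ¬ x ∣ g1 .modulus 0)) ?_ ?_ ?_ ?_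
    · simp; omega
    · simp only [Store.upd_apply, reduceCtorEq, false_and, if_false, and_self, if_true, true_and,
        zero_add]
      exact ⟨fun _ x hx hx2 => by omega, fun _ => one_ne_zero⟩
    · rintro k' g2 hk' f2 ⟨h7, h8⟩
      have em : g2 .modulus = g1 .modulus := by
        rw [f2 _ (by decide), Store.upd_of_ne _ (by decide), Store.upd_of_ne _ (by decide)]
      simp only [eval_sub, eval_sc, eval_lit, Store.upd_apply, reduceCtorEq, false_and,
        if_false] at hk'
      rw [wp_seq, wp_ite]
      refine ⟨⟨trivial, trivial⟩, fun hc => ?_, fun hc => ?_⟩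
      · simp only [eval_mod, eval_sc, em, h7] at hc
        simp only [wp_skip, wp_set, safe_add, safe_sc, safe_lit, eval_sc, eval_lit, eval_add, h7,
          Store.upd_apply, reduceCtorEq, false_and, if_false, if_true, and_self, true_and]
        refine ⟨⟨by omega, by omega⟩, h8.trans ⟨fun h x hx => ?_,
          fun h x hx => h x (by omega)⟩⟩
        by_cases hx' : x = k' + 2
        · intro _ hd; exact hc (hx' ▸ Nat.mod_eq_zero_of_dvd hd)
        · exact h x (by omega)
      · simp only [eval_mod, eval_sc, em, h7] at hc
        simp only [wp_set, safe_add, safe_sc, safe_lit, eval_sc, eval_lit, eval_add, h7,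
          Store.upd_apply, reduceCtorEq, false_and, if_false, if_true, and_self, true_and]
        refine ⟨by omega, ⟨by omega, by omega⟩, fun h => absurd rfl h, fun h => ?_⟩
        exact absurd (Nat.dvd_of_mod_eq_zero hc) (h (k' + 2) (by omega) (by omega))
    · rintro g2 f2 ⟨-, h8⟩
      have em : g2 .modulus = g1 .modulus := by
        rw [f2 _ (by decide), Store.upd_of_ne _ (by decide), Store.upd_of_ne _ (by decide)]
      simp only [eval_sub, eval_sc, eval_lit, Store.upd_apply, reduceCtorEq, false_and,
        if_false] at h8
      have h9 : g2 .flag 0 ≠ 0 ↔ (g1 .modulus 0).Prime := by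
        rw [h8, Nat.prime_def_lt']
        exact ⟨fun h => ⟨by omega, fun x hx hx' => h x (by omega) hx⟩,
          fun h x hx hx' => h.2 x hx' (by omega)⟩
      rw [wp_ite]
      refine ⟨trivial, fun hc => ?_, fun hc => ?_⟩
      · rw [wp_skip, em]
        exact ⟨h3, by omega, h5, Or.inl (h9.1 hc)⟩
      · have hnp := mt h9.2 (by simpa using hc)
        have h6' := h6.resolve_left hnp
        simp only [wp_set, safe_add, safe_sc, safe_lit, eval_sc, eval_lit, eval_add, em,
          Store.upd_apply, if_true, and_self, true_and]
        refine ⟨⟨by omega, by omega⟩, by omega, by omega, fun y hy hy' => ?_, Or.inr (by omega)⟩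
        by_cases hy2 : y = g1 .modulus 0
        · rwa [hy2]
        · exact h5 y hy (by omega)
  · rintro g1 - ⟨h3, h4, h5, h6⟩
    rw [eX] at h4 h6
    have h7 : g1 .modulus 0 ≤ nextPrime X := by
      by_contra! hlt
      exact h5 _ (le_nextPrime X) hlt (nextPrime_prime X)
    refine h7.antisymm ?_
    rcases h6 with h | h
    · exact nextPrime_le h3 h
    · exact (nextPrime_le_two_mul (by omega)).trans (by omega)

end

/-! ### Correctness of the preprocessing: the levels -/

/-- The lengths of the prefixes of a pattern of length `m` that are looked for. -/
def prefixLen (m : ℕ) : ℕ → ℕ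
  | 0 => 0
  | s + 1 => min m (prefixLen m s + prefixLen m s / 2 + 1)

theorem prefixLen_le (m s : ℕ) : prefixLen m s ≤ m := by
  cases s with
  | zero => exact Nat.zero_le _
  | succ s => exact min_le_left _ _

theorem prefixLen_lt_succ {m s : ℕ} (h : prefixLen m s < m) :
    prefixLen m s < prefixLen m (s + 1) := by
  simp only [prefixLen]; omega

theorem le_prefixLen (m : ℕ) {s : ℕ} (hs : s ≤ m) : s ≤ prefixLen m s := by
  induction s with
  | zero => exact Nat.zero_le _
  | succ s ih => have := ih (by omega); simp only [prefixLen]; omega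

/-- Two rounds of growth by a factor 3/2 at least double `ℓ + 1`, as long as the cap `m` is not
reached. -/
theorem two_pow_le_prefixLen {m i : ℕ} (h : prefixLen m (2 * i) < m) :
    2 ^ i ≤ prefixLen m (2 * i) + 1 := by
  induction i with
  | zero => simp
  | succ i ih =>
    have e : 2 * (i + 1) = 2 * i + 1 + 1 := by ring
    rw [e] at h ⊢
    simp only [prefixLen] at h ⊢
    have := ih (by omega)
    rw [pow_succ]
    omega

/-- This bounds the number of levels, and hence the length of the arrays, by `O(log m)`. -/
theorem lt_of_prefixLen_lt {m s : ℕ} (h : prefixLen m s < m) : s < 2 * (Nat.log 2 m + 1) := by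
  by_contra! hs
  have mono : ∀ a b, a ≤ b → prefixLen m b < m → prefixLen m a < m := by
    intro a b hab hb
    induction b with
    | zero => obtain rfl : a = 0 := by omega
              exact hb
    | succ b ih =>
      rcases Nat.le_succ_iff.1 hab with h | rfl
      · refine ih h ?_
        by_contra h'
        simp only [prefixLen] at hb
        omega
      · exact hb
  have h1 := two_pow_le_prefixLen (mono _ _ hs h)
  have h2 := Nat.lt_pow_succ_log_self (b := 2) (by norm_num) m
  have h3 := mono _ _ hs h
  have : 2 ^ (Nat.log 2 m + 1) = 2 ^ (Nat.log 2 m).succ := rfl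
  omega

/-- The stored constants of a level. -/
structure IsLevel (I : RamInput) (g : Store) (s : ℕ) : Prop where
  powLen : g .powLen s = modPow (g .seed 0) (g .modulus 0) (g .len s)
  fpLen : g .fpLen s = fingerprint (g .seed 0) (g .modulus 0) (patWord I) (g .len s)
  per : IsLeastWordPeriod (patWord I) (g .len s) (g .per s)
  powPer : g .powPer s = modPow (g .seed 0) (g .modulus 0) (g .per s)
  fpPer : g .fpPer s = fingerprint (g .seed 0) (g .modulus 0) (patWord I) (g .per s)

/-- The constants of all levels up to `top` are stored. -/
structure HasLevels (I : RamInput) (n : ℕ) (g : Store) : Prop where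
  top_lt : g .top 0 < n
  len : ∀ s ≤ g .top 0, g .len s = prefixLen I.patLen s
  len_lt : ∀ s < g .top 0, prefixLen I.patLen s < I.patLen
  level : ∀ s, 1 ≤ s → s ≤ g .top 0 → IsLevel I g s
  per_zero : g .per 0 = 1
  powPer_zero : g .powPer 0 = 0
  fpPer_zero : g .fpPer 0 = 0

theorem HasLevels.congr {I : RamInput} {n : ℕ} {g g' : Store} (h : HasLevels I n g)
    (hg : ∀ v ∈ [Arr.top, .len, .powLen, .fpLen, .per, .powPer, .fpPer, .seed, .modulus],
      g' v = g v) : HasLevels I n g' := by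
  simp only [List.mem_cons, List.not_mem_nil, or_false, forall_eq_or_imp, forall_eq] at hg
  obtain ⟨e1, e2, e3, e4, e5, e6, e7, e8, e9⟩ := hg
  refine ⟨?_, ?_, ?_, fun s h1 h2 => ?_, ?_, ?_, ?_⟩
  · rw [e1]; exact h.top_lt
  · rw [e1, e2]; exact h.len
  · rw [e1]; exact h.len_lt
  · rw [e1] at h2
    have := h.level s h1 h2
    exact ⟨by rw [e3, e8, e9, e2]; exact this.powLen, by rw [e4, e8, e9, e2]; exact this.fpLen,
      by rw [e2, e5]; exact this.per, by rw [e6, e8, e9, e5]; exact this.powPer,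
      by rw [e7, e8, e9, e5]; exact this.fpPer⟩
  · rw [e5]; exact h.per_zero
  · rw [e6]; exact h.powPer_zero
  · rw [e7]; exact h.fpPer_zero

section

variable {I : RamInput} {W n : ℕ} {g : Store} {P : Store → Prop}

/-- All writes to the tables of constants are at the new index, so the older levels survive. -/
theorem wp_addLevel (hI : I.Fits W) (h : HasLevels I n g) (hn : g .top 0 + 1 < n)
    (hnW : n < W) (hm : 2 * I.patLen + 1 < W)
    (hl : prefixLen I.patLen (g .top 0) < I.patLen) (hr : g .seed 0 < g .modulus 0)
    (hT : I.numT < g .modulus 0) (hQ1 : 1 < g .modulus 0)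
    (hQ : g .modulus 0 * g .modulus 0 < W) :
    Wp I W n addLevel g fun g' => HasLevels I n g' ∧ g' .top 0 = g .top 0 + 1 := by
  have hW : 2 < W := by nlinarith
  have hlen := h.len _ le_rfl
  unfold addLevel
  simp only [wp_seq, wp_set, safe_add, safe_sc, safe_lit, eval_sc, eval_lit, eval_add, safe_rd,
    safe_sub, safe_div, eval_sub, eval_rd, eval_div, Store.upd_apply, reduceCtorEq, false_and,
    if_false, if_true, and_self, true_and, Nat.add_sub_cancel, hlen]
  refine ⟨⟨by omega, by omega⟩, by omega, ?_⟩
  -- The store becomes a variable known only through the few values needed later, which keeps the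
  -- terms small.
  generalize hg0 : (g.upd .top 0 (g .top 0 + 1)).upd .y 0 _ = g0
  have f0 : ∀ v, v ∉ [Arr.top, .y] → g0 v = g v := by
    intro v hv
    simp only [List.mem_cons, List.not_mem_nil, or_false, not_or] at hv
    rw [← hg0, Store.upd_of_ne _ hv.2, Store.upd_of_ne _ hv.1]
  have t0 : g0 .top 0 = g .top 0 + 1 := by rw [← hg0]; simp [Store.upd_apply]
  have y0 : g0 .y 0 = prefixLen I.patLen (g .top 0) + prefixLen I.patLen (g .top 0) / 2 + 1 := by
    rw [← hg0]; simp [Store.upd_apply]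
  clear hg0
  have step1 : Wp I W n (ite (op .lt (sc .y) patLen) (asg .len (sc .top) (sc .y))
      (asg .len (sc .top) patLen)) g0 fun g1 =>
      g1 = g0.upd .len (g .top 0 + 1) (prefixLen I.patLen (g .top 0 + 1)) := by
    rw [wp_ite]
    refine ⟨⟨trivial, trivial⟩, fun hc => ?_, fun hc => ?_⟩
    · simp only [eval_lt, eval_sc, eval_patLen, y0] at hc
      simp only [wp_asg, safe_sc, eval_sc, t0, y0, true_and]
      refine ⟨hn, ?_⟩
      congr 1
      simp only [prefixLen]
      split at hc <;> omega
    · simp only [eval_lt, eval_sc, eval_patLen, y0] at hc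
      simp only [wp_asg, safe_sc, eval_sc, t0, safe_patLen, eval_patLen, true_and]
      refine ⟨hn, ?_⟩
      congr 1
      simp only [prefixLen]
      split at hc <;> omega
  refine step1.mono fun g1 _ hg1 => ?_
  have t1 : g1 .top 0 = g .top 0 + 1 := by rw [hg1, Store.upd_of_ne _ (by decide), t0]
  have l1 : g1 .len (g .top 0 + 1) = prefixLen I.patLen (g .top 0 + 1) := by
    rw [hg1]; simp [Store.upd_apply]
  have l1' : ∀ s, s ≠ g .top 0 + 1 → g1 .len s = g .len s := by
    intro s hs; rw [hg1]; simp [Store.upd_apply, hs, f0]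
  have f1 : ∀ v, v ∉ [Arr.top, .y, .len] → g1 v = g v := by
    intro v hv
    simp only [List.mem_cons, List.not_mem_nil, or_false, not_or] at hv
    rw [hg1, Store.upd_of_ne _ hv.2.2, f0 _ (by simp [hv])]
  clear hg1 step1 f0 t0 y0
  have s1 : g1 .seed = g .seed := f1 _ (by decide)
  have q1 : g1 .modulus = g .modulus := f1 _ (by decide)
  have hlt : prefixLen I.patLen (g .top 0 + 1) < W := (prefixLen_le _ _).trans_lt (by omega)
  refine wp_hashPrefix hI (by omega) (b := prefixLen I.patLen (g .top 0 + 1)) (by decide)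
    (by decide) (by decide) (fun g' f => ?_) hlt (by rwa [s1, q1]) (by rwa [q1]) (by rwa [q1])
    (by rwa [q1]) fun g2 f2 h2 h2p h2f => ?_
  · have e1 : g' .top = g1 .top := f _ (by decide)
    have e2 : g' .len = g1 .len := f _ (by decide)
    simp [e1, e2, t1, l1, hn]
  have t2 : g2 .top = g1 .top := f2 _ (by decide)
  have l2 : g2 .len = g1 .len := f2 _ (by decide)
  refine (wp_findPeriod hI hW.le (by rw [t2, t1]; omega) (by rw [t2, t1, l2, l1]; exact hlt)
    (by rw [t2, t1, l2, l1]; exact (prefixLen_lt_succ hl).pos)).mono fun g3 f3 h3 => ?_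
  rw [t2, l2, t1, l1] at h3
  obtain ⟨h3', h3⟩ := h3
  have hper : g3 .per (g .top 0 + 1) ≤ prefixLen I.patLen (g .top 0 + 1) :=
    h3.le (prefixLen_lt_succ hl).pos
  have t3 : g3 .top = g1 .top := by rw [f3 _ (by decide), t2]
  have l3 : g3 .len = g1 .len := by rw [f3 _ (by decide), l2]
  have s3 : g3 .seed = g .seed := by rw [f3 _ (by decide), f2 _ (by decide), s1]
  have q3 : g3 .modulus = g .modulus := by rw [f3 _ (by decide), f2 _ (by decide), q1]
  refine wp_hashPrefix hI (by rw [t3, t1]; omega) (b := g3 .per (g .top 0 + 1)) (by decide)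
    (by decide) (by decide) (fun g' f => ?_) (hper.trans_lt hlt) (by rwa [s3, q3]) (by rwa [q3])
    (by rwa [q3]) (by rwa [q3]) fun g4 f4 h4 h4p h4f => ?_
  · have e1 : g' .top = g3 .top := f _ (by decide)
    have e2 : g' .per = g3 .per := f _ (by decide)
    simp [e1, e2, t1, t3, hn]
  have t4 : g4 .top = g1 .top := by rw [f4 _ (by decide), t3]
  have l4 : g4 .len = g1 .len := by rw [f4 _ (by decide), l3]
  have s4 : g4 .seed = g .seed := by rw [f4 _ (by decide), s3]
  have q4 : g4 .modulus = g .modulus := by rw [f4 _ (by decide), q3]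
  have p4 : g4 .per = g3 .per := f4 _ (by decide)
  have a4 : g4 .powLen = g2 .powLen := by rw [f4 _ (by decide), f3 _ (by decide)]
  have b4 : g4 .fpLen = g2 .fpLen := by rw [f4 _ (by decide), f3 _ (by decide)]
  rw [t3, t1] at h4 h4p h4f
  rw [t1] at h2 h2p h2f
  have per' : ∀ s, s ≠ g .top 0 + 1 → g4 .per s = g .per s := by
    intro s hs; rw [p4, h3' s hs, f2 _ (by decide), f1 _ (by decide)]
  have powPer' : ∀ s, s ≠ g .top 0 + 1 → g4 .powPer s = g .powPer s := by
    intro s hs; rw [(h4 s hs).1, f3 _ (by decide), f2 _ (by decide), f1 _ (by decide)]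
  have fpPer' : ∀ s, s ≠ g .top 0 + 1 → g4 .fpPer s = g .fpPer s := by
    intro s hs; rw [(h4 s hs).2, f3 _ (by decide), f2 _ (by decide), f1 _ (by decide)]
  have powLen' : ∀ s, s ≠ g .top 0 + 1 → g4 .powLen s = g .powLen s := by
    intro s hs; rw [a4, (h2 s hs).1, f1 _ (by decide)]
  have fpLen' : ∀ s, s ≠ g .top 0 + 1 → g4 .fpLen s = g .fpLen s := by
    intro s hs; rw [b4, (h2 s hs).2, f1 _ (by decide)]
  refine ⟨⟨by rw [t4, t1]; omega, fun s hs => ?_, fun s hs => ?_, fun s hs1 hs => ?_,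
    by rw [per' _ (by omega), h.per_zero], by rw [powPer' _ (by omega), h.powPer_zero],
    by rw [fpPer' _ (by omega), h.fpPer_zero]⟩, by rw [t4, t1]⟩
  · rw [l4]
    by_cases hs' : s = g .top 0 + 1
    · rw [hs', l1]
    · rw [l1' s hs', h.len s (by rw [t4, t1] at hs; omega)]
  · rw [t4, t1] at hs
    by_cases hs' : s = g .top 0
    · rwa [hs']
    · exact h.len_lt s (by omega)
  · rw [t4, t1] at hs
    by_cases hs' : s = g .top 0 + 1
    · subst hs'
      exact ⟨by rw [s4, q4, l4, l1, a4, h2p, s1, q1], by rw [s4, q4, l4, l1, b4, h2f, s1, q1],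
        by rw [l4, l1, p4]; exact h3, by rw [s4, q4, p4, h4p, s3, q3],
        by rw [s4, q4, p4, h4f, s3, q3]⟩
    · have := h.level s hs1 (by omega)
      exact ⟨by rw [s4, q4, l4, l1' s hs', powLen' s hs', this.powLen],
        by rw [s4, q4, l4, l1' s hs', fpLen' s hs', this.fpLen],
        by rw [l4, l1' s hs', per' s hs']; exact this.per,
        by rw [s4, q4, per' s hs', powPer' s hs', this.powPer],
        by rw [s4, q4, per' s hs', fpPer' s hs', this.fpPer]⟩

/-- The loop runs `m` times because each new level lengthens the prefix by at least one letter. Idle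
rounds change nothing, and `lt_of_prefixLen_lt` keeps the indices in range. -/
theorem wp_addLevels (hI : I.Fits W) (hg : ∀ v ∈ [Arr.top, .len, .powPer, .fpPer], g v 0 = 0)
    (hn : 2 * (Nat.log 2 I.patLen + 1) < n)
    (hnW : n < W) (hm : 2 * I.patLen + 1 < W) (hr : g .seed 0 < g .modulus 0)
    (hT : I.numT < g .modulus 0) (hQ1 : 1 < g .modulus 0)
    (hQ : g .modulus 0 * g .modulus 0 < W) :
    Wp I W n addLevels g fun g' => HasLevels I n g' ∧ g' .len (g' .top 0) = I.patLen := by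
  have hW : 2 < W := by nlinarith
  simp only [List.mem_cons, List.not_mem_nil, or_false, forall_eq_or_imp, forall_eq] at hg
  obtain ⟨z1, z2, z3, z4⟩ := hg
  unfold addLevels
  simp only [wp_seq, wp_set, safe_lit, eval_lit]
  refine ⟨by omega, ?_⟩
  refine wp_loop (fun k g' => HasLevels I n g' ∧
    (g' .top 0 = k ∨ g' .len (g' .top 0) = I.patLen)) trivial ?_ ?_ ?_
  · refine ⟨⟨?_, ?_, ?_, ?_, ?_, ?_, ?_⟩, Or.inl ?_⟩ <;>
      simp only [Store.upd_apply, reduceCtorEq, false_and, if_false, if_true, and_self, z1, z3, z4]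
    · omega
    · intro s hs; obtain rfl : s = 0 := by omega
      exact z2
    · intro s hs; omega
    · intro s hs hs'; omega
  · rintro k g1 - f1 ⟨h1, h2⟩
    have s1 : g1 .seed = g .seed := by rw [f1 _ (by decide), Store.upd_of_ne _ (by decide)]
    have q1 : g1 .modulus = g .modulus := by rw [f1 _ (by decide), Store.upd_of_ne _ (by decide)]
    have hlen := h1.len _ le_rfl
    rw [wp_ite]
    refine ⟨by simp [h1.top_lt], fun hc => ?_, fun hc => ?_⟩
    · simp only [eval_lt, eval_rd, eval_sc, eval_patLen, hlen] at hc
      have hlt : prefixLen I.patLen (g1 .top 0) < I.patLen := by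
        by_contra h; simp [h] at hc
      have := lt_of_prefixLen_lt hlt
      refine (wp_addLevel hI h1 (by omega) hnW hm hlt (by rwa [s1, q1]) (by rwa [q1])
        (by rwa [q1]) (by rwa [q1])).mono fun g2 _ h3 => ⟨h3.1, Or.inl ?_⟩
      rw [h3.2]
      rcases h2 with h2 | h2 <;> omega
    · simp only [eval_lt, eval_rd, eval_sc, eval_patLen, hlen] at hc
      have hle : ¬ prefixLen I.patLen (g1 .top 0) < I.patLen := by
        intro h; simp [h] at hc
      rw [wp_skip]
      have := prefixLen_le I.patLen (g1 .top 0)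
      exact ⟨h1, Or.inr (by omega)⟩
  · rintro g1 - ⟨h1, h2⟩
    refine ⟨h1, ?_⟩
    rcases h2 with h2 | h2
    · have e := h1.len _ le_rfl
      have h3 := prefixLen_le I.patLen I.patLen
      have h4 := le_prefixLen I.patLen le_rfl
      simp only [eval_patLen] at h2
      rw [h2] at e ⊢
      omega
    · exact h2

theorem safe_powPatLen (a : ℕ) (hm : 0 < I.patLen) (hW : I.patLen ^ a < W) :
    (powPatLen a).Safe I W n g ∧ (powPatLen a).eval I g = I.patLen ^ a := by
  induction a with
  | zero => exact ⟨by simpa [powPatLen] using hW, rfl⟩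
  | succ a ih =>
    rw [pow_succ] at hW ⊢
    obtain ⟨h1, h2⟩ := ih (by nlinarith)
    exact ⟨⟨h1, trivial, by rw [h2]; exact hW⟩, by simp [powPatLen, h2]⟩

/-- The modulus is at most twice the lower bound `c * m ^ a`, so `hW` makes its square fit into a
word. -/
theorem wp_preprocess {c a : ℕ} (hI : I.Fits W)
    (hg : ∀ v ∈ [Arr.top, .len, .powPer, .fpPer], g v 0 = 0)
    (hn : 2 * (Nat.log 2 I.patLen + 1) < n) (hnW : n < W) (hm : 2 ≤ I.patLen)
    (hT : I.numT < c * I.patLen ^ a) (hX : I.patLen ≤ c * I.patLen ^ a)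
    (hW : (2 * (c * I.patLen ^ a)) * (2 * (c * I.patLen ^ a)) < W) :
    Wp I W n (preprocess c a) g fun g' => HasLevels I n g' ∧ g' .len (g' .top 0) = I.patLen ∧
      g' .modulus 0 = nextPrime (c * I.patLen ^ a) ∧ g' .seed 0 = g .seed 0 % g' .modulus 0 ∧
      g' (.time true) 0 = I.patLen := by
  have hc : 0 < c := by by_contra h; simp [Nat.eq_zero_of_not_pos h] at hX; omega
  have hp : 0 < I.patLen ^ a := by positivity
  have h1 : I.patLen ^ a ≤ c * I.patLen ^ a := Nat.le_mul_of_pos_left _ hc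
  have h2 : c ≤ c * I.patLen ^ a := Nat.le_mul_of_pos_right _ hp
  have e : 2 * (2 * (c * I.patLen ^ a)) ≤ (2 * (c * I.patLen ^ a)) * (2 * (c * I.patLen ^ a)) :=
    Nat.mul_le_mul_right _ (by omega)
  obtain ⟨h3, h4⟩ := safe_powPatLen (I := I) (W := W) (n := n) (g := g) a (by omega) (by omega)
  unfold preprocess
  simp only [wp_seq]
  have h5 : (lit c * powPatLen a).eval I g = c * I.patLen ^ a := by simp [h4]
  refine (wp_findPrime ((safe_mul ..).2 ⟨by simp; omega, h3, by rw [eval_lit, h4]; omega⟩) (by omega)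
    (by omega)).mono fun g1 f1 hq => ?_
  rw [h5] at hq
  have hq2 : c * I.patLen ^ a ≤ g1 .modulus 0 := hq ▸ le_nextPrime _
  have hq3 : g1 .modulus 0 ≤ 2 * (c * I.patLen ^ a) := hq ▸ nextPrime_le_two_mul (by omega)
  -- The list of written arrays does not depend on the expression; a closed instance allows
  -- `decide`.
  replace f1 : ∀ v, v ∉ (findPrime (lit 0)).writes → g1 v = g v := f1
  rw [wp_set]
  have hs : (g1 .seed 0 % g1 .modulus 0) < g1 .modulus 0 := Nat.mod_lt _ (by omega)
  refine ⟨⟨trivial, trivial⟩, ?_⟩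
  refine (wp_addLevels hI (fun v hv => ?_) hn hnW (by omega) ?_ ?_ ?_ ?_).mono
    fun g2 f2 ⟨h6, h7⟩ => ?_
  · simp only [List.mem_cons, List.not_mem_nil, or_false] at hv
    rcases hv with rfl | rfl | rfl | rfl <;>
      rw [Store.upd_of_ne _ (by decide), f1 _ (by decide)] <;> exact hg _ (by simp)
  · simpa [Store.upd_apply] using hs
  · rw [Store.upd_of_ne _ (by decide)]; omega
  · rw [Store.upd_of_ne _ (by decide)]; omega
  · rw [Store.upd_of_ne _ (by decide)]
    exact (Nat.mul_le_mul hq3 hq3).trans_lt hW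
  · have q2 : g2 .modulus = g1 .modulus := by rw [f2 _ (by decide), Store.upd_of_ne _ (by decide)]
    have s2 : g2 .seed 0 = g .seed 0 % g1 .modulus 0 := by
      rw [f2 _ (by decide)]; simp [Store.upd_apply, f1 .seed (by decide)]
    rw [wp_set]
    refine ⟨trivial, h6.congr fun v hv => Store.upd_of_ne _ (fun h => ?_) _ _, ?_, ?_, ?_, ?_⟩
    · subst h; simp at hv
    all_goals simp only [Store.upd_apply, reduceCtorEq, false_and, if_false, q2, s2, h7, hq,
      eval_patLen, and_self, if_true]

end

/-! ## The program for a text letter -/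

/-- Remove the first candidate of level `i`. -/
def popFirst (b : Bool) : ACmd :=
  ite (op .eq (rd (.first b) (sc .i)) (rd (.last b) (sc .i))) (asg (.full b) (sc .i) (lit 0))
    (asg (.first b) (sc .i) (rd (.first b) (sc .i) + rd .per (sc .i)) ++
      asg (.fpAt b) (sc .i) ((rd (.fpAt b) (sc .i) * rd .powPer (sc .i) + rd .fpPer (sc .i)) %
        sc .modulus))

/-- Add the candidate `x` to level `i + 1`, or report it if this is the last level. -/
def accept (b : Bool) : ACmd :=
  ite (op .lt (rd .len (sc .i + lit 1)) patLen)
    (ite (rd (.full b) (sc .i + lit 1)) skip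
      (asg (.first b) (sc .i + lit 1) (sc .x) ++ asg (.fpAt b) (sc .i + lit 1) (sc .y) ++
        asg (.full b) (sc .i + lit 1) (lit 1)) ++
      asg (.last b) (sc .i + lit 1) (sc .x))
    (ite (op .lt (sc (.time b)) (lit 2 * patLen)) (set .out (lit 1)) skip)

/-- Move the first candidate of level `i` up if its prefix of the next length is complete. -/
def moveUp (b : Bool) : ACmd :=
  set .i (sc .i - lit 1) ++
    ite (rd (.full b) (sc .i))
      (ite (op .eq (rd (.first b) (sc .i) + rd .len (sc .i + lit 1)) (sc (.time b)))
        (set .x (rd (.first b) (sc .i)) ++ set .y (rd (.fpAt b) (sc .i)) ++ popFirst b ++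
          ite (op .eq (sc (.fp b)) ((sc .y * rd .powLen (sc .i + lit 1) +
            rd .fpLen (sc .i + lit 1)) % sc .modulus)) (accept b) skip) skip) skip

/-- Restart a copy of the algorithm. -/
def restart (b : Bool) : ACmd :=
  set (.time b) (lit 0) ++ set (.fp b) (lit 0) ++ set .i (lit 0) ++
    loop (sc .top) (asg (.full b) (sc .i) (lit 0) ++ set .i (sc .i + lit 1))

/-- Process a letter with code `code` in one of the two copies. -/
def stepCopy (b : Bool) : ACmd :=
  set .y (sc (.fp b)) ++ set (.fp b) ((sc (.fp b) * sc .seed + sc .code) % sc .modulus) ++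
    set (.first b) (sc (.time b)) ++ set (.last b) (sc (.time b)) ++ set (.full b) (lit 1) ++
    set (.fpAt b) (sc .y) ++ set (.time b) (sc (.time b) + lit 1) ++ set .i (sc .top) ++
    loop (sc .top) (moveUp b) ++
    ite (op .eq (sc (.time b)) (lit 2 * patLen)) (restart b) skip

/-- Process a text letter. -/
def processLetter : ACmd := codeSym ++ set .out (lit 0) ++ stepCopy false ++ stepCopy true

/-! ### Invariants of the letter program -/

/-- The result of the preprocessing is present. -/
structure Ready (I : RamInput) (W n : ℕ) (g : Store) : Prop where
  levels : HasLevels I n g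
  len_top : g .len (g .top 0) = I.patLen
  two_le : 2 ≤ I.patLen
  modulus_pos : 1 < g .modulus 0
  seed_lt : g .seed 0 < g .modulus 0
  numT_lt : I.numT + 1 < g .modulus 0
  modulus_lt : g .modulus 0 * g .modulus 0 < W
  patLen_lt : 8 * I.patLen < W
  index_lt : n < W

/-- The arrays that are not changed any more after the preprocessing. -/
def constArrs : List Arr :=
  [.top, .len, .powLen, .fpLen, .per, .powPer, .fpPer, .seed, .modulus]

namespace Ready

variable {I : RamInput} {W n : ℕ} {g g' : Store}

theorem congr (h : Ready I W n g) (hg : ∀ v ∈ constArrs, g' v = g v) : Ready I W n g' := by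
  have h1 : g' .top = g .top := hg _ (by decide)
  have h2 : g' .len = g .len := hg _ (by decide)
  have h3 : g' .modulus = g .modulus := hg _ (by decide)
  have h4 : g' .seed = g .seed := hg _ (by decide)
  exact ⟨h.levels.congr hg, by rw [h1, h2]; exact h.len_top, h.two_le,
    by rw [h3]; exact h.modulus_pos, by rw [h3, h4]; exact h.seed_lt,
    by rw [h3]; exact h.numT_lt, by rw [h3]; exact h.modulus_lt, h.patLen_lt, h.index_lt⟩

theorem len_le (h : Ready I W n g) {s : ℕ} (hs : s ≤ g .top 0) : g .len s ≤ I.patLen := by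
  rw [h.levels.len s hs]; exact prefixLen_le _ _

theorem len_lt (h : Ready I W n g) {s : ℕ} (hs : s < g .top 0) : g .len s < I.patLen := by
  rw [h.levels.len s hs.le]; exact h.levels.len_lt s hs

theorem len_lt_succ (h : Ready I W n g) {s : ℕ} (hs : s < g .top 0) :
    g .len s < g .len (s + 1) := by
  rw [h.levels.len s hs.le, h.levels.len _ hs]; exact prefixLen_lt_succ (h.levels.len_lt s hs)

theorem len_succ_le (h : Ready I W n g) {s : ℕ} (hs : s < g .top 0) :
    g .len (s + 1) ≤ g .len s + g .len s / 2 + 1 := by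
  rw [h.levels.len s hs.le, h.levels.len _ hs]; exact min_le_right _ _

theorem len_zero (h : Ready I W n g) : g .len 0 = 0 := h.levels.len 0 (Nat.zero_le _)

theorem len_one (h : Ready I W n g) (hs : 0 < g .top 0) : g .len 1 = 1 := by
  rw [h.levels.len 1 hs]; have := h.two_le; simp only [prefixLen]; omega

theorem top_pos (h : Ready I W n g) : 0 < g .top 0 := by
  by_contra h0
  have h1 := h.len_top
  have h2 := h.len_zero
  have h3 := h.two_le
  rw [show g .top 0 = 0 by omega] at h1
  omega

theorem per_pos (h : Ready I W n g) {s : ℕ} (hs : s ≤ g .top 0) : 0 < g .per s := by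
  rcases Nat.eq_zero_or_pos s with rfl | h0
  · rw [h.levels.per_zero]; exact one_pos
  · exact (h.levels.level s h0 hs).per.pos

theorem per_le (h : Ready I W n g) {s : ℕ} (hs : s ≤ g .top 0) : g .per s ≤ I.patLen := by
  rcases Nat.eq_zero_or_pos s with rfl | h0
  · have := h.two_le; rw [h.levels.per_zero]; omega
  · refine ((h.levels.level s h0 hs).per.le ?_).trans (h.len_le hs)
    have h1 := h.len_lt_succ (s := s - 1) (by omega)
    rw [Nat.sub_add_cancel h0] at h1
    omega

theorem powPer_lt (h : Ready I W n g) {s : ℕ} (hs : s ≤ g .top 0) :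
    g .powPer s < g .modulus 0 := by
  have := h.modulus_pos
  rcases Nat.eq_zero_or_pos s with rfl | h0
  · rw [h.levels.powPer_zero]; omega
  · rw [(h.levels.level s h0 hs).powPer]; exact modPow_lt this _

theorem fpPer_lt (h : Ready I W n g) {s : ℕ} (hs : s ≤ g .top 0) :
    g .fpPer s < g .modulus 0 := by
  have := h.modulus_pos
  rcases Nat.eq_zero_or_pos s with rfl | h0
  · rw [h.levels.fpPer_zero]; omega
  · rw [(h.levels.level s h0 hs).fpPer]; exact fingerprint_lt (by omega) _ _

end Ready

/-- The candidates of level `s` in the copy `b`, for the text `u`. -/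
def Slot (I : RamInput) (b : Bool) (u : ℕ → ℕ) (g : Store) (s lo hi : ℕ) : Prop :=
  IsProgression (Candidate u (patWord I) (g .len s) (g .len (s + 1)) lo hi) (g .per s)
    (fingerprint (g .seed 0) (g .modulus 0) u) (g (.full b) s) (g (.first b) s) (g (.last b) s)
    (g (.fpAt b) s)

/-- The arrays that hold the candidates of the copy `b`. -/
def slotArrs (b : Bool) : List Arr := [.full b, .first b, .last b, .fpAt b]

theorem Slot.congr {I : RamInput} {b : Bool} {u : ℕ → ℕ} {g g' : Store} {s lo hi : ℕ}
    (h : Slot I b u g s lo hi) (hc : ∀ v ∈ constArrs, g' v = g v)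
    (hs : ∀ v ∈ slotArrs b, g' v s = g v s) : Slot I b u g' s lo hi := by
  unfold Slot at h ⊢
  rwa [hc .len (by decide), hc .per (by decide), hc .seed (by decide), hc .modulus (by decide),
    hs _ (by simp [slotArrs]), hs (.first b) (by simp [slotArrs]),
    hs (.last b) (by simp [slotArrs]), hs (.fpAt b) (by simp [slotArrs])]

/-- `x * y + z ≤ (Q - 1)² + (Q - 1) < Q²`: every fingerprint update fits into a word. -/
theorem mul_add_lt {x y z Q W : ℕ} (hx : x < Q) (hy : y < Q) (hz : z < Q) (hQ : Q * Q < W) :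
    x * y < W ∧ x * y + z < W := by
  constructor <;> nlinarith

/-! ### Moving one candidate -/

section

variable {I J : RamInput} {W n : ℕ} {g : Store} {P : Store → Prop}

/-- The range bounds are unconditional, while the statement on candidates is an implication. A copy
that has met a bad seed, or has not had its first restart, holds meaningless data but must still not
overflow. The bound `3m` is a position of at most `2m` plus a period of at most `m`. -/
theorem wp_popFirst (h : Ready J W n g) (b : Bool) {j T : ℕ} (hj : g .i 0 = j)
    (hjt : j < g .top 0) (hF : g (.fpAt b) j < g .modulus 0) (hT : T ≤ 2 * J.patLen)
    (hfull : g (.full b) j ≠ 0) (hfirst : g (.first b) j + g .len (j + 1) = T) :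
    Wp I W n (popFirst b) g fun g' => (∀ v ∈ slotArrs b, ∀ s, s ≠ j → g' v s = g v s) ∧
      g' (.first b) j ≤ 3 * J.patLen ∧ g' (.fpAt b) j < g .modulus 0 ∧
      ∀ u t, T = t + 1 → Slot J b u g j t t → Slot J b u g' j t (t + 1) := by
  have hn := h.levels.top_lt
  have hper := h.per_le hjt.le
  have hm := h.patLen_lt
  have hQ := h.modulus_pos
  obtain ⟨m1, m2⟩ := mul_add_lt hF (h.powPer_lt hjt.le) (h.fpPer_lt hjt.le) h.modulus_lt
  unfold popFirst
  rw [wp_ite]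
  refine ⟨by simp [hj]; omega, fun hc => ?_, fun hc => ?_⟩
  · have hc' : g (.first b) j = g (.last b) j := by
      by_contra hne; simp [hj, hne] at hc
    simp only [wp_asg, safe_sc, safe_lit, eval_sc, eval_lit, hj, true_and]
    refine ⟨⟨by omega, by omega⟩, fun v hv s hs => ?_, ?_, ?_, fun u t hu hslot => ?_⟩
    · simp [Store.upd_apply, hs]
    · simp only [Store.upd_apply, reduceCtorEq, false_and, if_false]; omega
    · simpa only [Store.upd_apply, reduceCtorEq, false_and, if_false]
    · have := IsProgression.pop_last hslot (h.per_pos hjt.le) hfull (by omega) hc'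
        (g (.first b) j) (g (.last b) j) (g (.fpAt b) j)
      simpa only [Slot, Store.upd_apply, reduceCtorEq, false_and, if_false, and_self, if_true]
  · have hc' : g (.first b) j ≠ g (.last b) j := by
      intro he; simp [hj, he] at hc
    simp only [wp_seq, wp_asg, safe_sc, safe_add, safe_rd, safe_mul, safe_mod, eval_sc, eval_add,
      eval_mod, eval_mul, eval_rd, hj, Store.upd_apply, reduceCtorEq, false_and, if_false,
      true_and, and_true]
    refine ⟨by omega, by omega, fun v hv s hs => by simp [hs], ?_, ?_, fun u t hu hslot => ?_⟩
    · simp only [if_true]; omega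
    · simp only [if_true]; exact Nat.mod_lt _ (by omega)
    · have := IsProgression.pop hslot (h.per_pos hjt.le) hfull (by omega) hc'
        (g' := (g (.fpAt b) j * g .powPer j + g .fpPer j) % g .modulus 0) (by
          intro h1 h2 h3
          rcases Nat.eq_zero_or_pos j with rfl | h0
          · have e1 := h.len_zero
            have e2 := h.len_one hjt
            have := h1.2
            have := h2.2
            have := h.levels.per_zero
            simp only [zero_add] at *
            omega
          · have hl := h.levels.level j h0 hjt.le
            have hpl : g .per j ≤ g .len j := hl.per.le (by
              have h1 := h.len_lt_succ (s := j - 1) (by omega)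
              rw [Nat.sub_add_cancel h0] at h1
              omega)
            rw [(h1.1.mono hpl).fingerprint_eq (r := g .seed 0) (Q := g .modulus 0) (by omega),
              h3, hl.powPer, hl.fpPer])
      simpa only [Slot, Store.upd_apply, reduceCtorEq, false_and, if_false, and_self, if_true]

/-- Below the top, the position joins the next level by `push_empty` or `push`. At the top the whole
pattern has been found; it is reported only if the time is below `2m`, as the other copy is
responsible for the window that ends at `2m`. -/
theorem wp_accept (hJ : I.patLen = J.patLen) (h : Ready J W n g) (b : Bool) {j : ℕ} (hj : g .i 0 = j)
    (hjt : j < g .top 0) (hy : g .y 0 < g .modulus 0)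
    (hx : g .x 0 + g .len (j + 1) = g (.time b) 0) (hT : g (.time b) 0 ≤ 2 * J.patLen)
    (hb : j + 1 < g .top 0 → g (.first b) (j + 1) ≤ 3 * J.patLen ∧
      g (.fpAt b) (j + 1) < g .modulus 0) :
    Wp I W n (accept b) g fun g' => (∀ v ∈ slotArrs b, ∀ s, s ≠ j + 1 → g' v s = g v s) ∧
      (j + 1 < g .top 0 → g' (.first b) (j + 1) ≤ 3 * J.patLen ∧
        g' (.fpAt b) (j + 1) < g .modulus 0) ∧
      (j + 1 < g .top 0 → g' .out = g .out ∧ ∀ u t, g (.time b) 0 = t + 1 →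
        Occurs u (patWord J) (g .len (j + 1)) (g .x 0) →
        g .y 0 = fingerprint (g .seed 0) (g .modulus 0) u (g .x 0) →
        Slot J b u g (j + 1) t (t + 1) → Slot J b u g' (j + 1) (t + 1) (t + 1)) ∧
      (j + 1 = g .top 0 → (g (.time b) 0 < 2 * J.patLen → g' .out 0 = 1) ∧
        (¬ g (.time b) 0 < 2 * J.patLen → g' .out = g .out)) := by
  have hn := h.levels.top_lt
  have hm := h.patLen_lt
  have hW := h.index_lt
  have hm2 := h.two_le
  unfold accept
  rw [wp_ite]
  refine ⟨by simp [hj]; omega, fun hc => ?_, fun hc => ?_⟩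
  · have hc' : g .len (j + 1) < J.patLen := by
      by_contra hne; simp [hj, hJ, hne] at hc
    have hjt' : j + 1 < g .top 0 := by
      have := h.len_top
      by_contra hne
      rw [show j + 1 = g .top 0 by omega] at hc'
      omega
    rw [wp_seq, wp_ite]
    refine ⟨by simp [hj]; omega, fun hf => ?_, fun hf => ?_⟩
    · simp only [eval_rd, eval_add, eval_sc, eval_lit, hj] at hf
      simp only [wp_skip, wp_asg, safe_sc, safe_add, safe_lit, eval_sc, eval_add, eval_lit, hj,
        Store.upd_apply, reduceCtorEq, false_and, if_false, true_and]
      refine ⟨by omega, fun v hv s hs => by simp [hs], hb, fun _ => ?_, fun h' => by omega⟩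
      refine ⟨Store.upd_of_ne _ (by simp) _ _, fun u t hu h1 h2 h3 => ?_⟩
      have := IsProgression.push h3 hf (h.len_lt_succ hjt') (h.len_succ_le hjt')
        (h.levels.level _ (by omega) hjt'.le).per h1 (by omega)
      have h4 : g (.full b) (j + 1) = 1 := by
        rcases h3 with h3 | h3
        · exact absurd h3.1 hf
        · exact h3.1
      simpa only [Slot, Store.upd_apply, reduceCtorEq, false_and, if_false, and_self, if_true, h4]
    · simp only [eval_rd, eval_add, eval_sc, eval_lit, hj] at hf
      simp only [wp_seq, wp_asg, safe_sc, safe_add, safe_lit, eval_sc, eval_add, eval_lit, hj,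
        Store.upd_apply, reduceCtorEq, false_and, if_false, true_and]
      refine ⟨by omega, by omega, by omega, by omega, fun v hv s hs => by simp [hs], fun _ => ?_,
        fun _ => ?_, fun h' => by omega⟩
      · simp only [if_true]; omega
      · refine ⟨?_, fun u t hu h1 h2 h3 => ?_⟩
        · rw [Store.upd_of_ne _ (by simp), Store.upd_of_ne _ (by simp),
            Store.upd_of_ne _ (by simp), Store.upd_of_ne _ (by simp)]
        · have := IsProgression.push_empty h3 hf (h.len_lt_succ hjt') h1 (by omega)
          rw [← h2] at this
          simpa only [Slot, Store.upd_apply, reduceCtorEq, false_and, if_false, and_self, if_true]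
  · have hc' : ¬ g .len (j + 1) < J.patLen := by
      intro he; simp [hj, hJ, he] at hc
    have hjt' : j + 1 = g .top 0 := by
      by_contra hne
      exact hc' (h.len_lt (by omega))
    rw [wp_ite]
    refine ⟨by simp; omega, fun hf => ?_, fun hf => ?_⟩
    · have hf' : g (.time b) 0 < 2 * J.patLen := by
        by_contra hne; simp [hne, hJ] at hf
      simp only [wp_set, safe_lit, eval_lit]
      refine ⟨by omega, fun v hv s hs => ?_, fun h' => by omega, fun h' => by omega,
        fun _ => ⟨fun _ => rfl, fun h' => absurd hf' h'⟩⟩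
      simp only [slotArrs, List.mem_cons, List.not_mem_nil, or_false] at hv
      rcases hv with rfl | rfl | rfl | rfl <;> rfl
    · have hf' : ¬ g (.time b) 0 < 2 * J.patLen := by
        intro hne; simp [hne, hJ] at hf
      rw [wp_skip]
      exact ⟨fun _ _ _ _ => rfl, hb, fun h' => by omega, fun _ => ⟨fun h' => absurd h' hf',
        fun _ => rfl⟩⟩

theorem notMem_writes_of_mem_constArrs (b : Bool) :
    (∀ v ∈ constArrs, v ∉ (popFirst b).writes) ∧ (∀ v ∈ constArrs, v ∉ (accept b).writes) ∧
      (∀ v ∈ constArrs, v ∉ (moveUp b).writes) ∧ (∀ v ∈ constArrs, v ∉ (restart b).writes) ∧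
      (∀ v ∈ constArrs, v ∉ (stepCopy b).writes) ∧ (∀ v ∈ constArrs, v ∉ codeSym.writes) := by
  cases b <;> decide

/-- One round takes level `j` from `(t, t)` to `(t, t + 1)` by removing the position that is due,
and level `j + 1` from `(t, t + 1)` to `(t + 1, t + 1)` by adding it if the test succeeds. `J` is
the input with the pattern, to which the specification refers; `I` is the input that the program
sees. -/
theorem wp_moveUp (hJ : I.patLen = J.patLen) (h : Ready J W n g) (b : Bool) {j : ℕ} (hj : g .i 0 = j + 1)
    (hjt : j < g .top 0) (hT : g (.time b) 0 ≤ 2 * J.patLen)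
    (hb : ∀ s < g .top 0, g (.first b) s ≤ 3 * J.patLen ∧ g (.fpAt b) s < g .modulus 0) :
    Wp I W n (moveUp b) g fun g' => g' .i 0 = j ∧
      (∀ s < g .top 0, g' (.first b) s ≤ 3 * J.patLen ∧ g' (.fpAt b) s < g .modulus 0) ∧
      (∀ v ∈ slotArrs b, ∀ s, s ≠ j → s ≠ j + 1 → g' v s = g v s) ∧
      (j + 1 < g .top 0 → g' .out = g .out) ∧
      (¬ (J.patLen ≤ g (.time b) 0 ∧ g (.time b) 0 < 2 * J.patLen) → g' .out = g .out) ∧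
      ∀ u t, g (.time b) 0 = t + 1 →
        GoodSeed (g .modulus 0) J.patLen u (patWord J) (g .seed 0) →
        g (.fp b) 0 = fingerprint (g .seed 0) (g .modulus 0) u (t + 1) →
        Slot J b u g j t t → (j + 1 < g .top 0 → Slot J b u g (j + 1) t (t + 1)) →
        Slot J b u g' j t (t + 1) ∧
        (j + 1 < g .top 0 → Slot J b u g' (j + 1) (t + 1) (t + 1)) ∧
        (j + 1 = g .top 0 → t + 1 < 2 * J.patLen → (g' .out 0 ≠ 0 ↔
          g .out 0 ≠ 0 ∨ ∃ q, q + J.patLen = t + 1 ∧ Occurs u (patWord J) J.patLen q)) := by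
  have hn := h.levels.top_lt
  have hm := h.patLen_lt
  have hW := h.index_lt
  have hm2 := h.two_le
  have hQ := h.modulus_pos
  have hlen1 : g .len (j + 1) ≤ J.patLen := h.len_le hjt
  obtain ⟨c1, c2, -⟩ := notMem_writes_of_mem_constArrs b
  unfold moveUp
  rw [wp_seq, wp_set]
  refine ⟨by simp; omega, ?_⟩
  have ei : (sc .i - lit 1).eval I g = j := by simp [hj]
  rw [ei]
  generalize hg0 : g.upd .i 0 j = g0
  have f0 : ∀ v, v ≠ .i → g0 v = g v := fun v hv => by rw [← hg0]; exact Store.upd_of_ne _ hv _ _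
  have i0 : g0 .i 0 = j := by rw [← hg0]; simp [Store.upd_apply]
  have hc0 : ∀ v ∈ constArrs, g0 v = g v := fun v hv => f0 v fun h => by subst h; revert hv; decide
  have hs0 : ∀ v ∈ slotArrs b, g0 v = g v := fun v hv => f0 v fun h => by
    subst h; simp [slotArrs] at hv
  clear hg0
  have keep : ¬ (g (.full b) j ≠ 0 ∧ g (.first b) j + g .len (j + 1) = g (.time b) 0) →
      (g0 .i 0 = j ∧
      (∀ s < g .top 0, g0 (.first b) s ≤ 3 * J.patLen ∧ g0 (.fpAt b) s < g .modulus 0) ∧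
      (∀ v ∈ slotArrs b, ∀ s, s ≠ j → s ≠ j + 1 → g0 v s = g v s) ∧
      (j + 1 < g .top 0 → g0 .out = g .out) ∧
      (¬ (J.patLen ≤ g (.time b) 0 ∧ g (.time b) 0 < 2 * J.patLen) → g0 .out = g .out) ∧
      ∀ u t, g (.time b) 0 = t + 1 →
        GoodSeed (g .modulus 0) J.patLen u (patWord J) (g .seed 0) →
        g (.fp b) 0 = fingerprint (g .seed 0) (g .modulus 0) u (t + 1) →
        Slot J b u g j t t → (j + 1 < g .top 0 → Slot J b u g (j + 1) t (t + 1)) →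
        Slot J b u g0 j t (t + 1) ∧
        (j + 1 < g .top 0 → Slot J b u g0 (j + 1) (t + 1) (t + 1)) ∧
        (j + 1 = g .top 0 → t + 1 < 2 * J.patLen → (g0 .out 0 ≠ 0 ↔
          g .out 0 ≠ 0 ∨ ∃ q, q + J.patLen = t + 1 ∧ Occurs u (patWord J) J.patLen q))) := by
    intro hk
    refine ⟨i0, ?_, fun v hv s _ _ => by rw [hs0 v hv], fun _ => f0 _ (by simp),
      fun _ => f0 _ (by simp), fun u t hu hgood hfp h1 h2 => ?_⟩
    · rw [hs0 _ (by simp [slotArrs]), hs0 (.fpAt b) (by simp [slotArrs])]; exact hb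
    · rw [hu] at hk
      -- A longer prefix ending now would start at a candidate of level `j`, namely the first one,
      -- but that one is not due.
      have hno : ∀ q, q + g .len (j + 1) = t + 1 → ¬ Occurs u (patWord J) (g .len (j + 1)) q := by
        intro q hq ho
        have hlt := h.len_lt_succ hjt
        obtain ⟨e1, e2⟩ := IsProgression.first_eq h1 hlt (ho.mono hlt.le) hq
        exact hk ⟨by omega, by omega⟩
      refine ⟨Slot.congr (IsProgression.keep h1 (h.len_lt_succ hjt) hk) hc0
        (fun v hv => by rw [hs0 v hv]), fun h3 => Slot.congr ((h2 h3).no_push hno) hc0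
        (fun v hv => by rw [hs0 v hv]), fun h3 _ => ?_⟩
      rw [f0 _ (by simp)]
      rw [h3, h.len_top] at hno
      exact ⟨Or.inl, fun h => h.resolve_right fun ⟨q, h4, h5⟩ => hno q h4 h5⟩
  have el : g0 .len = g .len := f0 _ (by simp)
  have et : g0 (.time b) = g (.time b) := f0 _ (by simp)
  have e1 : g0 (.full b) = g (.full b) := f0 _ (by simp)
  have e2 : g0 (.first b) = g (.first b) := f0 _ (by simp)
  have hbj := hb j hjt
  rw [wp_ite]
  refine ⟨by simp [i0]; omega, fun hfull => ?_, fun hfull => ?_⟩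
  swap
  · simp only [eval_rd, eval_sc, i0, e1] at hfull
    exact wp_skip.2 (keep fun h => h.1 hfull)
  simp only [eval_rd, eval_sc, i0, e1] at hfull
  rw [wp_ite]
  refine ⟨by simp [i0, e2, el]; omega, fun hfirst => ?_, fun hfirst => ?_⟩
  swap
  · simp only [eval_eq, eval_add, eval_rd, eval_sc, eval_lit, i0, e2, el, et] at hfirst
    exact wp_skip.2 (keep fun h => by simp [h.2] at hfirst)
  have hfirst : g (.first b) j + g .len (j + 1) = g (.time b) 0 := by
    simp only [eval_eq, eval_add, eval_rd, eval_sc, eval_lit, i0, e2, el, et] at hfirst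
    by_contra hne; simp [hne] at hfirst
  clear keep
  simp only [wp_seq, wp_set]
  refine ⟨by simp [i0]; omega, by simp [i0, Store.upd_apply]; omega, ?_⟩
  generalize hg1 : (g0.upd .x 0 _).upd .y 0 _ = g1
  have f1 : ∀ v, v ≠ .i → v ≠ .x → v ≠ .y → g1 v = g v := fun v h1 h2 h3 => by
    rw [← hg1, Store.upd_of_ne _ h3, Store.upd_of_ne _ h2, f0 v h1]
  have i1 : g1 .i 0 = j := by rw [← hg1]; simp [Store.upd_apply, i0]
  have x1 : g1 .x 0 = g (.first b) j := by rw [← hg1]; simp [Store.upd_apply, i0, e2]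
  have y1 : g1 .y 0 = g (.fpAt b) j := by rw [← hg1]; simp [Store.upd_apply, i0, f0]
  have hc1 : ∀ v ∈ constArrs, g1 v = g v := fun v hv =>
    f1 v (fun h => by subst h; revert hv; decide) (fun h => by subst h; revert hv; decide)
      (fun h => by subst h; revert hv; decide)
  have hs1 : ∀ v ∈ slotArrs b, g1 v = g v := fun v hv =>
    f1 v (fun h => by subst h; simp [slotArrs] at hv) (fun h => by subst h; simp [slotArrs] at hv)
      (fun h => by subst h; simp [slotArrs] at hv)
  clear hg1 f0 i0 hc0 hs0 el et e1 e2
  have m1 : g1 .modulus = g .modulus := hc1 _ (by decide)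
  have l1 : g1 .len = g .len := hc1 _ (by decide)
  have p1 : g1 .top = g .top := hc1 _ (by decide)
  have a1 : g1 (.fpAt b) = g (.fpAt b) := hs1 _ (by simp [slotArrs])
  have b1 : g1 (.first b) = g (.first b) := hs1 _ (by simp [slotArrs])
  refine (wp_popFirst (h.congr hc1) b i1 (by rwa [p1]) (by rw [a1, m1]; exact hbj.2) hT
    (by rwa [hs1 _ (by simp [slotArrs])]) (by rw [b1, l1]; exact hfirst)).mono
    fun g2 f2 ⟨h1, h2, h3, h4⟩ => ?_
  have hc2 : ∀ v ∈ constArrs, g2 v = g v := fun v hv => by rw [f2 v (c1 v hv), hc1 v hv]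
  have m2 : g2 .modulus = g .modulus := hc2 _ (by decide)
  have s2 : g2 .seed = g .seed := hc2 _ (by decide)
  have l2 : g2 .len = g .len := hc2 _ (by decide)
  have p2 : g2 .top = g .top := hc2 _ (by decide)
  have i2 : g2 .i 0 = j := by rw [f2 _ (by cases b <;> decide), i1]
  have x2 : g2 .x 0 = g (.first b) j := by rw [f2 _ (by cases b <;> decide), x1]
  have y2 : g2 .y 0 = g (.fpAt b) j := by rw [f2 _ (by cases b <;> decide), y1]
  have t2 : g2 (.time b) = g (.time b) := by
    rw [f2 _ (by cases b <;> decide), f1 _ (by simp) (by simp) (by simp)]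
  have o2 : g2 .out = g .out := by
    rw [f2 _ (by cases b <;> decide), f1 _ (by simp) (by simp) (by simp)]
  have fp2 : g2 (.fp b) = g (.fp b) := by
    rw [f2 _ (by cases b <;> decide), f1 _ (by simp) (by simp) (by simp)]
  have hs2 : ∀ v ∈ slotArrs b, ∀ s, s ≠ j → g2 v s = g v s := fun v hv s hs => by
    rw [h1 v hv s hs, hs1 v hv]
  have hb2 : ∀ s < g .top 0, g2 (.first b) s ≤ 3 * J.patLen ∧ g2 (.fpAt b) s < g .modulus 0 := by
    intro s hs
    by_cases hsj : s = j
    · rw [hsj]; exact ⟨h2, m1 ▸ h3⟩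
    · rw [hs2 _ (by simp [slotArrs]) s hsj, hs2 (.fpAt b) (by simp [slotArrs]) s hsj]
      exact hb s hs
  have hslot : ∀ u t, g (.time b) 0 = t + 1 → Slot J b u g j t t → Slot J b u g2 j t (t + 1) :=
    fun u t hu hsl => h4 u t hu (hsl.congr hc1 fun v hv => by rw [hs1 v hv])
  have hlev := h.levels.level (j + 1) (by omega) hjt
  have hpl : g .powLen (j + 1) < g .modulus 0 := by rw [hlev.powLen]; exact modPow_lt hQ _
  have hfl : g .fpLen (j + 1) < g .modulus 0 := by
    rw [hlev.fpLen]; exact fingerprint_lt (by omega) _ _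
  obtain ⟨w1, w2⟩ := mul_add_lt hbj.2 hpl hfl h.modulus_lt
  have pl2 : g2 .powLen = g .powLen := hc2 _ (by decide)
  have fl2 : g2 .fpLen = g .fpLen := hc2 _ (by decide)
  -- Completeness of the test holds for every seed. Soundness is the good seed, applicable because
  -- the position plus the length is the time, at most `2m`.
  have test : ∀ u t, g (.time b) 0 = t + 1 →
      GoodSeed (g .modulus 0) J.patLen u (patWord J) (g .seed 0) →
      g (.fp b) 0 = fingerprint (g .seed 0) (g .modulus 0) u (t + 1) → Slot J b u g j t t →
      (g (.fp b) 0 = (g (.fpAt b) j * g .powLen (j + 1) + g .fpLen (j + 1)) % g .modulus 0 ↔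
        Occurs u (patWord J) (g .len (j + 1)) (g (.first b) j)) ∧
      g (.fpAt b) j = fingerprint (g .seed 0) (g .modulus 0) u (g (.first b) j) := by
    intro u t hu hgood hfp hsl
    have hFa : g (.fpAt b) j = fingerprint (g .seed 0) (g .modulus 0) u (g (.first b) j) := by
      rcases hsl with hsl | hsl
      · exact absurd hsl.1 hfull
      · exact hsl.2.1
    refine ⟨?_, hFa⟩
    rw [hfp, hFa, hlev.powLen, hlev.fpLen, ← hu, ← hfirst]
    exact ⟨hgood _ _ (by omega) hlen1, fun ho => ho.fingerprint_eq (by omega)⟩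
  rw [wp_ite]
  refine ⟨?_, fun htest => ?_, fun htest => ?_⟩
  · simp only [safe_eq, safe_sc, safe_mod, safe_add, safe_mul, safe_rd, safe_lit, eval_sc, eval_rd,
      eval_add, eval_mul, eval_lit, i2, y2, pl2, fl2, true_and, and_true]
    omega
  · have htest : g (.fp b) 0 =
        (g (.fpAt b) j * g .powLen (j + 1) + g .fpLen (j + 1)) % g .modulus 0 := by
      by_contra hne
      simp only [eval_eq, eval_sc, eval_mod, eval_rd, eval_add, eval_mul, eval_lit, i2, y2, pl2, fl2,
        fp2, m2, if_neg hne] at htest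
      exact htest rfl
    refine (wp_accept hJ (h.congr hc2) b i2 (by rwa [p2]) (by rw [y2, m2]; exact hbj.2)
      (by rw [x2, l2, t2]; exact hfirst) (by rwa [t2])
      (by rw [p2, m2]; exact fun h => hb2 _ h)).mono fun g3 f3 ⟨h5, h6, h7, h8⟩ => ?_
    rw [p2] at h6 h7 h8
    rw [m2] at h6
    rw [t2] at h7 h8
    rw [o2] at h7 h8
    have hc3 : ∀ v ∈ constArrs, g3 v = g2 v := fun v hv => f3 v (c2 v hv)
    refine ⟨by rw [f3 _ (by cases b <;> decide), i2], fun s hs => ?_, fun v hv s hs1 hs2' => ?_,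
      fun h' => (h7 h').1, fun h' => ?_, fun u t hu hgood hfp hsl hsl' => ⟨?_, fun h' => ?_,
        fun h' ht => ?_⟩⟩
    · by_cases hsj : s = j + 1
      · subst hsj; exact h6 hs
      · rw [h5 _ (by simp [slotArrs]) s hsj, h5 (.fpAt b) (by simp [slotArrs]) s hsj]
        exact hb2 s hs
    · rw [h5 v hv s hs2', hs2 v hv s hs1]
    · by_cases htop : j + 1 = g .top 0
      · refine (h8 htop).2 fun ht => h' ⟨?_, ht⟩
        rw [htop, h.len_top] at hfirst
        omega
      · exact (h7 (by omega)).1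
    · exact (hslot u t hu hsl).congr hc3 fun v hv => h5 v hv j (by omega)
    · obtain ⟨ht1, ht2⟩ := test u t hu hgood hfp hsl
      refine (h7 h').2 u t hu ?_ ?_ ((hsl' h').congr hc2 fun v hv => hs2 v hv _ (by omega))
      · rw [l2, x2]; exact ht1.1 htest
      · rw [y2, s2, m2, x2]; exact ht2
    · obtain ⟨ht1, ht2⟩ := test u t hu hgood hfp hsl
      rw [(h8 h').1 (by omega)]
      refine ⟨fun _ => Or.inr ⟨g (.first b) j, ?_, ?_⟩, fun _ => one_ne_zero⟩
      · rw [h', h.len_top] at hfirst; omega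
      · have := ht1.1 htest
        rwa [h', h.len_top] at this
  · have htest : ¬ g (.fp b) 0 =
        (g (.fpAt b) j * g .powLen (j + 1) + g .fpLen (j + 1)) % g .modulus 0 := by
      intro hne
      simp only [eval_eq, eval_sc, eval_mod, eval_rd, eval_add, eval_mul, eval_lit, i2, y2, pl2, fl2,
        fp2, m2, if_pos hne] at htest
      exact one_ne_zero htest
    rw [wp_skip]
    refine ⟨i2, hb2, fun v hv s hs1 _ => hs2 v hv s hs1, fun _ => o2, fun _ => o2,
      fun u t hu hgood hfp hsl hsl' => ?_⟩
    obtain ⟨ht1, -⟩ := test u t hu hgood hfp hsl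
    -- The only possible start is the first candidate, which has just failed the test.
    have hno : ∀ q, q + g .len (j + 1) = t + 1 → ¬ Occurs u (patWord J) (g .len (j + 1)) q := by
      intro q hq ho
      rw [show q = g (.first b) j by omega] at ho
      exact htest (ht1.2 ho)
    refine ⟨hslot u t hu hsl, fun h' => Slot.congr ((hsl' h').no_push hno) hc2
      (fun v hv => hs2 v hv _ (by omega)), fun h' _ => ?_⟩
    rw [o2]
    rw [h', h.len_top] at hno
    exact ⟨Or.inl, fun h => h.resolve_right fun ⟨q, h4, h5⟩ => hno q h4 h5⟩

end

/-! ### One letter in one copy and in both -/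

/-- The variables of the copy `b` are in their ranges. -/
structure Bounded (J : RamInput) (b : Bool) (g : Store) : Prop where
  time_lt : g (.time b) 0 < 2 * J.patLen
  fp_lt : g (.fp b) 0 < g .modulus 0
  slot : ∀ s < g .top 0, g (.first b) s ≤ 3 * J.patLen ∧ g (.fpAt b) s < g .modulus 0

/-- The copy `b` has processed `t` letters of the text `u`. -/
structure Tracks (J : RamInput) (b : Bool) (u : ℕ → ℕ) (t : ℕ) (g : Store) : Prop where
  time : g (.time b) 0 = t
  fp : g (.fp b) 0 = fingerprint (g .seed 0) (g .modulus 0) u t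
  slot : ∀ s, 1 ≤ s → s < g .top 0 → Slot J b u g s t t

/-- All arrays of the copy `b`. -/
def copyArrs (b : Bool) : List Arr := [.full b, .first b, .last b, .fpAt b, .time b, .fp b]

section

variable {I J : RamInput} {W n : ℕ} {g g' : Store} {P : Store → Prop}

theorem Bounded.congr {b : Bool} (h : Bounded J b g) (hc : ∀ v ∈ constArrs, g' v = g v)
    (hs : ∀ v ∈ copyArrs b, g' v = g v) : Bounded J b g' := by
  have h1 : g' .modulus = g .modulus := hc _ (by decide)
  have h2 : g' .top = g .top := hc _ (by decide)
  have h3 : g' (.time b) = g (.time b) := hs _ (by simp [copyArrs])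
  have h4 : g' (.fp b) = g (.fp b) := hs _ (by simp [copyArrs])
  have h5 : g' (.first b) = g (.first b) := hs _ (by simp [copyArrs])
  have h6 : g' (.fpAt b) = g (.fpAt b) := hs _ (by simp [copyArrs])
  exact ⟨by rw [h3]; exact h.time_lt, by rw [h4, h1]; exact h.fp_lt,
    by rw [h2, h5, h6, h1]; exact h.slot⟩

theorem Tracks.congr {b : Bool} {u : ℕ → ℕ} {t : ℕ} (h : Tracks J b u t g)
    (hc : ∀ v ∈ constArrs, g' v = g v) (hs : ∀ v ∈ copyArrs b, g' v = g v) :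
    Tracks J b u t g' := by
  have h1 : g' .modulus = g .modulus := hc _ (by decide)
  have h2 : g' .top = g .top := hc _ (by decide)
  have h3 : g' (.time b) = g (.time b) := hs _ (by simp [copyArrs])
  have h4 : g' (.fp b) = g (.fp b) := hs _ (by simp [copyArrs])
  have h5 : g' .seed = g .seed := hc _ (by decide)
  refine ⟨by rw [h3]; exact h.time, by rw [h4, h1, h5]; exact h.fp, fun s hs1 hs2 => ?_⟩
  rw [h2] at hs2
  refine (h.slot s hs1 hs2).congr hc fun v hv => ?_
  rw [hs v]
  revert hv
  cases b <;> revert v <;> decide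

/-- A copy without candidates has processed the empty text. -/
theorem Ready.tracks_zero (h : Ready J W n g) {b : Bool} (ht : g (.time b) 0 = 0)
    (hf : g (.fp b) 0 = 0) (hs : ∀ s < g .top 0, g (.full b) s = 0) (u : ℕ → ℕ) :
    Tracks J b u 0 g := by
  refine ⟨ht, hf, fun s h1 h2 => Or.inl ⟨hs s h2, fun q hq => ?_⟩⟩
  have h3 := h.len_lt_succ (s := s - 1) (by omega)
  rw [Nat.sub_add_cancel h1] at h3
  have := hq.2.1
  omega

theorem wp_restart (h : Ready J W n g) (b : Bool) :
    Wp I W n (restart b) g fun g' => g' (.time b) 0 = 0 ∧ g' (.fp b) 0 = 0 ∧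
      ∀ s < g .top 0, g' (.full b) s = 0 := by
  have hn := h.levels.top_lt
  have hW := h.index_lt
  have hm := h.patLen_lt
  have hm2 := h.two_le
  unfold restart
  simp only [wp_seq, wp_set, safe_lit, eval_lit]
  refine ⟨by omega, by omega, by omega, ?_⟩
  refine wp_loop (fun k g' => g' .i 0 = k ∧ g' (.time b) 0 = 0 ∧ g' (.fp b) 0 = 0 ∧
    ∀ s < k, g' (.full b) s = 0) trivial ?_ ?_ ?_
  · simp [Store.upd_apply]
  · rintro k g1 hk f1 ⟨h1, h2, h3, h4⟩
    simp only [eval_sc, Store.upd_apply, reduceCtorEq, false_and, if_false] at hk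
    simp only [wp_seq, wp_asg, wp_set, safe_sc, safe_lit, safe_add, eval_sc, eval_lit, eval_add, h1,
      h2, h3, Store.upd_apply, reduceCtorEq, false_and, if_false, if_true, true_and, and_true]
    refine ⟨by omega, by omega, fun s hs => ?_⟩
    split
    · rfl
    · exact h4 s (by omega)
  · rintro g1 f1 ⟨-, h2, h3, h4⟩
    exact ⟨h2, h3, fun s hs => h4 s (by simpa [Store.upd_apply] using hs)⟩

/-- The loop that moves candidates up. -/
theorem wp_moveUps (hJ : I.patLen = J.patLen) (h : Ready J W n g) (b : Bool)
    (hi : g .i 0 = g .top 0) (hT : g (.time b) 0 ≤ 2 * J.patLen)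
    (hb : ∀ s < g .top 0, g (.first b) s ≤ 3 * J.patLen ∧ g (.fpAt b) s < g .modulus 0) :
    Wp I W n (loop (sc .top) (moveUp b)) g fun g' =>
      (∀ s < g .top 0, g' (.first b) s ≤ 3 * J.patLen ∧ g' (.fpAt b) s < g .modulus 0) ∧
      (¬ (J.patLen ≤ g (.time b) 0 ∧ g (.time b) 0 < 2 * J.patLen) → g' .out = g .out) ∧
      ∀ u t, g (.time b) 0 = t + 1 →
        GoodSeed (g .modulus 0) J.patLen u (patWord J) (g .seed 0) →
        g (.fp b) 0 = fingerprint (g .seed 0) (g .modulus 0) u (t + 1) →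
        (∀ s < g .top 0, Slot J b u g s t t) →
        (∀ s, 1 ≤ s → s < g .top 0 → Slot J b u g' s (t + 1) (t + 1)) ∧
        (t + 1 < 2 * J.patLen → (g' .out 0 ≠ 0 ↔
          g .out 0 ≠ 0 ∨ ∃ q, q + J.patLen = t + 1 ∧ Occurs u (patWord J) J.patLen q)) := by
  have hc := (notMem_writes_of_mem_constArrs b).2.2.1
  -- Rounds go from the top level down, so a level is emptied of its due position before it receives
  -- a new one. After `k` rounds, level `top - k` has only been popped, the levels above it have
  -- also been pushed to, and those below are untouched.
  refine wp_loop (fun k g' => g' .i 0 = g .top 0 - k ∧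
    (∀ s < g .top 0, g' (.first b) s ≤ 3 * J.patLen ∧ g' (.fpAt b) s < g .modulus 0) ∧
    (k = 0 → g' .out = g .out) ∧
    (¬ (J.patLen ≤ g (.time b) 0 ∧ g (.time b) 0 < 2 * J.patLen) → g' .out = g .out) ∧
    ∀ u t, g (.time b) 0 = t + 1 →
      GoodSeed (g .modulus 0) J.patLen u (patWord J) (g .seed 0) →
      g (.fp b) 0 = fingerprint (g .seed 0) (g .modulus 0) u (t + 1) →
      (∀ s < g .top 0, Slot J b u g s t t) →
      (∀ s < g .top 0, Slot J b u g' s (if g .top 0 < s + k then t + 1 else t)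
        (if g .top 0 ≤ s + k then t + 1 else t)) ∧
      (0 < k → t + 1 < 2 * J.patLen → (g' .out 0 ≠ 0 ↔
          g .out 0 ≠ 0 ∨ ∃ q, q + J.patLen = t + 1 ∧ Occurs u (patWord J) J.patLen q)))
    trivial ?_ ?_ ?_
  · refine ⟨by rw [hi]; rfl, hb, fun _ => rfl, fun _ => rfl, fun u t hu hg hf hs =>
      ⟨fun s hst => ?_, fun h => absurd h (lt_irrefl 0)⟩⟩
    rw [if_neg (by omega), if_neg (by omega)]
    exact hs s hst
  · rintro k g1 hk f1 ⟨h1, h2, h3, h4, h5⟩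
    simp only [eval_sc] at hk
    have k0 : k = 0 → g .top 0 - (k + 1) + 1 = g .top 0 := by omega
    have k1 : 0 < k → g .top 0 - (k + 1) + 1 < g .top 0 := by omega
    have hc1 : ∀ v ∈ constArrs, g1 v = g v := fun v hv => f1 v (hc v hv)
    have m1 : g1 .modulus = g .modulus := hc1 _ (by decide)
    have s1 : g1 .seed = g .seed := hc1 _ (by decide)
    have p1 : g1 .top = g .top := hc1 _ (by decide)
    have t1 : g1 (.time b) = g (.time b) := f1 _ (by cases b <;> decide)
    have q1 : g1 (.fp b) = g (.fp b) := f1 _ (by cases b <;> decide)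
    refine (wp_moveUp hJ (h.congr hc1) b (j := g .top 0 - (k + 1)) (by omega) (by rw [p1]; omega)
      (by rwa [t1]) (by rw [p1, m1]; exact h2)).mono fun g2 f2 h6 => ?_
    rw [p1, m1, s1, t1, q1] at h6
    obtain ⟨h6, h7, h8, h9, h10, h11⟩ := h6
    have hc2 : ∀ v ∈ constArrs, g2 v = g1 v := fun v hv => f2 v (hc v hv)
    refine ⟨h6, h7, fun h => by omega, fun hr => by rw [h10 hr, h4 hr],
      fun u t hu hg hf hs => ?_⟩
    obtain ⟨h12, h13⟩ := h5 u t hu hg hf hs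
    have sl1 : Slot J b u g1 (g .top 0 - (k + 1)) t t := by
      have := h12 (g .top 0 - (k + 1)) (by omega)
      rwa [if_neg (by omega), if_neg (by omega)] at this
    have sl2 : g .top 0 - (k + 1) + 1 < g .top 0 →
        Slot J b u g1 (g .top 0 - (k + 1) + 1) t (t + 1) := by
      intro hlt
      have := h12 (g .top 0 - (k + 1) + 1) (by omega)
      rwa [if_neg (by omega), if_pos (by omega)] at this
    obtain ⟨h14, h15, h16⟩ := h11 u t hu hg hf sl1 sl2
    refine ⟨fun s hst => ?_, fun _ ht => ?_⟩
    · clear h13 h16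
      by_cases e1 : s = g .top 0 - (k + 1)
      · rw [if_neg (by omega), if_pos (by omega), e1]; exact h14
      by_cases e2 : s = g .top 0 - (k + 1) + 1
      · rw [if_pos (by omega), if_pos (by omega), e2]; exact h15 (by omega)
      · have := (h12 s hst).congr hc2 fun v hv => h8 v hv s e1 e2
        rcases Nat.lt_or_ge s (g .top 0 - (k + 1)) with e3 | e3
        · rw [if_neg (by omega), if_neg (by omega)] at this ⊢; exact this
        · rw [if_pos (by omega), if_pos (by omega)] at this ⊢; exact this
    · rcases Nat.eq_zero_or_pos k with rfl | hk0
      · rw [← h3 rfl]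
        exact h16 (k0 rfl) ht
      · rw [h9 (k1 hk0)]
        exact h13 hk0 ht
  · rintro g1 f1 ⟨h1, h2, h3, h4, h5⟩
    simp only [eval_sc] at h5
    refine ⟨h2, h4, fun u t hu hg hf hs => ?_⟩
    obtain ⟨h6, h7⟩ := h5 u t hu hg hf hs
    refine ⟨fun s h8 h9 => ?_, h7 h.top_pos⟩
    have a1 : g .top 0 < s + g .top 0 := by omega
    have := h6 s h9
    simp only [a1, a1.le, if_true] at this
    exact this

/-- Each letter opens a new candidate at level 0 at the current position, with the fingerprint
before the letter; then the levels are updated. At time `2m` the copy restarts, which fits any later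
text. -/
theorem wp_stepCopy (hJ : I.patLen = J.patLen) (h : Ready J W n g) (b : Bool)
    (hb : Bounded J b g) (hcode : g .code 0 < g .modulus 0) :
    Wp I W n (stepCopy b) g fun g' => Bounded J b g' ∧
      g' (.time b) 0 = (g (.time b) 0 + 1) % (2 * J.patLen) ∧
      (g (.time b) 0 + 1 = 2 * J.patLen → ∀ u, Tracks J b u 0 g') ∧
      (¬ (J.patLen ≤ g (.time b) 0 + 1 ∧ g (.time b) 0 + 1 < 2 * J.patLen) →
        g' .out = g .out) ∧
      ∀ u t, GoodSeed (g .modulus 0) J.patLen u (patWord J) (g .seed 0) → Tracks J b u t g →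
        u t = g .code 0 → t + 1 < 2 * J.patLen → Tracks J b u (t + 1) g' ∧
          (g' .out 0 ≠ 0 ↔
            g .out 0 ≠ 0 ∨ ∃ q, q + J.patLen = t + 1 ∧ Occurs u (patWord J) J.patLen q) := by
  have hm := h.patLen_lt
  have hm2 := h.two_le
  have hQ := h.modulus_pos
  have ht := hb.time_lt
  have htop := h.top_pos
  obtain ⟨w1, w2⟩ := mul_add_lt hb.fp_lt h.seed_lt hcode h.modulus_lt
  unfold stepCopy
  simp only [wp_seq, wp_set, safe_mod, safe_add, safe_mul, safe_sc, safe_lit, eval_sc, eval_add,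
    eval_mul, eval_mod, eval_lit, Store.upd_apply, reduceCtorEq, if_false, and_self, if_true, true_and, and_true]
  refine ⟨⟨w1, w2⟩, by omega, ⟨by omega, by omega⟩, ?_⟩
  generalize hg0 : Store.upd _ .i 0 (g .top 0) = g0
  have f0 : ∀ v, v ∉ [Arr.y, .fp b, .first b, .last b, .full b, .fpAt b, .time b, .i] →
      g0 v = g v := by
    intro v hv
    simp only [List.mem_cons, List.not_mem_nil, or_false, not_or] at hv
    obtain ⟨h1, h2, h3, h4, h5, h6, h7, h8⟩ := hv
    rw [← hg0, Store.upd_of_ne _ h8, Store.upd_of_ne _ h7, Store.upd_of_ne _ h6,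
      Store.upd_of_ne _ h5, Store.upd_of_ne _ h4, Store.upd_of_ne _ h3, Store.upd_of_ne _ h2,
      Store.upd_of_ne _ h1]
  have hc0 : ∀ v ∈ constArrs, g0 v = g v := fun v hv => f0 v (by
    revert hv; cases b <;> revert v <;> decide)
  have hs0 : ∀ v ∈ slotArrs b, ∀ s, s ≠ 0 → g0 v s = g v s := by
    intro v hv s hs
    rw [← hg0]
    simp [Store.upd_apply, hs]
  have e1 : g0 (.time b) 0 = g (.time b) 0 + 1 := by rw [← hg0]; simp [Store.upd_apply]
  have e2 : g0 (.fp b) 0 = (g (.fp b) 0 * g .seed 0 + g .code 0) % g .modulus 0 := by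
    rw [← hg0]; simp [Store.upd_apply]
  have e3 : g0 .i 0 = g .top 0 := by rw [← hg0]; simp [Store.upd_apply]
  have e4 : g0 (.first b) 0 = g (.time b) 0 := by rw [← hg0]; simp [Store.upd_apply]
  have e5 : g0 (.last b) 0 = g (.time b) 0 := by rw [← hg0]; simp [Store.upd_apply]
  have e6 : g0 (.full b) 0 = 1 := by rw [← hg0]; simp [Store.upd_apply]
  have e7 : g0 (.fpAt b) 0 = g (.fp b) 0 := by rw [← hg0]; simp [Store.upd_apply]
  have e8 : g0 .top = g .top := hc0 _ (by decide)
  have e9 : g0 .modulus = g .modulus := hc0 _ (by decide)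
  have e10 : g0 .seed = g .seed := hc0 _ (by decide)
  have e11 : g0 .out = g .out := f0 _ (by simp)
  clear hg0
  have hready := h.congr hc0
  refine (wp_moveUps hJ hready b (by rw [e3, e8]) (by omega) (fun s hs => ?_)).mono
    fun g1 f1 h1 => ?_
  · by_cases hs0' : s = 0
    · rw [hs0', e4, e7, e9]; exact ⟨by omega, hb.fp_lt⟩
    · rw [hs0 _ (by simp [slotArrs]) s hs0', hs0 (.fpAt b) (by simp [slotArrs]) s hs0', e9]
      exact hb.slot s (by rwa [e8] at hs)
  rw [e8, e1, e9, e10, e11, e2] at h1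
  obtain ⟨h2, h3, h4⟩ := h1
  have hc1 : ∀ v ∈ constArrs, g1 v = g v := fun v hv => by
    rw [f1 v ((notMem_writes_of_mem_constArrs b).2.2.1 v hv), hc0 v hv]
  have t1 : g1 (.time b) 0 = g (.time b) 0 + 1 := by rw [f1 _ (by cases b <;> decide), e1]
  have q1 : g1 (.fp b) 0 = (g (.fp b) 0 * g .seed 0 + g .code 0) % g .modulus 0 := by
    rw [f1 _ (by cases b <;> decide), e2]
  have p1 : g1 .top = g .top := hc1 _ (by decide)
  have m1 : g1 .modulus = g .modulus := hc1 _ (by decide)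
  have s1 : g1 .seed = g .seed := hc1 _ (by decide)
  have hready1 := h.congr hc1
  rw [wp_ite]
  refine ⟨by simp; omega, fun hr => ?_, fun hr => ?_⟩
  · have hr' : g (.time b) 0 + 1 = 2 * J.patLen := by
      by_contra hne
      simp [hJ, t1, hne] at hr
    refine (wp_restart hready1 b).mono fun g2 f2 ⟨h5, h6, h7⟩ => ?_
    have hc2 : ∀ v ∈ constArrs, g2 v = g1 v :=
      fun v hv => f2 v ((notMem_writes_of_mem_constArrs b).2.2.2.1 v hv)
    have p2 : g2 .top = g1 .top := hc2 _ (by decide)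
    have m2 : g2 .modulus = g1 .modulus := hc2 _ (by decide)
    have o2 : g2 .out = g1 .out := f2 _ (by cases b <;> decide)
    have a2 : g2 (.first b) = g1 (.first b) := f2 _ (by cases b <;> decide)
    have b2 : g2 (.fpAt b) = g1 (.fpAt b) := f2 _ (by cases b <;> decide)
    refine ⟨⟨by omega, by rw [h6, m2, m1]; omega, by rw [p2, p1, m2, m1, a2, b2]; exact h2⟩,
      by rw [h5, hr', Nat.mod_self],
      fun _ => (hready1.congr hc2).tracks_zero h5 h6 (by rwa [p2]),
      fun hr => by rw [o2, h3 hr], fun u t hg htr hut hlt => ?_⟩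
    rw [htr.time] at hr'
    omega
  · have hr' : g (.time b) 0 + 1 ≠ 2 * J.patLen := by
      intro hne
      simp [hJ, t1, hne] at hr
    rw [wp_skip]
    refine ⟨⟨by omega, by rw [q1, m1]; exact Nat.mod_lt _ (by omega), by rwa [p1, m1]⟩, ?_,
      fun h => absurd h hr', h3, fun u t hg htr hut hlt => ?_⟩
    · rw [t1, Nat.mod_eq_of_lt (by omega)]
    have hfp : (g (.fp b) 0 * g .seed 0 + g .code 0) % g .modulus 0 =
        fingerprint (g .seed 0) (g .modulus 0) u (t + 1) := by
      rw [htr.fp, ← hut]; rfl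
    obtain ⟨h5, h6⟩ := h4 u t (by rw [htr.time]) hg hfp (fun s hs => by
      by_cases hs0' : s = 0
      -- The conditions `q + 0 ≤ t` and `t < q + 1` leave only `q = t`, the position just written.
      · subst hs0'
        refine Or.inr ⟨e6, ?_, 0, ?_, fun q => ⟨fun hq => ⟨0, le_rfl, ?_⟩, ?_⟩⟩
        · rw [e7, e4, e10, e9, htr.fp, htr.time]
        · rw [e5, e4, zero_mul, add_zero]
        · have := hq.2
          rw [hready.len_zero, zero_add, hready.len_one (by rwa [e8])] at this
          rw [e4, htr.time]; omega
        · rintro ⟨i, hi, rfl⟩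
          obtain rfl : i = 0 := by omega
          rw [e4, htr.time]
          refine ⟨?_, ?_, ?_⟩
          · rw [hready.len_zero]; intro x hx; omega
          · rw [hready.len_zero]; omega
          · rw [zero_add, hready.len_one (by rwa [e8])]; omega
      · exact (htr.slot s (by omega) hs).congr hc0 fun v hv => hs0 v hv s hs0')
    exact ⟨⟨by rw [t1, htr.time], by rw [q1, s1, m1, hfp], fun s hs1 hs2 => h5 s hs1 (by rwa [p1] at hs2)⟩,
      h6 hlt⟩

/-- What is known of a store `g'` that results from a store `g` when a letter with code `c`
arrives. -/
structure CopyStep (J : RamInput) (c : ℕ) (g g' : Store) (b : Bool) : Prop where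
  bounded : Bounded J b g'
  time : g' (.time b) 0 = (g (.time b) 0 + 1) % (2 * J.patLen)
  restart : g (.time b) 0 + 1 = 2 * J.patLen → ∀ u, Tracks J b u 0 g'
  tracks : ∀ u t, GoodSeed (g .modulus 0) J.patLen u (patWord J) (g .seed 0) →
    Tracks J b u t g → u t = c → t + 1 < 2 * J.patLen → Tracks J b u (t + 1) g' ∧
      (¬ (J.patLen ≤ g (.time !b) 0 + 1 ∧ g (.time !b) 0 + 1 < 2 * J.patLen) →
        (g' .out 0 ≠ 0 ↔ ∃ q, q + J.patLen = t + 1 ∧ Occurs u (patWord J) J.patLen q))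

/-- The copies share only the constants, scratch variables and `out`. The output starts at 0 and a
copy can only raise it when its time is in `[m, 2m)`, so if the other copy is outside this range the
output is that of copy `b`. -/
theorem wp_processLetter (hJ : I.patLen = J.patLen) (hT : I.numT = J.numT) (hI : I.Fits W)
    (h : Ready J W n g) (hb : ∀ b, Bounded J b g) :
    Wp I W n processLetter g fun g' => Ready J W n g' ∧
      g' .modulus = g .modulus ∧ g' .seed = g .seed ∧
      ∀ b, CopyStep J (textCode I I.sym) g g' b := by
  have hm := h.patLen_lt
  have hm2 := h.two_le
  have hQ := h.modulus_lt
  have hQ1 := h.numT_lt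
  have hc := (notMem_writes_of_mem_constArrs true).2.2.2.2.2
  have hc' := fun b => (notMem_writes_of_mem_constArrs b).2.2.2.2.1
  have hTW : I.numT + 1 < W := by rw [hT]; nlinarith
  unfold processLetter
  simp only [wp_seq]
  refine wp_codeSym hI (by omega) hTW fun g1 f1 h1 => ?_
  rw [wp_set]
  refine ⟨by simp; omega, ?_⟩
  generalize hg2 : g1.upd .out 0 ((lit 0).eval I g1) = g2
  have f2 : ∀ v, v ∉ [Arr.out, .x, .y, .code, .z] → g2 v = g v := by
    intro v hv
    simp only [List.mem_cons, List.not_mem_nil, or_false, not_or] at hv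
    rw [← hg2, Store.upd_of_ne _ hv.1, f1 v (by simp [hv])]
  have o2 : g2 .out 0 = 0 := by rw [← hg2]; simp [Store.upd_apply]
  have code2 : g2 .code 0 = textCode I I.sym := by rw [← hg2, Store.upd_of_ne _ (by simp), h1]
  clear hg2 f1 h1
  have hc2 : ∀ v ∈ constArrs, g2 v = g v := fun v hv => f2 v (by revert v; decide)
  have hs2 : ∀ b, ∀ v ∈ copyArrs b, g2 v = g v := fun b v hv => f2 v (by
    revert hv; cases b <;> revert v <;> decide)
  have ht2 : ∀ b, g2 (.time b) = g (.time b) := fun b => hs2 b _ (by simp [copyArrs])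
  have hcode : textCode I I.sym < g .modulus 0 := by
    have := textCode_le I I.sym; omega
  refine (wp_stepCopy hJ (h.congr hc2) false ((hb false).congr hc2 (hs2 false))
    (by rw [code2, hc2 .modulus (by decide)]; exact hcode)).mono fun g3 f3 h3 => ?_
  have hc3 : ∀ v ∈ constArrs, g3 v = g v := fun v hv => by rw [f3 v (hc' false v hv), hc2 v hv]
  have hs3 : ∀ v ∈ copyArrs true, g3 v = g v := fun v hv => by
    rw [f3 v (by revert v; decide), hs2 true v hv]
  have ht3 : g3 (.time true) = g (.time true) := hs3 _ (by decide)
  have code3 : g3 .code 0 = textCode I I.sym := by rw [f3 _ (by decide), code2]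
  refine (wp_stepCopy hJ (h.congr hc3) true ((hb true).congr hc3 hs3)
    (by rw [code3, hc3 .modulus (by decide)]; exact hcode)).mono fun g4 f4 h4 => ?_
  have hc4 : ∀ v ∈ constArrs, g4 v = g v := fun v hv => by rw [f4 v (hc' true v hv), hc3 v hv]
  have hs4 : ∀ v ∈ copyArrs false, g4 v = g3 v := fun v hv => f4 v (by revert v; decide)
  have hc43 : ∀ v ∈ constArrs, g4 v = g3 v := fun v hv => f4 v (hc' true v hv)
  rw [hc2 .modulus (by decide), hc2 .seed (by decide), ht2, code2] at h3
  rw [hc3 .modulus (by decide), hc3 .seed (by decide), ht3, code3] at h4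
  obtain ⟨a1, a2, a3, a4, a5⟩ := h3
  obtain ⟨b1, b2, b3, b4, b5⟩ := h4
  refine ⟨h.congr hc4, hc4 _ (by decide), hc4 _ (by decide), fun b => ?_⟩
  cases b with
  | false =>
    refine ⟨a1.congr hc43 hs4, by rw [hs4 _ (by decide), a2],
      fun hr u => (a3 hr u).congr hc43 hs4, fun u t hg htr hu hlt => ?_⟩
    obtain ⟨c1, c2⟩ := a5 u t hg (htr.congr hc2 (hs2 _)) hu hlt
    refine ⟨c1.congr hc43 hs4, fun hother => ?_⟩
    rw [b4 hother, c2, o2]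
    simp
  | true =>
    refine ⟨b1, b2, b3, fun u t hg htr hu hlt => ?_⟩
    obtain ⟨c1, c2⟩ := b5 u t hg (htr.congr hc3 hs3) hu hlt
    refine ⟨c1, fun hother => ?_⟩
    rw [c2, a4 hother, o2]
    simp

end

/-! ## The run of the algorithm -/

/-- The stores `G 0, G 1, …` arise from the preprocessing of the pattern of `J` and the text with
letters `T`. -/
structure IsRun (J : RamInput) (W n : ℕ) (T : ℕ → ℕ) (G : ℕ → Store) : Prop where
  ready : Ready J W n (G 0)
  time_true : G 0 (.time true) 0 = J.patLen
  zero : ∀ v ∈ [Arr.time false, .fp false, .fp true], G 0 v 0 = 0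
  zeros : ∀ v ∈ slotArrs true ++ slotArrs false, ∀ s, G 0 v s = 0
  step : ∀ t, Ready J W n (G t) → (∀ b, Bounded J b (G t)) →
    Ready J W n (G (t + 1)) ∧ G (t + 1) .modulus = G t .modulus ∧
      G (t + 1) .seed = G t .seed ∧ ∀ b, CopyStep J (textCode J (T t)) (G t) (G (t + 1)) b

namespace IsRun

variable {J : RamInput} {W n : ℕ} {T : ℕ → ℕ} {G : ℕ → Store}

/-- Safety and the clocks need no assumption on the seed. The clocks of the two copies are `t` and
`t + m` modulo `2m`. -/
theorem invariant (h : IsRun J W n T G) (t : ℕ) : Ready J W n (G t) ∧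
    (∀ b, Bounded J b (G t)) ∧ G t .modulus = G 0 .modulus ∧ G t .seed = G 0 .seed ∧
      ∀ b : Bool, G t (.time b) 0 = (t + b.toNat * J.patLen) % (2 * J.patLen) := by
  have hm := h.ready.two_le
  induction t with
  | zero =>
    have hQ := h.ready.modulus_pos
    refine ⟨h.ready, fun b => ⟨?_, ?_, fun s _ => ?_⟩, rfl, rfl, fun b => ?_⟩
    · cases b
      · rw [h.zero _ (by simp)]; omega
      · rw [h.time_true]; omega
    · cases b <;> rw [h.zero _ (by simp)] <;> omega
    · cases b <;> rw [h.zeros _ (by simp [slotArrs]), h.zeros _ (by simp [slotArrs])] <;>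
        exact ⟨Nat.zero_le _, by omega⟩
    · cases b
      · rw [h.zero _ (by simp)]; simp
      · rw [h.time_true]; simp [Nat.mod_eq_of_lt (show J.patLen < 2 * J.patLen by omega)]
  | succ t ih =>
    obtain ⟨h1, h2, h3, h4, h5⟩ := ih
    obtain ⟨h6, h7, h8, h9⟩ := h.step t h1 h2
    refine ⟨h6, fun b => (h9 b).bounded, h7.trans h3, h8.trans h4, fun b => ?_⟩
    rw [(h9 b).time, h5 b, Nat.mod_add_mod]
    congr 1; ring

/-- The copy that is restarted at time `k * m`. -/
theorem tracks (h : IsRun J W n T G) (k : ℕ) {s : ℕ} (hs : s < 2 * J.patLen)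
    (hg : GoodSeed (G 0 .modulus 0) J.patLen (fun s => textCode J (T (k * J.patLen + s)))
      (patWord J) (G 0 .seed 0)) :
    Tracks J (decide (k % 2 = 1)) (fun s => textCode J (T (k * J.patLen + s))) s
      (G (k * J.patLen + s)) := by
  have hm := h.ready.two_le
  induction s with
  | zero =>
    rw [add_zero]
    rcases Nat.eq_zero_or_pos k with rfl | hk
    · simp only [zero_mul, Nat.zero_mod, zero_ne_one, decide_false]
      exact h.ready.tracks_zero (h.zero _ (by simp)) (h.zero _ (by simp))
        (fun s _ => h.zeros _ (by simp [slotArrs]) s) _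
    · have hkm : 0 < k * J.patLen := by positivity
      obtain ⟨t, ht⟩ : ∃ t, k * J.patLen = t + 1 := ⟨k * J.patLen - 1, by omega⟩
      obtain ⟨h1, h2, h3, h4, h5⟩ := h.invariant t
      obtain ⟨h6, h7, h8, h9⟩ := h.step t h1 h2
      rw [ht]
      refine (h9 _).restart ?_ _
      rw [h5]
      -- Copy `false` restarts at even multiples of `m` and copy `true` at odd ones; adding the
      -- parity to `k` gives a positive even number, so just before time `k * m` the clock shows `2m
      -- - 1`.
      obtain ⟨c, hc⟩ : ∃ c, k + (decide (k % 2 = 1)).toNat = 2 * (c + 1) := by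
        by_cases hk2 : k % 2 = 1
        · exact ⟨(k - 1) / 2, by simp [hk2]; omega⟩
        · exact ⟨k / 2 - 1, by simp [hk2]; omega⟩
      have e : t + (decide (k % 2 = 1)).toNat * J.patLen
          = (2 * J.patLen - 1) + 2 * J.patLen * c := by
        have : (k + (decide (k % 2 = 1)).toNat) * J.patLen = 2 * J.patLen * c + 2 * J.patLen := by
          rw [hc]; ring
        rw [add_mul] at this
        omega
      rw [e, Nat.add_mul_mod_self_left, Nat.mod_eq_of_lt (by omega)]
      omega
  | succ s ih =>
    obtain ⟨h1, h2, h3, h4, h5⟩ := h.invariant (k * J.patLen + s)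
    obtain ⟨h6, h7, h8, h9⟩ := h.step _ h1 h2
    exact ((h9 _).tracks _ s (by rw [h3, h4]; exact hg) (ih (by omega)) rfl hs).1

/-- With a good seed for the relevant part of the text, the output is correct. -/
theorem out_iff (h : IsRun J W n T G) {i t : ℕ} (hit : t + 1 = i + J.patLen)
    (hg : GoodSeed (G 0 .modulus 0) J.patLen
      (fun s => textCode J (T (i / J.patLen * J.patLen + s))) (patWord J) (G 0 .seed 0)) :
    G (t + 1) .out 0 ≠ 0 ↔ ∀ x < J.patLen, textCode J (T (i + x)) = patWord J x := by
  have hm := h.ready.two_le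
  have hi := Nat.div_add_mod' i J.patLen
  have hlt := Nat.mod_lt i (show 0 < J.patLen by omega)
  set k := i / J.patLen
  set s := t - k * J.patLen with hs
  have hts : t = k * J.patLen + s := by omega
  have htr := h.tracks k (s := s) (by omega) hg
  obtain ⟨h1, h2, h3, h4, h5⟩ := h.invariant t
  obtain ⟨h6, h7, h8, h9⟩ := h.step _ h1 h2
  rw [← hts] at htr
  have hother : G t (.time !decide (k % 2 = 1)) 0 = (s + J.patLen) % (2 * J.patLen) := by
    have e1 := htr.time
    rw [h5] at e1
    rw [h5, ← e1, Nat.mod_add_mod]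
    by_cases hk2 : k % 2 = 1
    · simp only [hk2, decide_true, Bool.not_true, Bool.toNat_false, Bool.toNat_true]
      rw [show t + 1 * J.patLen + J.patLen = t + 0 * J.patLen + 2 * J.patLen by ring,
        Nat.add_mod_right]
    · simp [hk2]
  -- The window ends at a local time in `[m, 2m)` of its own copy; the other clock is half a period
  -- away and outside this range.
  have hno : ¬ (J.patLen ≤ G t (.time !decide (k % 2 = 1)) 0 + 1 ∧
      G t (.time !decide (k % 2 = 1)) 0 + 1 < 2 * J.patLen) := by
    rw [hother]
    by_cases hsm : s < J.patLen
    · rw [Nat.mod_eq_of_lt (by omega)]; omega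
    · rw [show s + J.patLen = (s - J.patLen) + 2 * J.patLen by omega, Nat.add_mod_right,
        Nat.mod_eq_of_lt (by omega)]
      omega
  rw [((h9 _).tracks _ s (by rw [h3, h4]; exact hg) htr (by simp only [← hts]) (by omega)).2 hno]
  constructor
  · rintro ⟨q, hq, ho⟩ x hx
    have := ho x hx
    simp only at this
    rwa [show k * J.patLen + (q + x) = i + x by omega] at this
  · intro ho
    refine ⟨i - k * J.patLen, by omega, fun x hx => ?_⟩
    simp only
    rw [show k * J.patLen + (i - k * J.patLen + x) = i + x by omega]
    exact ho x hx

end IsRun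

/-! ## Probability -/

/-- If all later steps are deterministic on the states `ν v t`, the output law is the image of the
law of the initial random word `v`. -/
theorem OnlineAlgorithm.output_of_deterministic {α σ M Ω : Type*} (A : OnlineAlgorithm α σ M)
    (P : α) (T : ℕ → σ) (U : PMF Ω) (ν : Ω → ℕ → M) (o : Ω → ℕ → Bool)
    (h0 : A.init P = U.map fun v => ν v 0)
    (hs : ∀ v t, A.step (ν v t) (T t) = PMF.pure (o v t, ν v (t + 1))) (t : ℕ) :
    A.output P T t = U.map fun v => o v t := by
  have key : ∀ t, A.state P T t = U.map fun v => ν v t := by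
    intro t
    induction t with
    | zero => exact h0
    | succ t ih =>
      simp only [state, ih, PMF.map, PMF.bind_bind, Function.comp, PMF.pure_bind, hs]
      rfl
  simp only [output, key, PMF.map, PMF.bind_bind, Function.comp, PMF.pure_bind, hs]
  rfl

theorem le_uniform_map_toReal {Ω β : Type*} [Fintype Ω] [Nonempty Ω] (f : Ω → β)
    (y : β) {c : ℝ} {B : Finset Ω} (hB : ∀ v, v ∉ B → f v = y)
    (hc : (B.card : ℝ) ≤ c * Fintype.card Ω) :
    1 - c ≤ ((PMF.uniformOfFintype Ω).map f y).toReal := by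
  classical
  have h1 : (PMF.uniformOfFintype Ω).map f y
      = ∑ v : Ω, if y = f v then ((Fintype.card Ω : ENNReal))⁻¹ else 0 := by
    rw [PMF.map_apply, tsum_fintype]
    simp
  rw [h1, ENNReal.toReal_sum (by intro v _; split <;> simp)]
  have h2 : ∀ v : Ω, (if v ∈ B then 0 else (Fintype.card Ω : ℝ)⁻¹) ≤
      (if y = f v then ((Fintype.card Ω : ENNReal))⁻¹ else 0).toReal := by
    intro v
    by_cases hv : v ∈ B
    · simp [hv]
    · simp [hv, hB v hv]
  refine le_trans ?_ (Finset.sum_le_sum fun v _ => h2 v)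
  have hpos : (0 : ℝ) < Fintype.card Ω := by exact_mod_cast Fintype.card_pos
  rw [Finset.sum_ite, Finset.sum_const_zero, zero_add, Finset.sum_const, nsmul_eq_mul,
    Finset.filter_not, Finset.filter_mem_eq_inter, Finset.univ_inter, ← Finset.compl_eq_univ_sdiff,
    Finset.card_compl, Nat.cast_sub (Finset.card_le_univ B), sub_mul, mul_inv_cancel₀ hpos.ne']
  have : (B.card : ℝ) * (Fintype.card Ω : ℝ)⁻¹ ≤ c := by
    rw [← div_eq_mul_inv, div_le_iff₀ hpos]; exact hc
  linarith

-- `v ↦ (v mod Q, v div Q)` is injective, so a residue has at most `W / Q + 1` representatives.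
open Classical in
theorem card_filter_mod_le (S : Finset ℕ) (W Q : ℕ) :
    (Finset.univ.filter fun v : Fin W => (v : ℕ) % Q ∈ S).card ≤ S.card * (W / Q + 1) := by
  have : Set.InjOn (fun v : Fin W => ((v : ℕ) % Q, (v : ℕ) / Q))
      (Finset.univ.filter fun v : Fin W => (v : ℕ) % Q ∈ S) := by
    intro a _ b _ hab
    simp only [Prod.mk.injEq] at hab
    ext
    rw [← Nat.mod_add_div a Q, ← Nat.mod_add_div b Q, hab.1, hab.2]
  rw [← Finset.card_image_of_injOn this]
  refine (Finset.card_le_card (t := S ×ˢ Finset.range (W / Q + 1)) fun z hz => ?_).trans (by simp)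
  obtain ⟨v, hv, rfl⟩ := Finset.mem_image.1 hz
  simp only [Finset.mem_filter, Finset.mem_univ, true_and] at hv
  simp only [Finset.mem_product, Finset.mem_range]
  exact ⟨hv, Nat.lt_succ_of_le (Nat.div_le_div_right v.2.le)⟩

/-! ## The streaming algorithm -/

/-- The input of the preprocessing. -/
def patInput {m k n : ℕ} (Δ : Fin k → Fin n → Bool) (P : Fin m → Fin k) : RamInput where
  patLen := m
  numP := k
  numT := n
  rel x a := if h : x < k ∧ a < n then Δ ⟨x, h.1⟩ ⟨a, h.2⟩ else false
  pat i := if h : i < m then (P ⟨i, h⟩ : ℕ) else 0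
  sym := 0

/-- The input of the processing of the text letter `a`. -/
def textInput (m : ℕ) {k n : ℕ} (Δ : Fin k → Fin n → Bool) (a : ℕ) : RamInput where
  patLen := m
  numP := k
  numT := n
  rel x a := if h : x < k ∧ a < n then Δ ⟨x, h.1⟩ ⟨a, h.2⟩ else false
  pat _ := 0
  sym := a

/-- A failure gives two classes with a common letter, one of them containing a letter that the other
lacks. The two symbols and the two letters are then distinct and span the wildcard matrix. -/
theorem patInput_rel_of_not_containsWildcard {m k n : ℕ} {Δ : Fin k → Fin n → Bool}
    (hΔ : ¬ ContainsWildcard Δ) (P : Fin m → Fin k) (x x' a a' : ℕ)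
    (h1 : (patInput Δ P).rel x a = true) (h2 : (patInput Δ P).rel x' a = true)
    (h3 : (patInput Δ P).rel x a' = true) : (patInput Δ P).rel x' a' = true := by
  simp only [patInput] at h1 h2 h3 ⊢
  split at h1
  case isFalse => simp at h1
  split at h2
  case isFalse => simp at h2
  split at h3
  case isFalse => simp at h3
  rename_i h4 h5 h6
  rw [dif_pos ⟨h5.1, h6.2⟩]
  by_contra h7
  have hx : (⟨x, h4.1⟩ : Fin k) ≠ ⟨x', h5.1⟩ := fun h => h7 (h ▸ h3)
  have ha : (⟨a, h4.2⟩ : Fin n) ≠ ⟨a', h6.2⟩ := fun h => h7 (h ▸ h2)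
  refine hΔ ⟨⟨![⟨x, h4.1⟩, ⟨x', h5.1⟩], ?_⟩, ⟨![⟨a, h4.2⟩, ⟨a', h6.2⟩], ?_⟩, ?_⟩
  · intro i j hij; fin_cases i <;> fin_cases j <;> simp_all
  · intro i j hij; fin_cases i <;> fin_cases j <;> simp_all
  · ext i j
    fin_cases i <;> fin_cases j
    · exact if_pos h1
    · exact if_pos h3
    · exact if_pos h2
    · exact if_neg h7

/-- Fingerprints are taken modulo the least prime that is at least `c * m ^ a`. -/
def streamingAlgorithm (c a : ℕ) : RamAlgorithm where
  pre := .seq (.rand (.const Arr.seed.idx)) (preprocess c a).compile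
  step := processLetter.compile

/-- The contents of the arrays after the preprocessing with the random word `v` and after each
letter of the text. -/
def streamingStore (c a : ℕ) {m k n : ℕ} (Δ : Fin k → Fin n → Bool) (P : Fin m → Fin k)
    (T : ℕ → Fin n) (v : ℕ) : ℕ → Store
  | 0 => (preprocess c a).exec (patInput Δ P) (Store.upd (fun _ _ => 0) .seed 0 v)
  | t + 1 => processLetter.exec (textInput m Δ (T t)) (streamingStore c a Δ P T v t)

/-- Conditions under which the algorithm runs correctly with `N` words below `W` and arrays of
length `r`. -/
structure Admissible (c a m k n W N r : ℕ) : Prop where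
  two_le : 2 ≤ m
  index : 2 * (Nat.log 2 m + 1) < r
  index_mem : 64 * r ≤ N
  index_lt : 64 * r < W
  numP : k < W
  numT : n + 1 < c * m ^ a
  patLen : m ≤ c * m ^ a
  modulus : (2 * (c * m ^ a)) * (2 * (c * m ^ a)) < W
  patLen_lt : 8 * m < W

section

variable {c a m k n W N r : ℕ} {Δ : Fin k → Fin n → Bool}

theorem Admissible.lt (h : Admissible c a m k n W N r) : c * m ^ a < W :=
  lt_of_le_of_lt (by nlinarith [h.numT]) h.modulus

theorem Admissible.fits_patInput (h : Admissible c a m k n W N r) (P : Fin m → Fin k) :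
    (patInput Δ P).Fits W := by
  have h1 := h.lt
  have h2 := h.numT
  have h3 := h.patLen
  refine ⟨?_, h.numP, ?_, ?_, fun i => ?_⟩ <;> simp only [patInput]
  · omega
  · omega
  · omega
  · split
    · exact (P _).2.trans h.numP
    · omega

theorem Admissible.fits_textInput (h : Admissible c a m k n W N r) (x : Fin n) :
    (textInput m Δ x).Fits W := by
  have h1 := h.lt
  have h2 := h.numT
  have h3 := h.patLen
  have h4 := x.2
  refine ⟨?_, h.numP, ?_, ?_, fun i => ?_⟩ <;> simp only [textInput] <;> omega

theorem Admissible.wp_preprocess (h : Admissible c a m k n W N r) (P : Fin m → Fin k) (v : ℕ) :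
    Wp (patInput Δ P) W r (preprocess c a) (Store.upd (fun _ _ => 0) .seed 0 v) fun g' =>
      HasLevels (patInput Δ P) r g' ∧ g' .len (g' .top 0) = m ∧
      g' .modulus 0 = nextPrime (c * m ^ a) ∧ g' .seed 0 = v % g' .modulus 0 ∧
      g' (.time true) 0 = m :=
  _root_.wp_preprocess (h.fits_patInput P)
    (by intro v hv; fin_cases hv <;> rfl) h.index (by have := h.index_lt; omega) h.two_le
    ((Nat.lt_succ_self n).trans h.numT) h.patLen h.modulus

theorem Admissible.isRun (h : Admissible c a m k n W N r) (P : Fin m → Fin k) (T : ℕ → Fin n)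
    (v : ℕ) : IsRun (patInput Δ P) W r (fun t => T t) (streamingStore c a Δ P T v) := by
  obtain ⟨-, h1, h2, h3, h4, h5⟩ := h.wp_preprocess (Δ := Δ) P v
  -- The written arrays are the same for all parameters, so membership is checked on the closed
  -- instance `preprocess 0 0`.
  have hframe : ∀ u, u ∉ (preprocess 0 0).writes → u ≠ .seed →
      streamingStore c a Δ P T v 0 u = fun _ => 0 := fun u hu hs => by
    have := exec_of_notMem_writes (patInput Δ P) (preprocess c a)
      (Store.upd (fun _ _ => 0) .seed 0 v) u hu
    rwa [Store.upd_of_ne _ hs] at this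
  have hX := le_nextPrime (c * m ^ a)
  have hQ : 1 < nextPrime (c * m ^ a) := (nextPrime_prime _).one_lt
  have h6 : nextPrime (c * m ^ a) ≤ 2 * (c * m ^ a) :=
    nextPrime_le_two_mul (by have := h.numT; omega)
  have h7 := h.index_lt
  refine ⟨⟨h1, h2, h.two_le, ?_, ?_, ?_, ?_, h.patLen_lt, by omega⟩, h5, ?_, ?_, ?_⟩
  · exact hQ.trans_eq h3.symm
  · refine h4.trans_lt (Nat.mod_lt _ ?_)
    exact h3.symm ▸ (zero_lt_one.trans hQ)
  · exact (h.numT.trans_le hX).trans_eq h3.symm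
  · refine lt_of_eq_of_lt ?_ ((Nat.mul_le_mul h6 h6).trans_lt h.modulus)
    exact congrArg₂ _ h3 h3
  · intro u hu
    fin_cases hu <;> rw [hframe _ (by decide) (by decide)]
  · intro u hu s
    fin_cases hu <;> rw [hframe _ (by decide) (by decide)]
  · intro t h8 h9
    exact (wp_processLetter (I := textInput m Δ (T t)) (J := patInput Δ P) rfl rfl
      (h.fits_textInput (T t)) h8 h9).2

end

/-- For each fixed random word the memory contents along the text are determined. They follow the
abstract stores because the run is safe, whether or not the seed is good. -/
theorem Admissible.exists_memory {c a m k n w N r : ℕ} {Δ : Fin k → Fin n → Bool}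
    (h : Admissible c a m k n (2 ^ w) N r) (P : Fin m → Fin k) (T : ℕ → Fin n)
    (v : Fin (2 ^ w)) : ∃ ν : ℕ → RamMem N w,
      (preprocess c a).compile.run (patInput Δ P) ((RamMem.zero N w).set 1 v) = PMF.pure (ν 0) ∧
      (∀ t, processLetter.compile.run (textInput m Δ (T t)) (ν t) = PMF.pure (ν (t + 1))) ∧
      ∀ t, (ν t).get 0 = streamingStore c a Δ P T v t .out 0 := by
  have hr : 0 < r := by have := h.index; omega
  have h0 : Represents r ((RamMem.zero N w).set 1 v) (Store.upd (fun _ _ => 0) .seed 0 v) := by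
    have : Represents r (RamMem.zero N w) fun _ _ => 0 := fun u i _ => by
      simp [RamMem.get, RamMem.zero]
    exact this.set h.index_mem .seed hr v.2
  obtain ⟨μ, hμ, hμ'⟩ := ACmd.run_compile (h.fits_patInput (Δ := Δ) P) hr h.index_lt h.index_mem
    (preprocess c a) h0 (h.wp_preprocess (Δ := Δ) P v).1
  have hrun := h.isRun (Δ := Δ) P T v
  -- Stated for every memory, with a dummy successor if it does not represent the store, so that
  -- `choose` gives a total function to iterate.
  have hstep : ∀ t (μ : RamMem N w), ∃ ν, Represents r μ (streamingStore c a Δ P T v t) →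
      processLetter.compile.run (textInput m Δ (T t)) μ = PMF.pure ν ∧
        Represents r ν (streamingStore c a Δ P T v (t + 1)) := by
    intro t μ
    by_cases hμ : Represents r μ (streamingStore c a Δ P T v t)
    · obtain ⟨ν, h1, h2⟩ := ACmd.run_compile (h.fits_textInput (Δ := Δ) (T t)) hr h.index_lt h.index_mem
        processLetter hμ (wp_processLetter (I := textInput m Δ (T t)) (J := patInput Δ P) rfl rfl
          (h.fits_textInput (T t)) (hrun.invariant t).1 (hrun.invariant t).2.1).1
      exact ⟨ν, fun _ => ⟨h1, h2⟩⟩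
    · exact ⟨μ, fun h => absurd h hμ⟩
  choose f hf using hstep
  let ν : ℕ → RamMem N w := fun t => Nat.rec μ f t
  have hν : ∀ t, Represents r (ν t) (streamingStore c a Δ P T v t) := by
    intro t
    induction t with
    | zero => exact hμ'
    | succ t ih => exact (hf t _ ih).2
  exact ⟨ν, hμ, fun t => (hf t _ (hν t)).1, fun t => hν t .out 0 hr⟩

theorem Admissible.output {c a m k n w N r : ℕ} {Δ : Fin k → Fin n → Bool}
    (h : Admissible c a m k n (2 ^ w) N r) (P : Fin m → Fin k) (T : ℕ → Fin n) (t : ℕ) :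
    haveI : Nonempty (Fin (2 ^ w)) := ⟨⟨0, Nat.two_pow_pos w⟩⟩
    ((streamingAlgorithm c a).toOnline N w m Δ).output P T t =
      (PMF.uniformOfFintype (Fin (2 ^ w))).map fun v : Fin (2 ^ w) =>
        decide (streamingStore c a Δ P T v (t + 1) .out 0 ≠ 0) := by
  have : Nonempty (Fin (2 ^ w)) := ⟨⟨0, Nat.two_pow_pos w⟩⟩
  choose ν h1 h2 h3 using h.exists_memory (Δ := Δ) P T
  refine OnlineAlgorithm.output_of_deterministic _ P T _ ν
    (fun v t => decide (streamingStore c a Δ P T v (t + 1) .out 0 ≠ 0)) ?_ (fun v t => ?_) t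
  · have hw : 1 < 2 ^ w := by have := h.index_lt; have := h.index; omega
    -- The random word enters `RamCmd.run` as the uniform distribution carried to `ℕ` by a bind with
    -- `PMF.pure`.
    change (((PMF.uniformOfFintype (Fin (2 ^ w))).bind fun v => PMF.pure (v : ℕ)).map fun v =>
      (RamMem.zero N w).set (1 % 2 ^ w) v).bind ((preprocess c a).compile.run (patInput Δ P)) = _
    rw [Nat.mod_eq_of_lt hw, PMF.map, PMF.bind_bind, PMF.bind_bind, PMF.map]
    simp only [Function.comp, PMF.pure_bind, h1]
    rfl
  · change (processLetter.compile.run (textInput m Δ (T t)) (ν v t)).map _ = _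
    rw [h2, PMF.pure_map, h3]

/-- If the modulus is large, then the algorithm errs with small probability only. -/
theorem Admissible.solves {c a m k n w N r : ℕ} {Δ : Fin k → Fin n → Bool}
    (h : Admissible c a m k n (2 ^ w) N r) (hΔ : ¬ ContainsWildcard Δ) {q : ℝ}
    (hq : 4 * (m : ℝ) ^ 3 ≤ q * (c * m ^ a : ℕ)) :
    ((streamingAlgorithm c a).toOnline N w m Δ).Solves Δ (1 - q) := by
  classical
  intro P T i t hit
  have : Nonempty (Fin (2 ^ w)) := ⟨⟨0, Nat.two_pow_pos w⟩⟩
  rw [h.output P T t]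
  set Q := nextPrime (c * m ^ a) with hQ
  have hX : c * m ^ a ≤ Q := le_nextPrime _
  have hQW : Q ≤ 2 ^ w := by
    have h1 : Q ≤ 2 * (c * m ^ a) := nextPrime_le_two_mul (by have := h.numT; omega)
    have h2 := h.modulus
    nlinarith
  let u : ℕ → ℕ := fun s => textCode (patInput Δ P) (T (i / m * m + s))
  let B := (Finset.range Q).filter fun r => ¬ GoodSeed Q m u (patWord (patInput Δ P)) r
  have hB : B.card ≤ 2 * m * m * m := by
    refine card_not_goodSeed_le (nextPrime_prime _) m (fun x => ?_) (fun x => ?_)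
    · exact ((textCode_le _ _).trans_lt h.numT).trans_le hX
    · exact (((patCode_le _ _).trans (Nat.le_succ _)).trans_lt h.numT).trans_le hX
  refine le_uniform_map_toReal (B := Finset.univ.filter fun v : Fin (2 ^ w) => (v : ℕ) % Q ∈ B)
    _ _ (fun v hv => ?_) ?_
  · obtain ⟨-, -, -, h3, h4, -⟩ := h.wp_preprocess (Δ := Δ) P v
    have h5 : streamingStore c a Δ P T v 0 .modulus 0 = Q := h3
    have h6 : streamingStore c a Δ P T v 0 .seed 0 = v % Q := by
      refine h4.trans ?_
      rw [h3]
    have hg : GoodSeed Q m u (patWord (patInput Δ P)) (v % Q) := by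
      by_contra hg
      exact hv (by simpa [B, hg] using Nat.mod_lt _ (nextPrime_prime (c * m ^ a)).pos)
    have := (h.isRun (Δ := Δ) P T v).out_iff hit (by rw [h5, h6]; exact hg)
    rw [localAnd]
    refine decide_eq_decide.2 (this.trans ⟨fun H j => ?_, fun H x hx => ?_⟩)
    · have := H j j.2
      rw [patWord, textCode_eq_patCode_iff (patInput_rel_of_not_containsWildcard hΔ P)] at this
      · simpa [patInput] using this
      · simp [patInput]
      · simp [patInput]
    · rw [patWord, textCode_eq_patCode_iff (patInput_rel_of_not_containsWildcard hΔ P)]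
      · have hx' : x < m := hx
        simpa [patInput, hx'] using H ⟨x, hx⟩
      · have hx' : x < m := hx
        simp [patInput, hx']
      · simp [patInput]
  · have h1 := (card_filter_mod_le B (2 ^ w) Q).trans (Nat.mul_le_mul_right _ hB)
    -- Reducing a uniform word modulo `Q ≤ 2 ^ w` at most doubles the probability of a residue. With
    -- at most `2 m³` bad seeds, this gives an error of at most `4 m³ / Q`.
    have h2 : Q * (2 ^ w / Q + 1) ≤ 2 * 2 ^ w := by
      have := Nat.mul_div_le (2 ^ w) Q
      rw [mul_add]; omega
    rw [Fintype.card_fin]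
    generalize (Finset.univ.filter fun v : Fin (2 ^ w) => (v : ℕ) % Q ∈ B).card = b at h1
    generalize 2 ^ w / Q + 1 = e at h1 h2
    have hX' : 0 < c * m ^ a := by have := h.numT; omega
    have hX1 : (0 : ℝ) < (c * m ^ a : ℕ) := by exact_mod_cast hX'
    have h1' : (b : ℝ) ≤ 2 * m ^ 3 * e := by
      have : (b : ℝ) ≤ 2 * m * m * m * e := by exact_mod_cast h1
      linarith
    have h2' : ((c * m ^ a : ℕ) : ℝ) * e ≤ 2 * (2 ^ w : ℕ) := by
      exact_mod_cast (Nat.mul_le_mul_right e hX).trans h2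
    have hq0 : 0 ≤ q := by
      by_contra hq0
      have : q * (c * m ^ a : ℕ) < 0 := mul_neg_of_neg_of_pos (not_le.1 hq0) hX1
      have : (0 : ℝ) ≤ 4 * (m : ℝ) ^ 3 := by positivity
      linarith
    have h3 : 4 * (m : ℝ) ^ 3 * e ≤ q * (c * m ^ a : ℕ) * e :=
      mul_le_mul_of_nonneg_right hq (Nat.cast_nonneg _)
    have h4 := mul_le_mul_of_nonneg_left h2' hq0
    linarith

/-! ## The parameters -/

/-- Since `m < H = 2 ^ (log₂ m + 1)`, a word below `2 ^ L` holds any fixed power of `H` that is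
needed. The exponent `2 (2c + d + 4)` covers the square of twice the lower bound on the modulus,
using `2c ≤ H ^ (2c)`; the summand 192 pays for 64 arrays of at most `3 (log₂ m + 1)` entries. -/
theorem admissible_of_two_le {c d m L k n : ℕ} (hc : 0 < c) (hm : 2 ≤ m)
    (hL : L = (2 * (2 * c + (d + 4)) + 192) * (Nat.log 2 m + 1)) (hk : k ≤ m ^ d)
    (hn : n ≤ m ^ d) :
    Admissible c (d + 4) m k n (2 ^ L) L (2 * (Nat.log 2 m + 1) + 1) := by
  set l := Nat.log 2 m with hl
  set H := 2 ^ (l + 1) with hH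
  have hmH : m < H := Nat.lt_pow_succ_log_self (by norm_num) m
  have hW : 2 ^ L = H ^ (2 * (2 * c + (d + 4)) + 192) := by
    rw [hL, mul_comm, pow_mul]
  have hH2 : 3 ≤ H := by omega
  have hlog : 64 * (2 * (l + 1) + 1) ≤ L := by
    rw [hL]; nlinarith
  have hcH : 2 * c ≤ H ^ (2 * c) := (Nat.lt_pow_self (by omega)).le
  have hmd : m ^ (d + 4) ≤ H ^ (d + 4) := Nat.pow_le_pow_left hmH.le _
  have hX : 2 * (c * m ^ (d + 4)) ≤ H ^ (2 * c + (d + 4)) := by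
    rw [pow_add H (2 * c), ← mul_assoc]; exact Nat.mul_le_mul hcH hmd
  have hlt : ∀ e, e < 2 * (2 * c + (d + 4)) + 192 → H ^ e < 2 ^ L := fun e he => by
    rw [hW]; exact Nat.pow_lt_pow_right (by omega) he
  have hmdp : 1 ≤ m ^ d := Nat.one_le_pow _ _ (by omega)
  have h16 : 16 * m ^ d ≤ c * m ^ (d + 4) := by
    have : 2 ^ 4 ≤ m ^ 4 := Nat.pow_le_pow_left hm 4
    calc 16 * m ^ d ≤ m ^ 4 * m ^ d := Nat.mul_le_mul_right _ this
      _ = m ^ (d + 4) := by ring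
      _ ≤ _ := Nat.le_mul_of_pos_left _ hc
  refine ⟨hm, by omega, hlog, hlog.trans_lt Nat.lt_two_pow_self, ?_, by omega, ?_, ?_, ?_⟩
  · exact (hk.trans (Nat.pow_le_pow_left hmH.le d)).trans_lt (hlt d (by omega))
  · calc m = m ^ 1 := (pow_one m).symm
      _ ≤ m ^ (d + 4) := Nat.pow_le_pow_right (by omega) (by omega)
      _ ≤ _ := Nat.le_mul_of_pos_left _ hc
  · refine (Nat.mul_le_mul hX hX).trans_lt ?_
    rw [← pow_add]
    exact hlt _ (by omega)
  · refine lt_of_le_of_lt ?_ (hlt 3 (by omega))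
    calc 8 * m ≤ H * H * H := Nat.mul_le_mul (by nlinarith) hmH.le
      _ = H ^ 3 := by ring

/-- `m ≥ 2` gives `log₂ m + 1 ≤ 2 log₂ m`, which absorbs the additive constants. -/
theorem space_le (R : RamAlgorithm) (s : ℕ) : ∃ C : ℝ, ∀ m L : ℕ, 2 ≤ m →
    L = s * (Nat.log 2 m + 1) → (R.space L L : ℝ) ≤ C * Real.log m ^ 2 := by
  set e : ℝ := R.pre.size + R.step.size
  refine ⟨(s + e) * s * (2 / Real.log 2) ^ 2, fun m L hm hL => ?_⟩
  have h2 : 0 < Real.log 2 := Real.log_pos one_lt_two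
  have he : 0 ≤ e := by positivity
  have h1 : ((Nat.log 2 m + 1 : ℕ) : ℝ) ≤ 2 / Real.log 2 * Real.log m := by
    have h3 : (Nat.log 2 m : ℝ) * Real.log 2 ≤ Real.log m := by
      rw [← Real.log_pow]
      exact Real.log_le_log (by positivity) (by exact_mod_cast Nat.pow_log_le_self 2 (by omega))
    have h4 : 1 ≤ Nat.log 2 m := Nat.log_pos one_lt_two hm
    have h5 : ((Nat.log 2 m + 1 : ℕ) : ℝ) ≤ 2 * Nat.log 2 m := by exact_mod_cast (by omega)
    refine h5.trans ?_
    rw [div_mul_eq_mul_div, le_div_iff₀ h2]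
    linarith
  set x : ℝ := ((Nat.log 2 m + 1 : ℕ) : ℝ) with hx
  have hx1 : 1 ≤ x := by rw [hx]; exact_mod_cast Nat.le_add_left 1 _
  have : (R.space L L : ℝ) = (s * x + e) * (s * x) := by
    simp only [RamAlgorithm.space, hL, hx, e]
    push_cast
    ring
  rw [this]
  have hsx : (s : ℝ) * x + e ≤ (s + e) * x := by nlinarith
  calc (s * x + e) * (s * x) ≤ ((s + e) * x) * (s * x) :=
        mul_le_mul_of_nonneg_right hsx (by positivity)
    _ = (s + e) * s * x ^ 2 := by ring
    _ ≤ (s + e) * s * (2 / Real.log 2 * Real.log m) ^ 2 := by gcongr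
    _ = _ := by ring

/-- `c ≥ 4 / (1 - p)` and the exponent `d + 4 ≥ 3` make the error `4 m³ / (c m ^ (d + 4))` at most
`1 - p`; the exponent also keeps the codes, of size up to `m ^ d + 1`, below the modulus. -/
theorem exists_ramAlgorithm_solves (d : ℕ) (p : ℝ) (hp : p < 1) :
    ∃ (R : RamAlgorithm) (s : ℕ) (C : ℝ), ∀ m L : ℕ, 2 ≤ m → L = s * (Nat.log 2 m + 1) →
      (R.space L L : ℝ) ≤ C * Real.log m ^ 2 ∧
      ∀ (k n : ℕ), k ≤ m ^ d → n ≤ m ^ d → ∀ Δ : Fin k → Fin n → Bool,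
        ¬ ContainsWildcard Δ → (R.toOnline L L m Δ).Solves Δ p := by
  obtain ⟨c, hc⟩ := exists_nat_ge (4 / (1 - p))
  have hp' : 0 < 1 - p := by linarith
  have hc0 : 0 < c := by
    have : (0 : ℝ) < c := lt_of_lt_of_le (by positivity) hc
    exact_mod_cast this
  obtain ⟨C, hC⟩ := space_le (streamingAlgorithm c (d + 4)) (2 * (2 * c + (d + 4)) + 192)
  refine ⟨streamingAlgorithm c (d + 4), 2 * (2 * c + (d + 4)) + 192, C, fun m L hm hL =>
    ⟨hC m L hm hL, fun k n hk hn Δ hΔ => ?_⟩⟩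
  have := (admissible_of_two_le hc0 hm hL hk hn).solves hΔ (q := 1 - p) ?_
  · rwa [sub_sub_cancel] at this
  · have h1 : 4 ≤ (1 - p) * c := by rwa [div_le_iff₀' hp'] at hc
    have h2 : (m : ℝ) ^ 3 ≤ (m : ℝ) ^ (d + 4) :=
      pow_le_pow_right₀ (by exact_mod_cast (by omega : 1 ≤ m)) (by omega)
    push_cast
    rw [← mul_assoc]
    exact mul_le_mul h1 h2 (by positivity) (by linarith)

/-! ### The two bounds together -/

theorem mainTheorem10 :
    -- Lower bound, for unrestricted classes over any alphabet with at least two letters,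
    -- and for every family of classes whose matching relation contains the wildcard matrix.
    (∀ p : ℝ, 1 / 2 < p → ∃ c : ℝ, 0 < c ∧
      (∀ (m : ℕ) (σ : Type*) [Nontrivial σ] (M : Type*) [Fintype M]
        (A : OnlineAlgorithm (Fin m → Set σ) σ M),
        A.Solves (classRel (id : Set σ → Set σ)) p →
          c * m ≤ Real.logb 2 (Fintype.card M)) ∧
      (∀ (m : ℕ) (κ : Type*) (σ : Type*) (cls : κ → Set σ),
        ContainsWildcard (classRel cls) →
        ∀ (M : Type*) [Fintype M] (A : OnlineAlgorithm (Fin m → κ) σ M),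
          A.Solves (classRel cls) p →
            c * m ≤ Real.logb 2 (Fintype.card M))) ∧
    -- Upper bound, for alphabets of size polynomial in the pattern length: a word-RAM algorithm
    -- that uses `O(log m)` words of `O(log m)` bits.
    (∀ (d : ℕ) (p : ℝ), p < 1 →
      ∃ (R : RamAlgorithm) (s : ℕ) (C : ℝ), ∀ m L : ℕ, 2 ≤ m → L = s * (Nat.log 2 m + 1) →
        (R.space L L : ℝ) ≤ C * Real.log m ^ 2 ∧
        ∀ (k n : ℕ), k ≤ m ^ d → n ≤ m ^ d → ∀ cls : Fin k → Set (Fin n),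
          ¬ ContainsWildcard (classRel cls) →
            (R.toOnline L L m (classRel cls)).Solves (classRel cls) p) := by

  -- With `δ = p - 1/2`, the constant is the exponent `2 δ²` of the random access code bound,
  -- converted to base 2.
  refine ⟨fun p hp => ⟨2 * (p - 1 / 2) ^ 2 / Real.log 2, ?_, ?_, ?_⟩, fun d p hp => ?_⟩
  · have h1 : 0 < p - 1 / 2 := by linarith
    have h2 : 0 < Real.log 2 := Real.log_pos one_lt_two
    positivity
  · intro m σ _ M _ A hA
    exact OnlineAlgorithm.Solves.le_logb_card containsWildcard_classRel_id
      (by linarith : 0 < p - 1 / 2) (by rwa [add_sub_cancel])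
  · intro m κ σ cls hcls M _ A hA
    exact OnlineAlgorithm.Solves.le_logb_card hcls
      (by linarith : 0 < p - 1 / 2) (by rwa [add_sub_cancel])
  · obtain ⟨R, s, C, h⟩ := exists_ramAlgorithm_solves d p hp
    exact ⟨R, s, C, fun m L hm hL => ⟨(h m L hm hL).1, fun k n hk hn cls =>
      (h m L hm hL).2 k n hk hn (classRel cls)⟩⟩
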